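/- For $m\ge 1$ consider walks of length $m$ on $\mathbb Z$, i.e. pairs $w=(p,s)$ of a starting point $p\in\mathbb Z$ and steps $s_1,\dots,s_m\in\{1,-1\}$, with points $p_i=p+\sum_{j\le i}s_j$ $(0\le i\le m)$; $w$ is closed if $p_m=p_0$. The multiplicity of $q\in\mathbb Z$ with respect to $w$ is $\mathrm{mu}(q,w)=\delta_{q,p_0}+\delta_{q,p_m}+2\sum_{i=1}^{m-1}\delta_{q,p_i}$, and for $k\ge 1$ and closed $w$ let $N_{2k}(w)=\#\{q\in\mathbb Z:\mathrm{mu}(q,w)=2k\}$, the number of points visited exactly $k$ times. Let $E_n$ denote the average over all closed walks of length $2n$ that start at $0$, all equally likely. Then for all fixed integers $k_1,k_2\ge 1$, as $n\to\infty$, $$ \begin{aligned} E_n\bigl(N_{2k_1}N_{2k_2}\bigr)={}&\delta_{k_1,k_2}+\frac12+2\sum_{r_1=1}^{k_1}\sum_{r_2=1}^{k_2}\binom{k_1-1}{r_1-1}\binom{k_2-1}{r_2-1}(-1)^{r_1+r_2}\binom{r_1+r_2}{r_1}\frac1{2^{r_1+r_2}}\\ &\cdot\left(\frac{k_1+k_2-r_1-r_2}{r_1+r_2}\,\zeta(r_1+r_2)+\frac{\binom{r_1}2+\binom{r_2}2}{\binom{r_1+r_2}2}\,Z(r_1+r_2)\right)+O\!\left(\frac1n\right),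 \end{aligned} $$ where $\zeta$ is the Riemann zeta function, $Z(2)=0$ and $Z(r)=\zeta(r-1)$ for $r\ge 3$; the constant implied by $O(1/n)$ may depend on $k_1$ and $k_2$. -/

import Mathlib

namespace ClosedSRW

/-- A nearest-neighbour walk of length `m` on `ℤ`: a starting point and `m` steps, each `1` or `-1`. -/
abbrev Walk (m : ℕ) : Type := ℤ × (Fin m → ℤˣ)

/-- The `i`-th point of the walk, i.e. the starting point plus the first `i` steps. -/
def point {m : ℕ} (w : Walk m) (i : ℕ) : ℤ :=
  w.1 + ∑ j ∈ Finset.univ.filter (fun j : Fin m => j.val < i), (w.2 j : ℤ)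

/-- The walk ends where it starts. -/
def Closes {m : ℕ} (w : Walk m) : Prop := point w m = point w 0

instance {m : ℕ} (w : Walk m) : Decidable (Closes w) :=
  inferInstanceAs (Decidable (point w m = point w 0))

/-- The multiplicity of `q` with respect to `w`: the number of incoming plus outgoing steps of `w`
at `q`. -/
def mult {m : ℕ} (q : ℤ) (w : Walk m) : ℕ :=
  (if q = point w 0 then 1 else 0) + (if q = point w m then 1 else 0)
    + 2 * ∑ i ∈ Finset.Ioo 0 m, (if q = point w i then 1 else 0)

/-- `multRange k w` is `N_{2k}(w)`, the number of points whose multiplicity is `2k`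
(for closed `w` of positive length: the points visited exactly `k` times). -/
noncomputable def multRange {m : ℕ} (k : ℕ) (w : Walk m) : ℕ :=
  Set.ncard {q : ℤ | mult q w = 2 * k}

/-- The closed walks of length `m` starting (and ending) at `0`. -/
def closedWalks (m : ℕ) : Finset (Walk m) :=
  (({0} : Finset ℤ) ×ˢ (Finset.univ : Finset (Fin m → ℤˣ))).filter Closes

/-- `expect n X` is `E_n(X)`, the mean of `X` over all closed walks of length `2n` starting at `0`,
all equally likely. -/
noncomputable def expect (n : ℕ) (X : Walk (2 * n) → ℝ) : ℝ :=
  (∑ w ∈ closedWalks (2 * n), X w) / ((closedWalks (2 * n)).card : ℝ)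

end ClosedSRW

/-! ### Walks with prescribed numbers of visits, and their first step equations. -/

namespace ClosedSRW

open Finset

/-! Rotating a closed walk preserves closedness and every `N_{2k}`. Hence `k₁ ∑ N_{2k₁} N_{2k₂}` is
`2n` times the number of pairs of a closed walk at `0` and a point `q` such that the walk visits `0`
exactly `k₁` times and `q` exactly `k₂` times (`mul_sum_multRange`). The case `q = 0` gives the
Kronecker delta, the cases `q = ±d` all the rest.

In the variable `z = u / (1 + u ^ 2)` the generating functions of these counts are rational in `u`,
and `dz / z = cayley (u ^ 2) du / u` turns coefficient extraction into a circle average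
(`walkCount_one`, `walkCount_two`). Put `t = u ^ 2 = exp (-v)`, `s = cayley t = tanh (v / 2)` and `X
= 1 / (1 - t ^ d)`. An excursion from one of the two points to itself has weight `1 - s X`, and two
crossings together have weight `s ^ 2 X (X - 1)`. The sum over `d` is thus a combination of terms `s
^ (p + q) ∑_d X ^ p (X - 1) ^ q`. Each product `X ^ p (X - 1) ^ q` is a combination of derivatives
of `1 / (exp w - 1)` at `w = d v`. Their polar parts sum to zeta values, their regular parts are
summed by the trapezoidal rule, and an expansion `α + β s + γ s ^ 2 + O(v ^ 3)` results
(`hasExp_pairSum`).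

Let `C` be the central binomial coefficient, which is the number of closed walks. Against the kernel
`ker n` the functions `1`, `s`, `s ^ 2` average to `0`, `-C / (2n - 1)`, `0` for `n ≥ 2`. On the
circle of radius `exp (-1 / √n)` the remainder averages to `O(4 ^ n n ^ (-5/2)) = O(C / n ^ 2)`
(`exists_norm_circleAverage_le`). After multiplication by `2n / C` only `-β` and an error `O(1 / n)`
survive (`exists_norm_expect_sub_le`). Binomial identities, chiefly `sum_choose_telescope`, bring
`β` into the stated form. -/

/-- The number of times `i < m` at which the walk is at a point of `S`. -/
def visits {m : ℕ} (S : ℤ → Prop) [DecidablePred S] (w : Walk m) : ℕ :=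
  #{i ∈ range m | S (point w i)}

/-- The number of walks of length `m` from `a` to `0` with `i` visits to `0` and `j` visits to `S`,
the end point not being counted. -/
def walkCount (m : ℕ) (a : ℤ) (S : ℤ → Prop) [DecidablePred S] (i j : ℕ) : ℕ :=
  #{s : Fin m → ℤˣ | point (a, s) m = 0 ∧ visits (· = 0) (a, s) = i ∧ visits S (a, s) = j}

theorem point_zero {m : ℕ} (w : Walk m) : point w 0 = w.1 := by simp [point]

theorem point_succ {m : ℕ} (w : Walk m) (i : ℕ) (hi : i < m) :
    point w (i + 1) = point w i + w.2 ⟨i, hi⟩ := by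
  have : (univ.filter fun j : Fin m => j.val < i + 1)
      = insert ⟨i, hi⟩ (univ.filter fun j : Fin m => j.val < i) := by
    ext j
    simp only [mem_filter, mem_univ, true_and, mem_insert, Fin.ext_iff]
    omega
  rw [point, this, sum_insert (by simp), point]
  ring

theorem point_cons_succ {m : ℕ} (a : ℤ) (e : ℤˣ) (s : Fin m → ℤˣ) (i : ℕ) :
    point (m := m + 1) (a, Fin.cons e s) (i + 1) = point (a + e, s) i := by
  simp only [point, sum_filter, Fin.sum_univ_succ, Fin.cons_zero, Fin.cons_succ, Fin.val_zero,
    Fin.val_succ]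
  simp [add_assoc]

theorem visits_cons {m : ℕ} (S : ℤ → Prop) [DecidablePred S] (a : ℤ) (e : ℤˣ) (s : Fin m → ℤˣ) :
    visits (m := m + 1) S (a, Fin.cons e s)
      = (if S a then 1 else 0) + visits S (a + e, s) := by
  simp only [visits, card_filter, sum_range_succ', point_cons_succ, point_zero]
  ring

theorem walkCount_zero (a : ℤ) (S : ℤ → Prop) [DecidablePred S] (i j : ℕ) :
    walkCount 0 a S i j = if a = 0 ∧ i = 0 ∧ j = 0 then 1 else 0 := by
  have h : ∀ s : Fin 0 → ℤˣ, (point (a, s) 0 = 0 ∧ visits (· = 0) (a, s) = i ∧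
      visits S (a, s) = j) ↔ (a = 0 ∧ i = 0 ∧ j = 0) := by
    intro s
    simp [point, visits, eq_comm]
  unfold walkCount
  simp only [h]
  split_ifs with h' <;> simp [h']

/-- Conditioning on the first step. The indicators are added to `i` and `j` to avoid truncated
subtraction; the counts not of this form are treated in `walkCount_succ_eq_zero`. -/
theorem walkCount_succ (m : ℕ) (a : ℤ) (S : ℤ → Prop) [DecidablePred S] (i j : ℕ) :
    walkCount (m + 1) a S (i + if a = 0 then 1 else 0) (j + if S a then 1 else 0)
      = walkCount m (a + 1) S i j + walkCount m (a - 1) S i j := by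
  unfold walkCount
  simp only [card_filter]
  rw [← Equiv.sum_comp (Fin.consEquiv fun _ => ℤˣ), Fintype.sum_prod_type,
    show (univ : Finset ℤˣ) = {1, -1} from rfl, sum_pair (by decide)]
  have h : ∀ p : ℤˣ × (Fin m → ℤˣ),
      (Fin.consEquiv fun _ => ℤˣ) p = (Fin.cons p.1 p.2 : Fin (m + 1) → ℤˣ) := fun _ => rfl
  simp only [h, visits_cons, point_cons_succ, sub_eq_add_neg, Units.val_one,
    Units.val_neg, add_comm i, add_comm j, Nat.add_left_cancel_iff]

theorem walkCount_succ_eq_zero (m : ℕ) (a : ℤ) (S : ℤ → Prop) [DecidablePred S] (i j : ℕ)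
    (h : ¬((if a = 0 then 1 else 0) ≤ i ∧ (if S a then 1 else 0) ≤ j)) :
    walkCount (m + 1) a S i j = 0 := by
  unfold walkCount
  rw [card_eq_zero, filter_eq_empty_iff]
  intro s _ hs
  rw [← Fin.cons_self_tail s, visits_cons, visits_cons] at hs
  apply h
  omega

/-! ### Rotation of closed walks -/

/-- Rotating the sequence of steps by one. -/
def rotate {m : ℕ} : (Fin m → ℤˣ) ≃ (Fin m → ℤˣ) := (finRotate m).symm.arrowCongr (Equiv.refl _)

theorem rotate_apply {m : ℕ} (s : Fin m → ℤˣ) (i : Fin m) : rotate s i = s (finRotate m i) := rfl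

theorem point_eq_sum {m : ℕ} (w : Walk m) : point w m = w.1 + ∑ j, (w.2 j : ℤ) := by
  simp [point]

theorem point_rotate_self {m : ℕ} (s : Fin m → ℤˣ) : point (0, rotate s) m = point (0, s) m := by
  rw [point_eq_sum, point_eq_sum]
  simp only [rotate_apply]
  rw [Equiv.sum_comp (finRotate m) fun j => (s j : ℤ)]

theorem point_rotate {m : ℕ} (s : Fin (m + 1) → ℤˣ) (i : ℕ) (hi : i ≤ m) : point (0, rotate s) i = point (0, s) (i + 1) - s 0 := by
  induction i with
  | zero => rw [point_zero, point_succ _ _ (Nat.succ_pos m), point_zero]; simp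
  | succ i ih =>
    have h : rotate s ⟨i, by omega⟩ = s ⟨i + 1, by omega⟩ := by
      rw [rotate_apply, finRotate_of_lt (by omega)]
    rw [point_succ _ _ (by omega), ih (by omega), point_succ _ (i + 1) (by omega)]
    simp only [h]
    ring

/-- Shifting the time window trades time `0` for time `m`, and these agree for a closed walk. -/
theorem card_filter_range_succ {m : ℕ} (P : ℕ → Prop) [DecidablePred P] (h : P 0 ↔ P m) :
    #{i ∈ range m | P (i + 1)} = #{i ∈ range m | P i} := by
  have h1 := sum_range_succ (fun i => if P i then 1 else 0) m
  have h2 := sum_range_succ' (fun i => if P i then 1 else 0) m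
  simp only [card_filter]
  simp only [h] at h2
  omega

theorem visits_rotate {m : ℕ} (s : Fin (m + 1) → ℤˣ) (hs : point (0, s) (m + 1) = 0) (q : ℤ) :
    visits (· = q) (0, rotate s) = visits (· = q + s 0) (0, s) := by
  unfold visits
  rw [← card_filter_range_succ (fun i => point (0, s) i = q + s 0) (by rw [hs, point_zero])]
  congr 1
  apply filter_congr
  intro i hi
  rw [point_rotate s i (by simp at hi; omega)]
  omega

theorem abs_point_le {m : ℕ} (s : Fin m → ℤˣ) (i : ℕ) (hi : i ≤ m) : |point (0, s) i| ≤ i := by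
  induction i with
  | zero => simp [point_zero]
  | succ i ih =>
    rw [point_succ _ _ (by omega)]
    have h1 := ih (by omega)
    have h2 : |((s ⟨i, hi⟩ : ℤˣ) : ℤ)| = 1 := Int.isUnit_iff_abs_eq.1 (Units.isUnit _)
    push_cast
    exact (abs_add_le _ _).trans (by simp only [h2]; linarith)

theorem mult_eq {m : ℕ} (hm : 1 ≤ m) (w : Walk m) (hw : Closes w) (q : ℤ) :
    mult q w = 2 * visits (· = q) w := by
  have h : range m = insert 0 (Ioo 0 m) := by ext; simp; omega
  have hw' : point w m = point w 0 := hw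
  rw [mult, visits, card_filter, h, sum_insert (by simp), hw']
  simp only [eq_comm (a := q)]
  ring

theorem setOf_mult_eq {m : ℕ} (hm : 1 ≤ m) (s : Fin m → ℤˣ) (hs : Closes (0, s)) (k : ℕ)
    (hk : 1 ≤ k) : {q : ℤ | mult q (0, s) = 2 * k}
      = ({q ∈ Icc (-m : ℤ) m | visits (· = q) (0, s) = k} : Finset ℤ) := by
  ext q
  simp only [Set.mem_ofPred_eq, coe_filter, mem_Icc, mult_eq hm _ hs]
  refine ⟨fun h => ⟨?_, by omega⟩, fun h => by omega⟩
  have h1 : 0 < visits (· = q) (0, s) := by omega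
  obtain ⟨i, hi⟩ := card_pos.1 h1
  simp only [mem_filter, mem_range] at hi
  have h2 := abs_point_le s i hi.1.le
  rw [hi.2, abs_le] at h2
  omega

theorem multRange_eq {m : ℕ} (hm : 1 ≤ m) (s : Fin m → ℤˣ) (hs : Closes (0, s)) (k : ℕ)
    (hk : 1 ≤ k) : multRange k (0, s)
      = ∑ q ∈ Icc (-m : ℤ) m, if visits (· = q) (0, s) = k then 1 else 0 := by
  rw [multRange, setOf_mult_eq hm s hs k hk, Set.ncard_coe_finset, card_filter]

theorem closes_iff {m : ℕ} (s : Fin m → ℤˣ) : Closes (0, s) ↔ point (0, s) m = 0 := by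
  rw [Closes, point_zero]

theorem multRange_rotate {m : ℕ} (s : Fin (m + 1) → ℤˣ) (hs : Closes (0, s)) (k : ℕ) :
    multRange k (0, rotate s) = multRange k (0, s) := by
  have h0 : point (0, s) (m + 1) = 0 := (closes_iff s).1 hs
  have hr : Closes (0, rotate s) := by rw [closes_iff, point_rotate_self, h0]
  unfold multRange
  have : {q : ℤ | mult q (0, rotate s) = 2 * k}
      = (Equiv.addRight ((s 0 : ℤˣ) : ℤ)) ⁻¹' {q : ℤ | mult q (0, s) = 2 * k} := by
    ext q
    simp [mult_eq (Nat.succ_pos m) _ hs, mult_eq (Nat.succ_pos m) _ hr, visits_rotate s h0]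
  rw [this, Set.ncard_preimage_of_injective_subset_range (Equiv.injective _)
    (by rw [(Equiv.addRight _).surjective.range_eq]; exact Set.subset_univ _)]

/-- Double counting: a point visited `k` times is the current position at exactly `k` times `i`. -/
theorem mul_multRange {m : ℕ} (hm : 1 ≤ m) (s : Fin m → ℤˣ) (hs : Closes (0, s)) (k : ℕ)
    (hk : 1 ≤ k) : k * multRange k (0, s)
      = ∑ i ∈ range m, if visits (· = point (0, s) i) (0, s) = k then 1 else 0 := by
  have h1 : ∀ i ∈ range m, (if visits (· = point (0, s) i) (0, s) = k then 1 else 0)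
      = ∑ q ∈ Icc (-m : ℤ) m, if point (0, s) i = q then
        (if visits (· = q) (0, s) = k then 1 else 0) else 0 := by
    intro i hi
    rw [mem_range] at hi
    have h2 := abs_point_le s i hi.le
    rw [abs_le] at h2
    have h3 : point (0, s) i ∈ Icc (-m : ℤ) m := by rw [mem_Icc]; omega
    simp only [sum_ite_eq, h3, if_true]
  rw [sum_congr rfl h1, sum_comm, multRange_eq hm s hs k hk, mul_sum]
  refine sum_congr rfl fun q _ => ?_
  rw [← sum_filter, sum_const, smul_eq_mul]
  split_ifs with h
  · rw [← h]; rfl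
  · simp

theorem sum_closedWalks {m : ℕ} {R : Type*} [AddCommMonoid R] (F : Walk m → R) :
    ∑ w ∈ closedWalks m, F w = ∑ s : Fin m → ℤˣ, if Closes (0, s) then F (0, s) else 0 := by
  rw [closedWalks, sum_filter, sum_product]
  simp

/-- Rotation permutes the closed walks and moves the marked time by one, so the marked time may be
taken to be `0`. -/
theorem sum_rotate {m : ℕ} (k k' : ℕ) (i : ℕ) (hi : i ≤ m) :
    (∑ s : Fin (m + 1) → ℤˣ, if Closes (0, s) then
      (if visits (· = point (0, s) i) (0, s) = k then 1 else 0) * multRange k' (0, s) else 0)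
    = ∑ s : Fin (m + 1) → ℤˣ, if Closes (0, s) then
      (if visits (· = 0) (0, s) = k then 1 else 0) * multRange k' (0, s) else 0 := by
  induction i with
  | zero => simp [point_zero]
  | succ i ih =>
    rw [← ih (by omega)]
    conv_rhs => rw [← Equiv.sum_comp rotate]
    refine sum_congr rfl fun s _ => ?_
    have hc : Closes (0, rotate s) ↔ Closes (0, s) := by
      rw [closes_iff, closes_iff, point_rotate_self]
    simp only [hc]
    by_cases h : Closes (0, s)
    · rw [multRange_rotate s h, visits_rotate s ((closes_iff s).1 h),
        point_rotate s i (by omega)]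
      simp
    · simp [h]

theorem point_neg {m : ℕ} (s : Fin m → ℤˣ) (i : ℕ) : point (0, -s) i = - point (0, s) i := by
  simp [point]

theorem visits_neg {m : ℕ} (s : Fin m → ℤˣ) (q : ℤ) :
    visits (· = q) (0, -s) = visits (· = -q) (0, s) := by
  simp only [visits, point_neg, neg_eq_iff_eq_neg]

theorem walkCount_neg (m : ℕ) (d : ℤ) (i j : ℕ) :
    walkCount m 0 (· = -d) i j = walkCount m 0 (· = d) i j := by
  unfold walkCount
  simp only [card_filter]
  rw [← Equiv.sum_comp (Equiv.neg (Fin m → ℤˣ))]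
  simp [point_neg, visits_neg]

theorem walkCount_diag (m : ℕ) (i j : ℕ) :
    walkCount m 0 (· = 0) i j = if i = j then walkCount m 0 (fun _ => False) i 0 else 0 := by
  unfold walkCount
  split_ifs with h
  · subst h
    congr 1
    ext s
    simp [visits]
  · rw [card_eq_zero, filter_eq_empty_iff]
    rintro s _ ⟨-, h1, h2⟩
    exact h (h1.symm.trans h2)

theorem sum_Icc_neg {M : Type*} [AddCommMonoid M] (m : ℕ) (f : ℤ → M) (hf : ∀ q, f (-q) = f q) :
    ∑ q ∈ Icc (-m : ℤ) m, f q = f 0 + 2 • ∑ d ∈ Icc 1 m, f d := by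
  induction m with
  | zero => simp
  | succ m ih =>
    have h : Icc (-(m + 1 : ℕ) : ℤ) ((m + 1 : ℕ) : ℤ)
        = insert (-(m + 1 : ℕ) : ℤ) (insert ((m + 1 : ℕ) : ℤ) (Icc (-m : ℤ) m)) := by
      ext q; simp; omega
    rw [h, sum_insert (by simp; omega), sum_insert (by simp), ih, hf,
      sum_Icc_succ_top (by omega), smul_add, two_nsmul (f _)]
    abel

/-- The second moment sum in terms of walks from `0` to `0` with prescribed numbers of visits. -/
theorem mul_sum_multRange {m : ℕ} (hm : 1 ≤ m) (k₁ k₂ : ℕ) (hk₁ : 1 ≤ k₁) (hk₂ : 1 ≤ k₂) :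
    k₁ * ∑ w ∈ closedWalks m, multRange k₁ w * multRange k₂ w
      = m * ((if k₁ = k₂ then walkCount m 0 (fun _ => False) k₁ 0 else 0)
        + 2 * ∑ d ∈ Icc 1 m, walkCount m 0 (· = (d : ℤ)) k₁ k₂) := by
  obtain ⟨m, rfl⟩ : ∃ n, m = n + 1 := ⟨m - 1, by omega⟩
  have h1 : k₁ * ∑ w ∈ closedWalks (m + 1), multRange k₁ w * multRange k₂ w
      = ∑ i ∈ range (m + 1), ∑ s : Fin (m + 1) → ℤˣ, if Closes (0, s) then
        (if visits (· = point (0, s) i) (0, s) = k₁ then 1 else 0) * multRange k₂ (0, s)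
        else 0 := by
    rw [sum_comm, sum_closedWalks, mul_sum]
    refine sum_congr rfl fun s _ => ?_
    split_ifs with h
    · rw [← sum_mul, ← mul_multRange hm s h k₁ hk₁, mul_assoc]
    · simp
  rw [h1, sum_congr rfl fun i hi => sum_rotate k₁ k₂ i (by simp at hi; omega), sum_const,
    card_range, smul_eq_mul]
  congr 1
  have h2 : (∑ s : Fin (m + 1) → ℤˣ, if Closes (0, s) then
      (if visits (· = 0) (0, s) = k₁ then 1 else 0) * multRange k₂ (0, s) else 0)
      = ∑ q ∈ Icc (-(m + 1 : ℕ) : ℤ) ((m + 1 : ℕ) : ℤ), walkCount (m + 1) 0 (· = q) k₁ k₂ := by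
    simp only [walkCount, card_filter]
    rw [sum_comm]
    refine sum_congr rfl fun s _ => ?_
    by_cases h : Closes (0, s)
    · rw [if_pos h, multRange_eq hm s h k₂ hk₂, mul_sum]
      refine sum_congr rfl fun q _ => ?_
      rw [closes_iff] at h
      simp only [h, true_and, ite_and]
      split_ifs <;> simp
    · rw [if_neg h]
      rw [closes_iff] at h
      simp [h]
  rw [h2, sum_Icc_neg _ _ (fun q => walkCount_neg _ _ _ _), walkCount_diag, smul_eq_mul]

end ClosedSRW

/-! ### Walk counts as circle averages of generating functions. -/

namespace ClosedSRW

open Finset Real Metric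

/-- The Cayley transform `(1 - t) / (1 + t)`. -/
noncomputable def cayley (t : ℂ) : ℂ := (1 - t) / (1 + t)

theorem one_add_ne_zero {t : ℂ} (ht : ‖t‖ < 1) : 1 + t ≠ 0 := by
  intro h
  have h1 : t = -1 := by linear_combination h
  rw [h1] at ht
  simp at ht

theorem one_sub_ne_zero {t : ℂ} (ht : ‖t‖ < 1) : 1 - t ≠ 0 := by
  intro h
  have h1 : t = 1 := by linear_combination -h
  rw [h1] at ht
  simp at ht

theorem norm_pow_lt_one {u : ℂ} (hu : ‖u‖ < 1) {d : ℕ} (hd : d ≠ 0) : ‖u ^ d‖ < 1 := by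
  rw [norm_pow]
  exact pow_lt_one₀ (norm_nonneg _) hu hd

theorem one_add_sq_ne_zero {u : ℂ} (hu : ‖u‖ < 1) : 1 + u ^ 2 ≠ 0 :=
  one_add_ne_zero (norm_pow_lt_one hu two_ne_zero)

/-- With `z = (u + u⁻¹)⁻¹` one has `dz / z = cayley (u ^ 2) du / u`, so the integral is that of `z ^
(-m - 2) dz`, which has a single-valued primitive. -/
theorem circleAverage_kernel {r : ℝ} (hr : 0 < r) (hr1 : r < 1) (m : ℕ) :
    circleAverage (fun u => cayley (u ^ 2) * (u + u⁻¹) ^ (m + 1)) 0 r = 0 := by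
  rw [circleAverage_eq_circleIntegral hr.ne']
  suffices h : (∮ z in C(0, r), (z - 0)⁻¹ • (cayley (z ^ 2) * (z + z⁻¹) ^ (m + 1))) = 0 by
    rw [h, smul_zero]
  apply circleIntegral.integral_eq_zero_of_hasDerivWithinAt hr.le
    (f := fun u => -(u + u⁻¹) ^ (m + 1) / (m + 1))
  intro u hu
  rw [mem_sphere_zero_iff_norm] at hu
  have hu0 : u ≠ 0 := by
    rintro rfl
    simp at hu
    exact hr.ne hu
  have hu2 : 1 + u ^ 2 ≠ 0 := one_add_sq_ne_zero (hu ▸ hr1)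
  have h1 : HasDerivAt (fun u : ℂ => u + u⁻¹) (1 + -(u ^ 2)⁻¹) u :=
    (hasDerivAt_id u).add (hasDerivAt_inv hu0)
  have h2 := ((h1.fun_pow (m + 1)).fun_neg.div_const ((m : ℂ) + 1)).hasDerivWithinAt (s := sphere 0 r)
  convert h2 using 1
  have hm : (m : ℂ) + 1 ≠ 0 := by exact_mod_cast Nat.succ_ne_zero m
  have h3 : u + u⁻¹ = (1 + u ^ 2) / u := by field_simp; ring
  have h4 : 1 + -(u ^ 2)⁻¹ = -((1 - u ^ 2) / u ^ 2) := by field_simp; ring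
  rw [h4, pow_succ (u + u⁻¹)]
  nth_rewrite 2 [h3]
  simp only [cayley, smul_eq_mul, sub_zero, Nat.add_sub_cancel]
  push_cast
  field_simp

/-- Walk counts as circle averages of a solution of the first step equations. -/
theorem walkCount_eq_circleAverage {r : ℝ} (hr : 0 < r) (hr1 : r < 1) (S : ℤ → Prop)
    [DecidablePred S] (g : ℤ → ℕ → ℕ → ℂ → ℂ)
    (hd : ∀ a i j, DifferentiableOn ℂ (g a i j) (ball 0 1))
    (h0 : ∀ a i j, g a i j 0 = if a = 0 ∧ i = 0 ∧ j = 0 then 1 else 0)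
    (hstep : ∀ a i j (u : ℂ), ‖u‖ < 1 → u ≠ 0 →
      (u + u⁻¹) * g a (i + if a = 0 then 1 else 0) (j + if S a then 1 else 0) u
        = g (a + 1) i j u + g (a - 1) i j u)
    (hedge : ∀ a i j, ¬((if a = 0 then 1 else 0) ≤ i ∧ (if S a then 1 else 0) ≤ j) →
      ∃ c : ℂ, ∀ u, g a i j u = c)
    (m : ℕ) (a : ℤ) (i j : ℕ) :
    (walkCount m a S i j : ℂ)
      = circleAverage (fun u => g a i j u * (cayley (u ^ 2) * (u + u⁻¹) ^ m)) 0 r := by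
  have hdc : DifferentiableOn ℂ (fun u => cayley (u ^ 2)) (ball 0 1) := by
    intro u hu
    rw [mem_ball_zero_iff] at hu
    unfold cayley
    have := one_add_sq_ne_zero hu
    fun_prop (disch := assumption)
  have hu0 : ∀ u ∈ sphere (0 : ℂ) r, ‖u‖ < 1 ∧ u ≠ 0 := by
    intro u hu
    rw [mem_sphere_zero_iff_norm] at hu
    refine ⟨hu ▸ hr1, ?_⟩
    rintro rfl
    simp at hu
    exact hr.ne hu
  have hci : ∀ m a i j, CircleIntegrable
      (fun u => g a i j u * (cayley (u ^ 2) * (u + u⁻¹) ^ m)) 0 r := by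
    intro m a i j
    apply ContinuousOn.circleIntegrable hr.le
    have hs : sphere (0 : ℂ) r ⊆ ball 0 1 := fun u hu => by simpa using (hu0 u hu).1
    refine ((hd a i j).continuousOn.mono hs).mul ((hdc.continuousOn.mono hs).mul ?_)
    refine ContinuousOn.pow (continuousOn_id.add (continuousOn_id.inv₀ ?_)) m
    exact fun u hu => (hu0 u hu).2
  induction m generalizing a i j with
  | zero =>
    -- For `m = 0` the mean value property reads off the value of `g` at the centre, as `cayley 0 =
    -- 1`.
    have hD : DifferentiableOn ℂ (fun u => g a i j u * (cayley (u ^ 2) * (u + u⁻¹) ^ 0))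
        (ball 0 1) := by
      simpa using (hd a i j).fun_mul hdc
    have hD' : DiffContOnCl ℂ (fun u => g a i j u * (cayley (u ^ 2) * (u + u⁻¹) ^ 0))
        (ball 0 |r|) := by
      rw [abs_of_pos hr]
      exact hD.diffContOnCl_ball (closedBall_subset_ball hr1)
    rw [hD'.circleAverage, walkCount_zero, h0]
    simp [cayley]
  | succ m ih =>
    by_cases h : (if a = 0 then 1 else 0) ≤ i ∧ (if S a then 1 else 0) ≤ j
    · obtain ⟨i', hi⟩ := Nat.exists_eq_add_of_le' h.1
      obtain ⟨j', hj⟩ := Nat.exists_eq_add_of_le' h.2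
      rw [hi, hj, walkCount_succ, Nat.cast_add, ih, ih, ← circleAverage_fun_add (hci _ _ _ _)
        (hci _ _ _ _)]
      apply circleAverage_congr_sphere
      intro u hu
      rw [abs_of_pos hr] at hu
      have := hstep a i' j' u (hu0 u hu).1 (hu0 u hu).2
      simp only
      rw [pow_succ (u + u⁻¹)]
      linear_combination (-cayley (u ^ 2) * (u + u⁻¹) ^ m) * this
    -- The visit at time `0` already exceeds a prescribed number: the count is `0`, and a constant
    -- `g` averages to `0` against the kernel.
    · obtain ⟨c, hc⟩ := hedge a i j h
      rw [walkCount_succ_eq_zero _ _ _ _ _ h]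
      simp only [hc]
      have := circleAverage_fun_smul (a := c) (f := fun u => cayley (u ^ 2) * (u + u⁻¹) ^ (m + 1))
        (c := 0) (R := r)
      simp only [smul_eq_mul] at this
      rw [this, circleAverage_kernel hr hr1]
      simp

/-! ### One marked point -/

theorem step_pow {u : ℂ} (hu : u ≠ 0) (n : ℕ) :
    (u + u⁻¹) * u ^ (n + 1) = u ^ (n + 2) + u ^ n := by
  field_simp
  ring

/-- The passage from `a` to `0` has weight `u ^ |a|`, and each visit to `0` starts one excursion, of
weight `2 u / (u + u⁻¹) = 1 - cayley (u ^ 2)`. -/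
theorem walkCount_one {r : ℝ} (hr : 0 < r) (hr1 : r < 1) (m k : ℕ) :
    (walkCount m 0 (fun _ => False) k 0 : ℂ)
      = circleAverage (fun u => (1 - cayley (u ^ 2)) ^ k *
          (cayley (u ^ 2) * (u + u⁻¹) ^ m)) 0 r := by
  have hdc : ∀ u ∈ ball (0 : ℂ) 1, 1 + u ^ 2 ≠ 0 := fun u hu =>
    one_add_sq_ne_zero (by simpa using hu)
  rw [walkCount_eq_circleAverage hr hr1 (fun _ => False)
    (fun a i j u => if j = 0 then u ^ a.natAbs * (1 - cayley (u ^ 2)) ^ i else 0)]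
  · simp
  · intro a i j
    by_cases hj : j = 0
    · simp only [hj, if_true, cayley]
      intro u hu
      have := hdc u hu
      fun_prop (disch := assumption)
    · simp only [hj, if_false]
      fun_prop
  · intro a i j
    by_cases ha : a = 0 <;> by_cases hi : i = 0 <;> by_cases hj : j = 0 <;>
      simp [ha, hi, hj, cayley]
  · intro a i j u hu hu0
    simp only [if_false, add_zero]
    split_ifs with hj ha
    · subst ha
      have h2 : 1 + u ^ 2 ≠ 0 := one_add_sq_ne_zero hu
      have h3 : (u + u⁻¹) * (1 - cayley (u ^ 2)) = 2 * u := by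
        rw [cayley]; field_simp; ring
      simp only [Int.natAbs_zero, pow_zero, zero_add, zero_sub, Int.natAbs_neg, Int.natAbs_one,
        pow_one, one_mul, pow_succ (1 - cayley (u ^ 2))]
      linear_combination (1 - cayley (u ^ 2)) ^ i * h3
    · rw [add_zero]
      obtain ⟨n, hn | hn⟩ : ∃ n : ℕ, a = n + 1 ∨ a = -(n + 1 : ℕ) := ⟨a.natAbs - 1, by omega⟩
      · have e1 : a.natAbs = n + 1 := by omega
        have e2 : (a + 1).natAbs = n + 2 := by omega
        have e3 : (a - 1).natAbs = n := by omega
        rw [e1, e2, e3]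
        linear_combination (1 - cayley (u ^ 2)) ^ i * step_pow hu0 n
      · have e1 : a.natAbs = n + 1 := by omega
        have e2 : (a + 1).natAbs = n := by omega
        have e3 : (a - 1).natAbs = n + 2 := by omega
        rw [e1, e2, e3]
        linear_combination (1 - cayley (u ^ 2)) ^ i * step_pow hu0 n
    · simp
  · intro a i j h
    by_cases hj : j = 0
    · simp only [if_false, zero_le, and_true, not_le] at h
      split_ifs at h with ha
      · refine ⟨1, fun u => ?_⟩
        have : i = 0 := by omega
        simp [hj, ha, this]
      · omega
    · exact ⟨0, fun u => by simp [hj]⟩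

end ClosedSRW

/-! ### Weights of words in two letters, for the successive visits to two marked points. -/

namespace ClosedSRW

open Finset Real Metric

/-- The term `C(i, l) A ^ (i - l)` of the binomial expansion. -/
def binomTerm {R : Type*} [CommRing R] (A : R) (i l : ℕ) : R := i.choose l * A ^ (i - l)

/-- The weight of the words that start with the first letter, contain `i` first and `j` second
letters, and return cyclically: equal neighbours have weight `A`, distinct ones `b`. -/
def returnWeight {R : Type*} [CommRing R] (A b : R) (i : ℕ) : ℕ → R
  | 0 => A ^ i
  | j + 1 => ∑ l ∈ range (j + 1), binomTerm A i (l + 1) * binomTerm A j l * b ^ (2 * l + 2)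

/-- The same as `returnWeight`, for words that start with the second letter and are followed by
the first one. -/
def crossWeight {R : Type*} [CommRing R] (A b : R) (i : ℕ) : ℕ → R
  | 0 => 0
  | j + 1 => ∑ l ∈ range (j + 1), binomTerm A i l * binomTerm A j l * b ^ (2 * l + 1)

section weights

variable {R : Type*} [CommRing R] (A b : R)

theorem binomTerm_succ_succ (i l : ℕ) :
    binomTerm A (i + 1) (l + 1) = A * binomTerm A i (l + 1) + binomTerm A i l := by
  unfold binomTerm
  rw [Nat.choose_succ_succ, Nat.add_sub_add_right]
  rcases lt_or_ge l i with h | h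
  · obtain ⟨k, rfl⟩ : ∃ k, i = l + 1 + k := ⟨i - (l + 1), by omega⟩
    rw [show l + 1 + k - l = k + 1 by omega, show l + 1 + k - (l + 1) = k by omega]
    push_cast
    ring
  -- Here the exponent `i - (l + 1)` is truncated, but its binomial coefficient vanishes.
  · rw [Nat.choose_eq_zero_of_lt (show i < l + 1 by omega)]
    simp

theorem binomTerm_succ_zero (i : ℕ) : binomTerm A (i + 1) 0 = A * binomTerm A i 0 := by
  simp [binomTerm, pow_succ']

theorem binomTerm_eq_zero {i l : ℕ} (h : i < l) : binomTerm A i l = 0 := by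
  simp [binomTerm, Nat.choose_eq_zero_of_lt h]

/-- Removal of the first letter: the next one is equal to it, with weight `A`, or distinct, with
weight `b`. The same holds for `crossWeight_succ`. -/
theorem returnWeight_succ (i j : ℕ) :
    returnWeight A b (i + 1) j = A * returnWeight A b i j + b * crossWeight A b i j := by
  cases j with
  | zero => simp [returnWeight, crossWeight, pow_succ']
  | succ j =>
    simp only [returnWeight, crossWeight, mul_sum, ← sum_add_distrib, binomTerm_succ_succ]
    exact sum_congr rfl fun l _ => by ring

theorem crossWeight_succ (i j : ℕ) :
    crossWeight A b i (j + 1) = b * returnWeight A b i j + A * crossWeight A b i j := by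
  cases j with
  | zero => simp [returnWeight, crossWeight, binomTerm, mul_comm]
  | succ j =>
    simp only [returnWeight, crossWeight]
    have h1 : ∑ l ∈ range (j + 1), binomTerm A i l * binomTerm A j l * b ^ (2 * l + 1)
        = ∑ l ∈ range (j + 2), binomTerm A i l * binomTerm A j l * b ^ (2 * l + 1) := by
      rw [sum_range_succ _ (j + 1), binomTerm_eq_zero A (Nat.lt_succ_self j)]
      simp
    rw [h1, sum_range_succ' _ (j + 1), sum_range_succ' _ (j + 1), mul_add, mul_sum, mul_sum,
      ← add_assoc, ← sum_add_distrib]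
    simp only [binomTerm_succ_succ, binomTerm_succ_zero]
    congr 1
    · exact sum_congr rfl fun l _ => by ring
    · ring

theorem returnWeight_zero_left (j : ℕ) : returnWeight A b 0 j = if j = 0 then 1 else 0 := by
  cases j with
  | zero => simp [returnWeight]
  | succ j => simp [returnWeight, binomTerm]

theorem returnWeight_zero_zero (i j : ℕ) :
    returnWeight (0 : R) 0 i j = if i = 0 ∧ j = 0 then 1 else 0 := by
  cases j with
  | zero => simp [returnWeight, zero_pow_eq]
  | succ j => simp [returnWeight]

theorem crossWeight_zero_zero (i j : ℕ) : crossWeight (0 : R) 0 i j = 0 := by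
  cases j with
  | zero => simp [crossWeight]
  | succ j => simp [crossWeight]

end weights

theorem DifferentiableOn.returnWeight {A b : ℂ → ℂ} {s : Set ℂ} (hA : DifferentiableOn ℂ A s)
    (hb : DifferentiableOn ℂ b s) (i j : ℕ) :
    DifferentiableOn ℂ (fun u => returnWeight (A u) (b u) i j) s := by
  cases j with
  | zero => simp only [ClosedSRW.returnWeight]; fun_prop
  | succ j => simp only [ClosedSRW.returnWeight, binomTerm]; fun_prop

theorem DifferentiableOn.crossWeight {A b : ℂ → ℂ} {s : Set ℂ} (hA : DifferentiableOn ℂ A s)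
    (hb : DifferentiableOn ℂ b s) (i j : ℕ) :
    DifferentiableOn ℂ (fun u => crossWeight (A u) (b u) i j) s := by
  cases j with
  | zero => simp only [ClosedSRW.crossWeight]; fun_prop
  | succ j => simp only [ClosedSRW.crossWeight, binomTerm]; fun_prop

/-! ### Two marked points -/

/-- The geometric series `1 / (1 - t)`. -/
noncomputable def geom (t : ℂ) : ℂ := (1 - t)⁻¹

/-- The generating function of the excursions from one of two points at distance `d` to itself. -/
noncomputable def stay (d : ℕ) (u : ℂ) : ℂ := 1 - cayley (u ^ 2) * geom (u ^ (2 * d))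

/-- The generating function of the passages between two points at distance `d`. -/
noncomputable def cross (d : ℕ) (u : ℂ) : ℂ := cayley (u ^ 2) * (u ^ d * geom (u ^ (2 * d)))

/-- The generating function of the passages from `a` to `0` that avoid `d`. -/
noncomputable def hit (d : ℕ) (a : ℤ) (u : ℂ) : ℂ :=
  if a ≤ 0 then u ^ (-a).toNat
  else if a ≤ d then geom (u ^ (2 * d)) * (u ^ a.toNat - u ^ (2 * d - a).toNat) else 0

theorem hit_neg (d n : ℕ) (u : ℂ) : hit d (-n) u = u ^ n := by
  simp [hit]

/-- Between the two points the recurrence has solutions spanned by `u ^ n` and `u ^ (-n)`; this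
combination is `1` at `0` and `0` at `d`. The exponent `k = 2 * d - n` is a variable so that no
subtraction occurs. -/
theorem hit_mid {d : ℕ} (hd : d ≠ 0) {n k : ℕ} (h : n + k = 2 * d) (hn : n ≤ d) {u : ℂ}
    (hu : ‖u‖ < 1) : hit d n u = geom (u ^ (2 * d)) * (u ^ n - u ^ k) := by
  unfold hit
  have h1 := one_sub_ne_zero (norm_pow_lt_one hu (show 2 * d ≠ 0 by omega))
  split_ifs with h2 h3
  · have h3 : n = 0 := by omega
    subst h3
    rw [zero_add] at h
    subst h
    rw [pow_zero, geom]
    simp [inv_mul_cancel₀ h1]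
  · congr 3
    omega
  · omega

theorem hit_top (d n : ℕ) (hd : d ≠ 0) (u : ℂ) : hit d (d + n) u = 0 := by
  unfold hit
  split_ifs with h2 h3
  · omega
  · have h4 : n = 0 := by omega
    subst h4
    rw [show ((2 : ℤ) * d - (d + (0 : ℕ))).toNat = d by omega,
      show ((d : ℤ) + (0 : ℕ)).toNat = d by omega]
    simp
  · rfl

theorem hit_step {d : ℕ} (hd : d ≠ 0) {a : ℤ} (ha : a ≠ 0) (ha' : a ≠ d) {u : ℂ} (hu : ‖u‖ < 1)
    (hu0 : u ≠ 0) : (u + u⁻¹) * hit d a u = hit d (a + 1) u + hit d (a - 1) u := by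
  rcases lt_trichotomy a 0 with h | h | h
  · obtain ⟨n, rfl⟩ : ∃ n : ℕ, a = -((n + 1 : ℕ) : ℤ) := ⟨(-a - 1).toNat, by omega⟩
    rw [show -((n + 1 : ℕ) : ℤ) + 1 = -(n : ℤ) by omega,
      show -((n + 1 : ℕ) : ℤ) - 1 = -((n + 2 : ℕ) : ℤ) by omega]
    simp only [hit_neg]
    linear_combination step_pow hu0 n
  · exact absurd h ha
  · rcases lt_or_ge a d with h' | h'
    · obtain ⟨n, rfl⟩ : ∃ n : ℕ, a = ((n + 1 : ℕ) : ℤ) := ⟨(a - 1).toNat, by omega⟩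
      obtain ⟨k, hk⟩ : ∃ k : ℕ, 2 * d = n + 1 + (k + 1) := ⟨2 * d - n - 2, by omega⟩
      rw [show ((n + 1 : ℕ) : ℤ) + 1 = ((n + 2 : ℕ) : ℤ) by omega,
        show ((n + 1 : ℕ) : ℤ) - 1 = (n : ℤ) by omega,
        hit_mid hd (n := n + 1) (k := k + 1) (by omega) (by omega) hu,
        hit_mid hd (n := n + 2) (k := k) (by omega) (by omega) hu,
        hit_mid hd (n := n) (k := k + 2) (by omega) (by omega) hu]
      linear_combination geom (u ^ (2 * d)) * (step_pow hu0 n - step_pow hu0 k)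
    · obtain ⟨n, rfl⟩ : ∃ n : ℕ, a = d + ((n + 1 : ℕ) : ℤ) := ⟨(a - d - 1).toNat, by omega⟩
      rw [show (d : ℤ) + ((n + 1 : ℕ) : ℤ) + 1 = d + ((n + 2 : ℕ) : ℤ) by omega,
        show (d : ℤ) + ((n + 1 : ℕ) : ℤ) - 1 = d + (n : ℤ) by omega]
      simp only [hit_top _ _ hd]
      simp

theorem hit_zero (d : ℕ) (u : ℂ) : hit d 0 u = 1 := by
  simpa using hit_neg d 0 u

theorem hit_self {d : ℕ} (hd : d ≠ 0) (u : ℂ) : hit d d u = 0 := by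
  simpa using hit_top d 0 hd u

/-- An excursion from `0` steps to `1` or `-1` and then returns without meeting `d`. -/
theorem stay_eq {d : ℕ} (hd : d ≠ 0) {u : ℂ} (hu : ‖u‖ < 1) (hu0 : u ≠ 0) :
    (u + u⁻¹) * stay d u = hit d 1 u + hit d (-1) u := by
  have h1 := hit_neg d 1 u
  have h2 := hit_mid hd (n := 1) (k := 2 * d - 1) (by omega) (by omega) hu
  push_cast at h1 h2
  rw [h1, h2, stay, cayley, geom]
  obtain ⟨k, hk⟩ : ∃ k, 2 * d = k + 1 := ⟨2 * d - 1, by omega⟩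
  have h3 := one_sub_ne_zero (norm_pow_lt_one hu (show 2 * d ≠ 0 by omega))
  rw [hk] at h3 ⊢
  have h4 := one_add_sq_ne_zero hu
  rw [Nat.add_sub_cancel]
  field_simp
  ring

theorem cross_eq {d : ℕ} (hd : d ≠ 0) {u : ℂ} (hu : ‖u‖ < 1) (hu0 : u ≠ 0) :
    (u + u⁻¹) * cross d u = hit d (d - 1) u := by
  obtain ⟨k, rfl⟩ : ∃ k, d = k + 1 := ⟨d - 1, by omega⟩
  have h2 := hit_mid hd (n := k) (k := k + 2) (by omega) (by omega) hu
  rw [show ((k + 1 : ℕ) : ℤ) - 1 = k by omega, h2, cross, cayley]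
  have h4 := one_add_sq_ne_zero hu
  field_simp
  ring

theorem differentiableOn_geom {d : ℕ} (hd : d ≠ 0) :
    DifferentiableOn ℂ (fun u => geom (u ^ (2 * d))) (ball 0 1) := by
  intro u hu
  rw [mem_ball_zero_iff] at hu
  have := one_sub_ne_zero (norm_pow_lt_one hu (show 2 * d ≠ 0 by omega))
  unfold geom
  fun_prop (disch := assumption)

theorem differentiableOn_cayley_sq : DifferentiableOn ℂ (fun u => cayley (u ^ 2)) (ball 0 1) := by
  intro u hu
  rw [mem_ball_zero_iff] at hu
  unfold cayley
  have := one_add_sq_ne_zero hu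
  fun_prop (disch := assumption)

theorem differentiableOn_stay {d : ℕ} (hd : d ≠ 0) :
    DifferentiableOn ℂ (stay d) (ball 0 1) := by
  have h1 := differentiableOn_geom hd
  have h2 := differentiableOn_cayley_sq
  unfold stay
  fun_prop

theorem differentiableOn_cross {d : ℕ} (hd : d ≠ 0) :
    DifferentiableOn ℂ (cross d) (ball 0 1) := by
  have h1 := differentiableOn_geom hd
  have h2 := differentiableOn_cayley_sq
  unfold cross
  fun_prop

theorem differentiableOn_hit {d : ℕ} (hd : d ≠ 0) (a : ℤ) :
    DifferentiableOn ℂ (hit d a) (ball 0 1) := by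
  have h1 := differentiableOn_geom hd
  unfold hit
  split_ifs <;> fun_prop

theorem hit_apply_zero (d : ℕ) (a : ℤ) : hit d a 0 = if a = 0 then 1 else 0 := by
  split_ifs with h
  · rw [h, hit_zero]
  · unfold hit
    split_ifs with h1 h2
    · exact zero_pow (by omega)
    · rw [zero_pow (show a.toNat ≠ 0 by omega), zero_pow (show (2 * d - a).toNat ≠ 0 by omega),
        sub_self, mul_zero]
    · rfl

theorem walkCount_two {r : ℝ} (hr : 0 < r) (hr1 : r < 1) {d : ℕ} (hd : d ≠ 0) (m i j : ℕ) :
    (walkCount m 0 (· = (d : ℤ)) i j : ℂ)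
      = circleAverage (fun u => returnWeight (stay d u) (cross d u) i j *
          (cayley (u ^ 2) * (u + u⁻¹) ^ m)) 0 r := by
  have hd' : (d : ℤ) ≠ 0 := by exact_mod_cast hd
  -- The walk from `a` first meets the two marked points at `0` or at `d`; the reflection `a ↦ d -
  -- a` turns the second passage into `hit d (d - a)`.
  rw [walkCount_eq_circleAverage hr hr1 (· = (d : ℤ))
    (fun a i j u => hit d a u * returnWeight (stay d u) (cross d u) i j
      + hit d (d - a) u * crossWeight (stay d u) (cross d u) i j)]
  · simp [hit_zero, hit_self hd]
  · intro a i j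
    have h1 := DifferentiableOn.returnWeight (differentiableOn_stay hd)
      (differentiableOn_cross hd) i j
    have h2 := DifferentiableOn.crossWeight (differentiableOn_stay hd)
      (differentiableOn_cross hd) i j
    have h3 := differentiableOn_hit hd a
    have h4 := differentiableOn_hit hd (d - a)
    fun_prop
  · intro a i j
    have h1 : stay d 0 = 0 := by simp [stay, cayley, geom, hd]
    have h2 : cross d 0 = 0 := by simp [cross, hd]
    rw [h1, h2, returnWeight_zero_zero, crossWeight_zero_zero, hit_apply_zero]
    by_cases ha : a = 0 <;> simp [ha]
  · intro a i j u hu hu0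
    by_cases ha : a = 0
    · subst ha
      simp only [if_true, if_neg hd'.symm, add_zero, hit_zero, sub_zero, hit_self hd, zero_mul,
        one_mul, zero_add, zero_sub, sub_neg_eq_add, returnWeight_succ]
      have h1 := hit_top d 1 hd u
      push_cast at h1
      rw [h1]
      linear_combination returnWeight (stay d u) (cross d u) i j * stay_eq hd hu hu0
        + crossWeight (stay d u) (cross d u) i j * cross_eq hd hu hu0
    · by_cases ha' : a = d
      · subst ha'
        simp only [if_true, if_neg hd', add_zero, hit_zero, sub_self, hit_self hd, zero_mul,
          one_mul, zero_add, crossWeight_succ]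
        have h1 := hit_top d 1 hd u
        push_cast at h1
        rw [h1, show (d : ℤ) - (d + 1) = -1 by ring, show (d : ℤ) - (d - 1) = 1 by ring]
        linear_combination crossWeight (stay d u) (cross d u) i j * stay_eq hd hu hu0
          + returnWeight (stay d u) (cross d u) i j * cross_eq hd hu hu0
      · simp only [if_neg ha, if_neg ha', add_zero]
        have h1 := hit_step hd ha ha' hu hu0
        have h2 := hit_step hd (a := d - a) (by omega) (by omega) hu hu0
        rw [show (d : ℤ) - (a + 1) = d - a - 1 by ring, show (d : ℤ) - (a - 1) = d - a + 1 by ring]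
        linear_combination returnWeight (stay d u) (cross d u) i j * h1
          + crossWeight (stay d u) (cross d u) i j * h2
  · intro a i j h
    by_cases ha : a = 0
    · subst ha
      simp only [if_true, if_neg hd'.symm, zero_le, and_true, not_le, Nat.lt_one_iff] at h
      subst h
      simp only [hit_zero, sub_zero, hit_self hd, zero_mul, add_zero, one_mul,
        returnWeight_zero_left]
      exact ⟨_, fun _ => rfl⟩
    · simp only [if_neg ha, zero_le, true_and] at h
      split_ifs at h with ha'
      · have hj : j = 0 := by omega
        subst ha' hj
        exact ⟨0, fun u => by simp [hit_self hd, crossWeight]⟩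
      · omega

end ClosedSRW

/-! ### The variable `t = u ^ 2` and the sum over all distances. -/

namespace ClosedSRW

open Finset Real Metric

/-- The weight function of the circle averages that count closed walks of length `2 * n`. -/
noncomputable def ker (n : ℕ) (t : ℂ) : ℂ := cayley t * ((1 + t) ^ 2 / t) ^ n

/-- The contribution of pairs of points at a fixed distance. -/
noncomputable def pairTerm (a b : ℕ) (s X : ℂ) : ℂ :=
  ∑ l ∈ range (b + 1), 1 / ((l : ℂ) + 1) * binomTerm (1 - s * X) a l * binomTerm (1 - s * X) b l
    * (s ^ 2 * (X * (X - 1))) ^ (l + 1)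

/-- The contribution of all pairs of distinct points, up to the order of the two points. -/
noncomputable def pairSum (a b : ℕ) (t : ℂ) : ℂ :=
  ∑' d : ℕ, pairTerm a b (cayley t) (geom (t ^ (d + 1)))

/-- Absorption makes the remaining weight symmetric in the two counts. The extracted factor is the
`k₁` of the double counting and cancels against it. -/
theorem binomTerm_succ_succ' (A : ℂ) (i l : ℕ) :
    binomTerm A (i + 1) (l + 1) = (i + 1) * (1 / ((l : ℂ) + 1) * binomTerm A i l) := by
  have h1 : ((i + 1 : ℕ) : ℂ) * (i.choose l : ℂ)
      = ((i + 1).choose (l + 1) : ℂ) * ((l + 1 : ℕ) : ℂ) := by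
    exact_mod_cast Nat.add_one_mul_choose_eq i l
  have h2 : (l : ℂ) + 1 ≠ 0 := by exact_mod_cast Nat.succ_ne_zero l
  unfold binomTerm
  rw [Nat.add_sub_add_right]
  push_cast at h1
  field_simp
  linear_combination (-A ^ (i - l)) * h1

theorem returnWeight_eq (A b : ℂ) (i j : ℕ) : returnWeight A b (i + 1) (j + 1)
    = (i + 1) * ∑ l ∈ range (j + 1), 1 / ((l : ℂ) + 1) * binomTerm A i l * binomTerm A j l
      * (b ^ 2) ^ (l + 1) := by
  rw [returnWeight, mul_sum]
  refine sum_congr rfl fun l _ => ?_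
  rw [binomTerm_succ_succ', ← pow_mul, mul_add, mul_one]
  ring

/-- Since `X - 1 = u ^ (2 * d) X`, the square of `cross d u` is `s ^ 2 X (X - 1)`. Crossings occur
in pairs, so only `u ^ 2` enters. -/
theorem returnWeight_eq_pairTerm {d : ℕ} (hd : d ≠ 0) {u : ℂ} (hu : ‖u‖ < 1) (i j : ℕ) :
    returnWeight (stay d u) (cross d u) (i + 1) (j + 1)
      = (i + 1) * pairTerm i j (cayley (u ^ 2)) (geom ((u ^ 2) ^ d)) := by
  rw [returnWeight_eq, pairTerm, stay, ← pow_mul]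
  congr 1
  refine sum_congr rfl fun l _ => ?_
  congr 2
  have h : geom (u ^ (2 * d)) - 1 = u ^ (2 * d) * geom (u ^ (2 * d)) := by
    have := one_sub_ne_zero (norm_pow_lt_one hu (show 2 * d ≠ 0 by omega))
    rw [geom]
    field_simp
    ring
  rw [h, cross]
  ring

/-- Squaring wraps the circle twice around the one of radius `r ^ 2`, and the average over two
periods is that over one. -/
theorem circleAverage_sq {f : ℂ → ℂ} {r : ℝ} (hf : CircleIntegrable f 0 (r ^ 2)) :
    circleAverage (fun u => f (u ^ 2)) 0 r = circleAverage f 0 (r ^ 2) := by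
  rw [circleAverage_def, circleAverage_def]
  congr 1
  set g : ℝ → ℂ := fun θ => f (circleMap 0 (r ^ 2) θ) with hg
  have hper : Function.Periodic g (2 * π) := fun θ => by
    simp [hg, periodic_circleMap 0 (r ^ 2) θ]
  have h1 : ∀ θ : ℝ, f (circleMap 0 r θ ^ 2) = g (2 * θ) := by
    intro θ
    simp only [hg, circleMap, zero_add, mul_pow, ← Complex.exp_nat_mul]
    push_cast
    ring_nf
  have hint : IntervalIntegrable g MeasureTheory.volume 0 (2 * π) := hf
  have h2 := hper.intervalIntegral_add_zsmul_eq 2 0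
    (hper.intervalIntegrable₀ two_pi_pos.ne' hint)
  simp only [h1]
  rw [intervalIntegral.integral_comp_mul_left _ two_ne_zero, mul_zero]
  simp only [zsmul_eq_mul, zero_add, Int.cast_ofNat] at h2
  rw [h2, Complex.real_smul]
  push_cast
  ring

theorem pow_add_inv_eq {u : ℂ} (hu : u ≠ 0) (n : ℕ) :
    (u + u⁻¹) ^ (2 * n) = ((1 + u ^ 2) ^ 2 / u ^ 2) ^ n := by
  rw [pow_mul, ← div_pow]
  congr 2
  field_simp
  ring

theorem sphere_facts {ρ : ℝ} (hρ : 0 < ρ) (hρ1 : ρ < 1) {t : ℂ}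
    (ht : t ∈ sphere (0 : ℂ) ρ) :
    ‖t‖ < 1 ∧ t ≠ 0 := by
  rw [mem_sphere_zero_iff_norm] at ht
  exact ⟨ht ▸ hρ1, norm_pos_iff.1 (ht ▸ hρ)⟩

theorem continuousOn_cayley {ρ : ℝ} (hρ : 0 < ρ) (hρ1 : ρ < 1) :
    ContinuousOn cayley (sphere 0 ρ) := by
  unfold cayley
  exact ContinuousOn.div (by fun_prop) (by fun_prop)
    fun t ht => one_add_ne_zero (sphere_facts hρ hρ1 ht).1

theorem continuousOn_ker {ρ : ℝ} (hρ : 0 < ρ) (hρ1 : ρ < 1) (n : ℕ) :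
    ContinuousOn (ker n) (sphere 0 ρ) := by
  refine (continuousOn_cayley hρ hρ1).mul (ContinuousOn.pow (ContinuousOn.div (by fun_prop)
    (by fun_prop) fun t ht => (sphere_facts hρ hρ1 ht).2) n)

theorem continuousOn_geom {ρ : ℝ} (hρ : 0 < ρ) (hρ1 : ρ < 1) {d : ℕ} (hd : d ≠ 0) :
    ContinuousOn (fun t => geom (t ^ d)) (sphere 0 ρ) := by
  unfold geom
  exact ContinuousOn.inv₀ (by fun_prop)
    fun t ht => one_sub_ne_zero (norm_pow_lt_one (sphere_facts hρ hρ1 ht).1 hd)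

theorem continuousOn_pairTerm {ρ : ℝ} (hρ : 0 < ρ) (hρ1 : ρ < 1) (a b : ℕ) {d : ℕ} (hd : d ≠ 0) :
    ContinuousOn (fun t => pairTerm a b (cayley t) (geom (t ^ d))) (sphere 0 ρ) := by
  have h1 := continuousOn_cayley hρ hρ1
  have h2 := continuousOn_geom hρ hρ1 hd
  unfold pairTerm binomTerm
  fun_prop

theorem norm_geom_le {ρ : ℝ} (hρ1 : ρ < 1) {t : ℂ} (ht : ‖t‖ ≤ ρ) :
    ‖geom t‖ ≤ (1 - ρ)⁻¹ := by
  rw [geom, norm_inv]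
  refine inv_anti₀ (by linarith) ?_
  have := norm_sub_norm_le (1 : ℂ) t
  rw [norm_one] at this
  linarith

theorem norm_cayley_le {ρ : ℝ} (hρ1 : ρ < 1) {t : ℂ} (ht : ‖t‖ ≤ ρ) :
    ‖cayley t‖ ≤ 2 * (1 - ρ)⁻¹ := by
  rw [cayley, norm_div, div_eq_mul_inv]
  refine mul_le_mul ?_ (inv_anti₀ (by linarith) ?_) (by positivity) (by norm_num)
  · have := norm_sub_le (1 : ℂ) t
    rw [norm_one] at this
    linarith
  · have := norm_sub_norm_le (1 : ℂ) (-t)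
    rw [norm_one, norm_neg, sub_neg_eq_add] at this
    linarith

/-- Every summand contains a factor `X - 1 = t ^ (d + 1) X`, which gives the geometric decay; the
cofactor is a polynomial in `(s, X)` and these stay in a compact set. -/
theorem exists_norm_pairTerm_le {ρ : ℝ} (hρ1 : ρ < 1) (a b : ℕ) :
    ∃ M : ℝ, ∀ t : ℂ, ‖t‖ = ρ → ∀ d : ℕ,
      ‖pairTerm a b (cayley t) (geom (t ^ (d + 1)))‖ ≤ M * ρ ^ (d + 1) := by
  set q : ℂ × ℂ → ℂ := fun p => ∑ l ∈ range (b + 1), 1 / ((l : ℂ) + 1) *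
    binomTerm (1 - p.1 * p.2) a l * binomTerm (1 - p.1 * p.2) b l
    * ((p.1 ^ 2 * p.2) ^ (l + 1) * (p.2 - 1) ^ l * p.2) with hq
  have hqc : Continuous q := by
    simp only [hq, binomTerm]
    fun_prop
  obtain ⟨M, hM⟩ := ((isCompact_closedBall (0 : ℂ) (2 * (1 - ρ)⁻¹)).prod
    (isCompact_closedBall (0 : ℂ) ((1 - ρ)⁻¹))).exists_bound_of_continuousOn hqc.continuousOn
  refine ⟨M, fun t ht d => ?_⟩
  have hρ0 : 0 ≤ ρ := ht ▸ norm_nonneg t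
  have ht1 : ‖t ^ (d + 1)‖ < 1 := norm_pow_lt_one (ht ▸ hρ1) (Nat.succ_ne_zero d)
  have h : pairTerm a b (cayley t) (geom (t ^ (d + 1)))
      = q (cayley t, geom (t ^ (d + 1))) * t ^ (d + 1) := by
    have h1 : geom (t ^ (d + 1)) - 1 = geom (t ^ (d + 1)) * t ^ (d + 1) := by
      have := one_sub_ne_zero ht1
      rw [geom]
      field_simp
      ring
    simp only [hq, pairTerm, sum_mul]
    refine sum_congr rfl fun l _ => ?_
    rw [← mul_assoc (cayley t ^ 2), mul_pow _ (geom (t ^ (d + 1)) - 1),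
      pow_succ (geom (t ^ (d + 1)) - 1) l]
    linear_combination 1 / ((l : ℂ) + 1) * binomTerm (1 - cayley t * geom (t ^ (d + 1))) a l *
      binomTerm (1 - cayley t * geom (t ^ (d + 1))) b l *
      ((cayley t ^ 2 * geom (t ^ (d + 1))) ^ (l + 1) * (geom (t ^ (d + 1)) - 1) ^ l) * h1
  rw [h, norm_mul, norm_pow, ht]
  gcongr
  apply hM
  rw [Set.mem_prod, mem_closedBall_zero_iff, mem_closedBall_zero_iff]
  refine ⟨norm_cayley_le hρ1 ht.le, norm_geom_le hρ1 ?_⟩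
  rw [norm_pow, ht]
  exact pow_le_of_le_one hρ0 hρ1.le (Nat.succ_ne_zero d)

/-- This lets the series over all distances stand for the finite sum up to the length of the walk.
-/
theorem walkCount_eq_zero_of_lt {m d : ℕ} (h : m < d) (i j : ℕ) :
    walkCount m 0 (· = (d : ℤ)) i (j + 1) = 0 := by
  unfold walkCount
  rw [card_eq_zero, filter_eq_empty_iff]
  rintro s _ ⟨-, -, h1⟩
  have h2 : 0 < visits (· = (d : ℤ)) (0, s) := by omega
  obtain ⟨i, hi⟩ := card_pos.1 h2
  simp only [mem_filter, mem_range] at hi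
  have h3 := abs_point_le s i hi.1.le
  rw [hi.2, abs_le] at h3
  omega

theorem hasSum_circleAverage {ρ : ℝ} (hρ : 0 < ρ) (hρ1 : ρ < 1) (a b n : ℕ) :
    HasSum (fun d : ℕ => circleAverage
        (fun t => pairTerm a b (cayley t) (geom (t ^ (d + 1))) * ker n t) 0 ρ)
      (circleAverage (fun t => pairSum a b t * ker n t) 0 ρ) := by
  obtain ⟨M, hM⟩ := exists_norm_pairTerm_le hρ1 a b
  obtain ⟨N, hN⟩ := (isCompact_sphere (0 : ℂ) ρ).exists_bound_of_continuousOn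
    (continuousOn_ker hρ hρ1 n)
  simp only [circleAverage_def]
  apply HasSum.const_smul
  have hs : ∀ θ : ℝ, circleMap 0 ρ θ ∈ sphere (0 : ℂ) ρ := circleMap_mem_sphere 0 hρ.le
  have hn : ∀ θ : ℝ, ‖circleMap 0 ρ θ‖ = ρ := fun θ => mem_sphere_zero_iff_norm.1 (hs θ)
  have hb : ∀ d θ, ‖pairTerm a b (cayley (circleMap 0 ρ θ)) (geom (circleMap 0 ρ θ ^ (d + 1)))
      * ker n (circleMap 0 ρ θ)‖ ≤ M * N * ρ * ρ ^ d := by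
    intro d θ
    rw [norm_mul]
    calc _ ≤ (M * ρ ^ (d + 1)) * N := mul_le_mul (hM _ (hn θ) d) (hN _ (hs θ)) (norm_nonneg _)
          ((norm_nonneg _).trans (hM _ (hn θ) d))
      _ = _ := by ring
  have hsum : Summable fun d : ℕ => M * N * ρ * ρ ^ d :=
    (summable_geometric_of_lt_one hρ.le hρ1).mul_left _
  apply intervalIntegral.hasSum_integral_of_dominated_convergence
    (fun d _ => M * N * ρ * ρ ^ d)
  · intro d
    refine Continuous.aestronglyMeasurable ?_
    exact ((continuousOn_pairTerm hρ hρ1 a b (Nat.succ_ne_zero d)).mul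
      (continuousOn_ker hρ hρ1 n)).comp_continuous (continuous_circleMap 0 ρ) hs
  · exact fun d => Filter.Eventually.of_forall fun θ _ => hb d θ
  · exact Filter.Eventually.of_forall fun θ _ => hsum
  · exact intervalIntegrable_const
  · refine Filter.Eventually.of_forall fun θ _ => ?_
    have : Summable fun d => pairTerm a b (cayley (circleMap 0 ρ θ))
        (geom (circleMap 0 ρ θ ^ (d + 1))) :=
      Summable.of_norm_bounded (g := fun d => M * ρ * ρ ^ d)
        ((summable_geometric_of_lt_one hρ.le hρ1).mul_left _)
        fun d => (hM _ (hn θ) d).trans_eq (by ring)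
    exact this.hasSum.mul_right _

theorem walkCount_two_sq {ρ : ℝ} (hρ : 0 < ρ) (hρ1 : ρ < 1) (n a b : ℕ) {d : ℕ} (hd : d ≠ 0) :
    (walkCount (2 * n) 0 (· = (d : ℤ)) (a + 1) (b + 1) : ℂ) = (a + 1) * circleAverage
      (fun t => pairTerm a b (cayley t) (geom (t ^ d)) * ker n t) 0 ρ := by
  have hr : 0 < √ρ := sqrt_pos.2 hρ
  have hr1 : √ρ < 1 := by rwa [sqrt_lt' one_pos, one_pow]
  have hci : CircleIntegrable (fun t => pairTerm a b (cayley t) (geom (t ^ d)) * ker n t) 0 ρ :=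
    ((continuousOn_pairTerm hρ hρ1 a b hd).mul
      (continuousOn_ker hρ hρ1 n)).circleIntegrable hρ.le
  nth_rewrite 1 [← sq_sqrt hρ.le] at hci
  rw [walkCount_two hr hr1 hd]
  have h := circleAverage_sq hci
  rw [sq_sqrt hρ.le] at h
  rw [← h, ← smul_eq_mul (a := (a : ℂ) + 1), ← circleAverage_fun_smul]
  apply circleAverage_congr_sphere
  intro u hu
  rw [abs_of_pos hr] at hu
  have hu' := sphere_facts hr hr1 hu
  simp only [smul_eq_mul]
  rw [returnWeight_eq_pairTerm hd hu'.1, pow_add_inv_eq hu'.2, ker]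
  ring

theorem walkCount_one_sq {ρ : ℝ} (hρ : 0 < ρ) (hρ1 : ρ < 1) (n k : ℕ) :
    (walkCount (2 * n) 0 (fun _ => False) k 0 : ℂ) = circleAverage
      (fun t => (1 - cayley t) ^ k * ker n t) 0 ρ := by
  have hr : 0 < √ρ := sqrt_pos.2 hρ
  have hr1 : √ρ < 1 := by rwa [sqrt_lt' one_pos, one_pow]
  have hci : CircleIntegrable (fun t => (1 - cayley t) ^ k * ker n t) 0 ρ :=
    (((continuousOn_const.sub (continuousOn_cayley hρ hρ1)).pow k).mul
      (continuousOn_ker hρ hρ1 n)).circleIntegrable hρ.le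
  nth_rewrite 1 [← sq_sqrt hρ.le] at hci
  rw [walkCount_one hr hr1]
  have h := circleAverage_sq hci
  rw [sq_sqrt hρ.le] at h
  rw [← h]
  apply circleAverage_congr_sphere
  intro u hu
  rw [abs_of_pos hr] at hu
  have hu' := sphere_facts hr hr1 hu
  simp only
  rw [pow_add_inv_eq hu'.2, ker]

theorem sum_walkCount_two {ρ : ℝ} (hρ : 0 < ρ) (hρ1 : ρ < 1) (n a b : ℕ) :
    ∑ d ∈ Icc 1 (2 * n), (walkCount (2 * n) 0 (· = (d : ℤ)) (a + 1) (b + 1) : ℂ)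
      = (a + 1) * circleAverage (fun t => pairSum a b t * ker n t) 0 ρ := by
  have h1 := (hasSum_circleAverage hρ hρ1 a b n).mul_left ((a : ℂ) + 1)
  simp only [← walkCount_two_sq hρ hρ1 n a b (Nat.succ_ne_zero _)] at h1
  have h2 := hasSum_sum_of_ne_finset_zero (s := range (2 * n)) (L := SummationFilter.unconditional ℕ)
    (f := fun d : ℕ => (walkCount (2 * n) 0 (· = ((d + 1 : ℕ) : ℤ)) (a + 1) (b + 1) : ℂ))
    (fun d hd => by
      rw [walkCount_eq_zero_of_lt (by simp at hd; omega), Nat.cast_zero])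
  rw [h1.unique h2, range_eq_Ico, sum_Ico_add' (fun d : ℕ =>
    (walkCount (2 * n) 0 (· = (d : ℤ)) (a + 1) (b + 1) : ℂ)) 0 (2 * n) 1, zero_add]
  rfl

/-- The second moment sum as a circle average. -/
theorem sum_closedWalks_eq {ρ : ℝ} (hρ : 0 < ρ) (hρ1 : ρ < 1) {n : ℕ} (hn : 1 ≤ n) (a b : ℕ) :
    ∑ w ∈ closedWalks (2 * n), (multRange (a + 1) w : ℂ) * (multRange (b + 1) w : ℂ)
      = 2 * n * ((if a = b then 1 / ((a : ℂ) + 1) *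
          circleAverage (fun t => (1 - cayley t) ^ (a + 1) * ker n t) 0 ρ else 0)
        + 2 * circleAverage (fun t => pairSum a b t * ker n t) 0 ρ) := by
  have h := congrArg (Nat.cast (R := ℂ)) (mul_sum_multRange (m := 2 * n) (by omega) (a + 1) (b + 1)
    (by omega) (by omega))
  push_cast at h
  rw [sum_walkCount_two hρ hρ1, walkCount_one_sq hρ hρ1] at h
  have ha : (a : ℂ) + 1 ≠ 0 := by exact_mod_cast Nat.succ_ne_zero a
  apply mul_left_cancel₀ ha
  rw [h]
  split_ifs
  · field_simp
  · ring

end ClosedSRW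

namespace ClosedSRW

open Finset Real Metric

/-! ### The number of closed walks and the averages of the kernel -/

theorem card_closedWalks (n : ℕ) : #(closedWalks (2 * n)) = n.centralBinom := by
  have h1 : #(closedWalks (2 * n)) = #{s : Fin (2 * n) → ℤˣ | Closes (0, s)} := by
    rw [card_eq_sum_ones, sum_closedWalks, card_filter]
  have h2 : ∀ s : Fin (2 * n) → ℤˣ, Closes (0, s) ↔ #{j | s j = 1} = n := by
    intro s
    rw [closes_iff, point_eq_sum]
    have h3 : ∀ j, ((s j : ℤˣ) : ℤ) = 2 * (if s j = 1 then 1 else 0) - 1 := by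
      intro j
      rcases Int.units_eq_one_or (s j) with h | h <;> simp [h]
    simp only [h3, sum_sub_distrib, ← mul_sum, sum_boole]
    simp
    omega
  have h4 : #{s : Fin (2 * n) → ℤˣ | #{j | s j = 1} = n}
      = #(powersetCard n (univ : Finset (Fin (2 * n)))) := by
    refine card_nbij' (fun s => ({j | s j = 1} : Finset (Fin (2 * n))))
      (fun S j => if j ∈ S then 1 else -1) ?_ ?_ ?_ ?_
    · intro s hs
      simpa [mem_powersetCard] using hs
    · intro S hS
      simpa [mem_powersetCard] using hS
    · intro s _
      ext j
      rcases Int.units_eq_one_or (s j) with h | h <;> simp [h]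
    · intro S _
      ext j
      simp
  rw [h1]
  simp only [h2]
  rw [h4, card_powersetCard, card_univ, Fintype.card_fin, Nat.centralBinom]

theorem circleAverage_zpow {ρ : ℝ} (hρ : 0 < ρ) (j : ℤ) :
    circleAverage (fun t : ℂ => t ^ j) 0 ρ = if j = 0 then 1 else 0 := by
  split_ifs with hj
  · subst hj
    simp only [zpow_zero]
    exact circleAverage_const _ _ _
  · rw [circleAverage_eq_circleIntegral hρ.ne']
    have h : (∮ z in C(0, ρ), (z - 0)⁻¹ • z ^ j) = ∮ z in C(0, ρ), (z - 0) ^ (j - 1) := by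
      apply circleIntegral.integral_congr hρ.le
      intro z hz
      have hz0 : z ≠ 0 := norm_pos_iff.1 (mem_sphere_zero_iff_norm.1 hz ▸ hρ)
      simp only [sub_zero, smul_eq_mul]
      rw [zpow_sub_one₀ hz0, mul_comm]
    rw [h, circleIntegral.integral_sub_zpow_of_ne (by omega), smul_zero]

theorem circleAverage_pow {ρ : ℝ} (hρ : 0 < ρ) (n : ℕ) :
    circleAverage (fun t : ℂ => ((1 + t) ^ 2 / t) ^ n) 0 ρ = (n.centralBinom : ℂ) := by
  have h1 : Set.EqOn (fun t : ℂ => ((1 + t) ^ 2 / t) ^ n) (fun t : ℂ => ∑ k ∈ range (2 * n + 1),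
      ((2 * n).choose k : ℂ) • t ^ ((k : ℤ) - n)) (sphere 0 |ρ|) := by
    intro t ht
    rw [abs_of_pos hρ] at ht
    have ht0 : t ≠ 0 := norm_pos_iff.1 (mem_sphere_zero_iff_norm.1 ht ▸ hρ)
    simp only [smul_eq_mul]
    rw [div_pow, ← pow_mul, add_comm, add_pow, sum_div]
    refine sum_congr rfl fun k _ => ?_
    rw [zpow_sub₀ ht0]
    simp
    ring
  rw [circleAverage_congr_sphere h1, circleAverage_fun_sum]
  · simp only [circleAverage_fun_smul, circleAverage_zpow hρ, sub_eq_zero, Nat.cast_inj]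
    simp only [smul_eq_mul, mul_ite, mul_one, mul_zero]
    rw [sum_ite_eq', if_pos (by simp; omega), Nat.centralBinom]
  · intro k _
    apply ContinuousOn.circleIntegrable hρ.le
    apply ContinuousOn.fun_const_smul
    apply ContinuousOn.zpow₀ continuousOn_id
    exact fun t ht => Or.inl (norm_pos_iff.1 (mem_sphere_zero_iff_norm.1 ht ▸ hρ))

/-- The average counts closed walks at `0` that never visit `0`, of which there are none. -/
theorem circleAverage_ker {ρ : ℝ} (hρ : 0 < ρ) (hρ1 : ρ < 1) {n : ℕ} (hn : 1 ≤ n) :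
    circleAverage (ker n) 0 ρ = 0 := by
  have h1 := walkCount_one_sq hρ hρ1 n 0
  simp only [pow_zero, one_mul] at h1
  rw [← h1, Nat.cast_eq_zero, walkCount, card_eq_zero, filter_eq_empty_iff]
  rintro s _ ⟨-, h2, -⟩
  rw [visits, card_eq_zero, filter_eq_empty_iff] at h2
  exact h2 (x := 0) (by simp; omega) (point_zero _)

/-- Because `cayley t ^ 2 = 1 - 4 t / (1 + t) ^ 2`, two factors `cayley` can be traded for a
difference of consecutive powers. -/
theorem cayley_sq_mul {t : ℂ} (ht : 1 + t ≠ 0) (ht0 : t ≠ 0) (n : ℕ) :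
    cayley t ^ 2 * ((1 + t) ^ 2 / t) ^ (n + 1)
      = ((1 + t) ^ 2 / t) ^ (n + 1) - 4 * ((1 + t) ^ 2 / t) ^ n := by
  have h : cayley t ^ 2 * ((1 + t) ^ 2 / t) = (1 + t) ^ 2 / t - 4 := by
    rw [cayley]
    field_simp
    ring
  rw [pow_succ]
  linear_combination ((1 + t) ^ 2 / t) ^ n * h

theorem continuousOn_pow {ρ : ℝ} (hρ : 0 < ρ) (n : ℕ) :
    ContinuousOn (fun t : ℂ => ((1 + t) ^ 2 / t) ^ n) (sphere 0 ρ) :=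
  ContinuousOn.pow (ContinuousOn.div (by fun_prop) (by fun_prop) fun _ ht =>
    norm_pos_iff.1 (mem_sphere_zero_iff_norm.1 ht ▸ hρ)) n

theorem circleAverage_cayley_mul_ker {ρ : ℝ} (hρ : 0 < ρ) (hρ1 : ρ < 1) (n : ℕ) :
    circleAverage (fun t => cayley t * ker (n + 1) t) 0 ρ
      = ((n + 1).centralBinom : ℂ) - 4 * (n.centralBinom : ℂ) := by
  rw [← circleAverage_pow hρ, ← circleAverage_pow hρ,
    ← smul_eq_mul (a := (4 : ℂ)), ← circleAverage_fun_smul,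
    ← circleAverage_fun_sub]
  · apply circleAverage_congr_sphere
    intro t ht
    rw [abs_of_pos hρ] at ht
    have ht' := sphere_facts hρ hρ1 ht
    simp only [smul_eq_mul]
    rw [← cayley_sq_mul (one_add_ne_zero ht'.1) ht'.2, ker]
    ring
  · exact (continuousOn_pow hρ _).circleIntegrable hρ.le
  · exact ((continuousOn_pow hρ n).fun_const_smul (4 : ℂ)).circleIntegrable hρ.le

/-- The trade leaves a combination of averages of `ker n` and `ker (n - 1)`; both vanish only from
`n = 2` on. -/
theorem circleAverage_cayley_sq_mul_ker {ρ : ℝ} (hρ : 0 < ρ) (hρ1 : ρ < 1) {n : ℕ} (hn : 2 ≤ n) :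
    circleAverage (fun t => cayley t ^ 2 * ker n t) 0 ρ = 0 := by
  obtain ⟨n, rfl⟩ : ∃ k, n = k + 1 := ⟨n - 1, by omega⟩
  have h : circleAverage (fun t => cayley t ^ 2 * ker (n + 1) t) 0 ρ
      = circleAverage (fun t => ker (n + 1) t - (4 : ℂ) • ker n t) 0 ρ := by
    apply circleAverage_congr_sphere
    intro t ht
    rw [abs_of_pos hρ] at ht
    have ht' := sphere_facts hρ hρ1 ht
    have := cayley_sq_mul (one_add_ne_zero ht'.1) ht'.2 n
    simp only [smul_eq_mul, ker]
    linear_combination cayley t * this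
  rw [h, circleAverage_fun_sub, circleAverage_fun_smul, circleAverage_ker hρ hρ1 (by omega),
    circleAverage_ker hρ hρ1 (by omega)]
  · simp
  · exact (continuousOn_ker hρ hρ1 _).circleIntegrable hρ.le
  · exact ((continuousOn_ker hρ hρ1 n).fun_const_smul (4 : ℂ)).circleIntegrable hρ.le

theorem four_pow_le_sqrt_mul_centralBinom {n : ℕ} (hn : 1 ≤ n) :
    (4 : ℝ) ^ n ≤ 2 * √n * n.centralBinom := by
  have h : ((4 : ℝ) ^ n) ^ 2 ≤ 4 * n * (n.centralBinom : ℝ) ^ 2 := by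
    induction n, hn using Nat.le_induction with
    | base => norm_num [Nat.centralBinom, Nat.choose]
    | succ n hn ih =>
      have h1 : ((n : ℝ) + 1) * (n + 1).centralBinom = 2 * (2 * n + 1) * n.centralBinom := by
        exact_mod_cast Nat.succ_mul_centralBinom_succ n
      have hn0 : (0 : ℝ) < (n : ℝ) + 1 := by positivity
      have h2 : ((n + 1).centralBinom : ℝ) = 2 * (2 * n + 1) * n.centralBinom / (n + 1) := by
        field_simp
        linarith
      rw [h2, pow_succ (4 : ℝ) n, mul_pow]
      push_cast
      have h3 : 4 * ((n : ℝ) + 1) * (2 * (2 * n + 1) * n.centralBinom / (n + 1)) ^ 2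
          = 16 * ((2 * n + 1) ^ 2 / (n + 1)) * (n.centralBinom : ℝ) ^ 2 := by
        field_simp
        ring
      have h4 : 4 * (n : ℝ) ≤ (2 * n + 1) ^ 2 / (n + 1) := by
        rw [le_div_iff₀ hn0]
        nlinarith
      rw [h3]
      calc ((4 : ℝ) ^ n) ^ 2 * 4 ^ 2 ≤ (4 * n * (n.centralBinom : ℝ) ^ 2) * 4 ^ 2 := by gcongr
        _ = 16 * (4 * n) * (n.centralBinom : ℝ) ^ 2 := by ring
        _ ≤ _ := by gcongr
  refine (pow_le_pow_iff_left₀ (by positivity) (by positivity) two_ne_zero).1 ?_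
  rw [mul_pow, mul_pow, sq_sqrt (Nat.cast_nonneg n)]
  linarith

end ClosedSRW

namespace ClosedSRW

open Finset Real Metric

/-! ### Functions of controlled growth on a strip -/

/-- The strip `0 < Re v ≤ 1`, `|Im v| ≤ π`. -/
def strip : Set ℂ := {v | 0 < v.re ∧ v.re ≤ 1 ∧ |v.im| ≤ π}

/-- The function `f` is `O(v ^ e)` in the strip, up to a power of `‖v‖ / Re v`. -/
def Tame (e : ℤ) (f : ℂ → ℂ) : Prop :=
  ∃ C : ℝ, ∃ K : ℕ, 0 ≤ C ∧ ∀ v ∈ strip, ‖f v‖ ≤ C * ‖v‖ ^ e * (‖v‖ / v.re) ^ K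

theorem norm_pos_of_mem_strip {v : ℂ} (hv : v ∈ strip) : 0 < ‖v‖ :=
  hv.1.trans_le (Complex.re_le_norm v)

theorem one_le_div_of_mem_strip {v : ℂ} (hv : v ∈ strip) : 1 ≤ ‖v‖ / v.re :=
  (one_le_div hv.1).2 (Complex.re_le_norm v)

theorem norm_le_of_mem_strip {v : ℂ} (hv : v ∈ strip) : ‖v‖ ≤ 5 := by
  have h1 := Complex.norm_le_abs_re_add_abs_im v
  have h2 := hv.2.2
  have h3 := pi_lt_four
  rw [abs_of_pos hv.1] at h1
  linarith [hv.2.1]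

namespace Tame

variable {e e' : ℤ} {f g : ℂ → ℂ}

theorem congr (hf : Tame e f) (h : ∀ v ∈ strip, f v = g v) : Tame e g := by
  obtain ⟨C, K, hC, hb⟩ := hf
  exact ⟨C, K, hC, fun v hv => h v hv ▸ hb v hv⟩

theorem add (hf : Tame e f) (hg : Tame e g) : Tame e (fun v => f v + g v) := by
  obtain ⟨C, K, hC, hb⟩ := hf
  obtain ⟨C', K', hC', hb'⟩ := hg
  refine ⟨C + C', max K K', by positivity, fun v hv => (norm_add_le _ _).trans ?_⟩
  have h1 := one_le_div_of_mem_strip hv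
  rw [add_mul, add_mul]
  refine add_le_add ((hb v hv).trans ?_) ((hb' v hv).trans ?_)
  · gcongr
    exact le_max_left _ _
  · gcongr
    exact le_max_right _ _

theorem mul (hf : Tame e f) (hg : Tame e' g) : Tame (e + e') (fun v => f v * g v) := by
  obtain ⟨C, K, hC, hb⟩ := hf
  obtain ⟨C', K', hC', hb'⟩ := hg
  refine ⟨C * C', K + K', by positivity, fun v hv => ?_⟩
  have h1 := norm_pos_of_mem_strip hv
  have h2 := hv.1
  rw [norm_mul, zpow_add₀ h1.ne', pow_add]
  calc _ ≤ _ := mul_le_mul (hb v hv) (hb' v hv) (norm_nonneg _) (by positivity)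
    _ = _ := by ring

theorem mono (hf : Tame e f) (h : e' ≤ e) : Tame e' f := by
  obtain ⟨C, K, hC, hb⟩ := hf
  obtain ⟨k, rfl⟩ := Int.le.dest h
  refine ⟨C * 5 ^ k, K, by positivity, fun v hv => (hb v hv).trans ?_⟩
  have h1 := norm_pos_of_mem_strip hv
  have h2 := norm_le_of_mem_strip hv
  have h3 := one_le_div_of_mem_strip hv
  rw [zpow_add₀ h1.ne', zpow_natCast, mul_comm (‖v‖ ^ e'), ← mul_assoc]
  gcongr

theorem const (c : ℂ) : Tame 0 (fun _ => c) :=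
  ⟨‖c‖, 0, norm_nonneg _, fun v _ => by simp⟩

theorem zero : Tame e (fun _ => 0) := ⟨0, 0, le_rfl, fun v _ => by simp⟩

theorem const_mul (c : ℂ) (hf : Tame e f) : Tame e (fun v => c * f v) := by
  simpa using (const c).mul hf

theorem neg (hf : Tame e f) : Tame e (fun v => -f v) := by
  simpa using hf.const_mul (-1)

theorem sub (hf : Tame e f) (hg : Tame e g) : Tame e (fun v => f v - g v) := by
  simpa [sub_eq_add_neg] using hf.add hg.neg

theorem id_zpow (e : ℤ) : Tame e (fun v => v ^ e) :=
  ⟨1, 0, zero_le_one, fun v _ => by simp⟩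

theorem pow (hf : Tame e f) (k : ℕ) : Tame (k * e) (fun v => f v ^ k) := by
  induction k with
  | zero => simpa using const 1
  | succ k ih =>
    simp only [pow_succ]
    have := ih.mul hf
    rwa [show (k : ℤ) * e + e = ((k + 1 : ℕ) : ℤ) * e by push_cast; ring] at this

end Tame

theorem norm_exp_neg_lt_one {v : ℂ} (hv : 0 < v.re) : ‖Complex.exp (-v)‖ < 1 := by
  rw [Complex.norm_exp, Complex.neg_re, exp_lt_one_iff]
  linarith

theorem tame_exp_sub_sum (n : ℕ) :
    Tame n (fun v => Complex.exp (-v) - ∑ m ∈ range n, (-v) ^ m / m.factorial) := by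
  refine ⟨rexp 5, 0, (exp_pos _).le, fun v hv => ?_⟩
  have h1 := Complex.norm_exp_sub_sum_le_norm_mul_exp (-v) n
  rw [norm_neg] at h1
  refine h1.trans ?_
  rw [pow_zero, mul_one, zpow_natCast, mul_comm]
  gcongr
  exact norm_le_of_mem_strip hv

theorem half_le_one_sub_exp {c : ℝ} (h0 : 0 ≤ c) (h1 : c ≤ 1) : c / 2 ≤ 1 - rexp (-c) := by
  have h2 : rexp (-c) ≤ 1 / (1 + c) := by
    rw [exp_neg, ← one_div]
    exact one_div_le_one_div_of_le (by linarith) (by linarith [add_one_le_exp c])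
  have h3 : c / 2 ≤ 1 - 1 / (1 + c) := by
    rw [le_sub_iff_add_le, ← le_sub_iff_add_le', div_le_iff₀ (by linarith)]
    nlinarith
  linarith

/-- The poles at `±π i` lie on the boundary of the strip. Near them `‖v‖` is bounded below, so the
bound `2 / Re v` is absorbed by the allowed factor `‖v‖ / Re v`. -/
theorem tame_inv_one_add : Tame 0 (fun v => (1 + Complex.exp (-v))⁻¹) := by
  refine ⟨8, 1, by norm_num, fun v hv => ?_⟩
  have h0 := hv.1
  have h1 := one_le_div_of_mem_strip hv
  rw [norm_inv, zpow_zero, pow_one, mul_one]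
  by_cases h : ‖v‖ ≤ 1 / 4
  · have h2 := Complex.norm_exp_sub_one_le (x := -v) (by rw [norm_neg]; linarith)
    have h3 : ‖(2 : ℂ)‖ - ‖Complex.exp (-v) - 1‖ ≤ ‖1 + Complex.exp (-v)‖ := by
      have := norm_sub_norm_le (2 : ℂ) (-(Complex.exp (-v) - 1))
      rw [norm_neg, show (2 : ℂ) - -(Complex.exp (-v) - 1) = 1 + Complex.exp (-v) by ring] at this
      exact this
    rw [norm_neg] at h2
    have h4 : ‖(2 : ℂ)‖ = 2 := by simp
    have h5 : 1 ≤ ‖1 + Complex.exp (-v)‖ := by linarith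
    calc _ ≤ (1 : ℝ)⁻¹ := inv_anti₀ one_pos h5
      _ ≤ _ := by linarith
  · have h2 : v.re / 2 ≤ ‖1 + Complex.exp (-v)‖ := by
      have h3 := norm_sub_norm_le (1 : ℂ) (-Complex.exp (-v))
      rw [norm_neg, sub_neg_eq_add, norm_one, Complex.norm_exp, Complex.neg_re] at h3
      exact (half_le_one_sub_exp h0.le hv.2.1).trans h3
    calc _ ≤ (v.re / 2)⁻¹ := inv_anti₀ (by linarith) h2
      _ = 8 * ((1 / 4) / v.re) := by field_simp; norm_num
      _ ≤ _ := by gcongr; linarith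

/-- The function `tanh (v / 2)`. -/
noncomputable def tanhHalf (v : ℂ) : ℂ := cayley (Complex.exp (-v))

theorem tanhHalf_eq (v : ℂ) :
    tanhHalf v = (1 - Complex.exp (-v)) * (1 + Complex.exp (-v))⁻¹ := by
  rw [tanhHalf, cayley, div_eq_mul_inv]

theorem one_add_exp_ne_zero {v : ℂ} (hv : 0 < v.re) : 1 + Complex.exp (-v) ≠ 0 :=
  one_add_ne_zero (norm_exp_neg_lt_one hv)

theorem tame_id : Tame 1 (fun v => v) := by simpa using Tame.id_zpow 1

theorem tame_tanhHalf : Tame 1 tanhHalf := by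
  have h1 := ((tame_exp_sub_sum 1).neg.mul tame_inv_one_add)
  refine h1.congr fun v _ => ?_
  rw [tanhHalf_eq]
  simp

/-- Multiply by `1 + exp (-v)` and insert the cubic Taylor polynomial of the exponential: all terms
below `v ^ 4` cancel. Order 4 is what is needed to keep order 3 after division by `v`. -/
theorem tame_tanhHalf_sub : Tame 4 (fun v => tanhHalf v - v / 2 + v ^ 3 / 24) := by
  have hv4 : Tame 4 (fun v => v ^ 4) := by simpa using tame_id.pow 4
  have h1 : Tame 0 (fun v : ℂ => -(1 + v / 2 - v ^ 3 / 24)) :=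
    ((((Tame.const 1).add ((tame_id.const_mul (1 / 2)).mono (by norm_num))).sub
      (((tame_id.pow 3).const_mul (1 / 24)).mono (by norm_num))).neg).congr fun v _ => by ring
  have h2 : Tame 0 (fun v : ℂ => 1 / 24 + v / 48 - v ^ 2 / 144) :=
    (((Tame.const (1 / 24)).add ((tame_id.const_mul (1 / 48)).mono (by norm_num))).sub
      (((tame_id.pow 2).const_mul (1 / 144)).mono (by norm_num))).congr fun v _ => by ring
  have h3 : Tame 4 (fun v => (v ^ 4 * (1 / 24 + v / 48 - v ^ 2 / 144) + (Complex.exp (-v)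
      - ∑ m ∈ range 4, (-v) ^ m / m.factorial) * -(1 + v / 2 - v ^ 3 / 24))
      * (1 + Complex.exp (-v))⁻¹) :=
    ((hv4.mul h2).add ((tame_exp_sub_sum 4).mul h1)).mul tame_inv_one_add
  refine h3.congr fun v hv => ?_
  have h4 := one_add_exp_ne_zero hv.1
  rw [tanhHalf_eq]
  simp only [sum_range_succ, range_zero, sum_empty, Nat.factorial]
  push_cast
  field_simp
  ring

/-! ### The remainder estimate -/

theorem circleMap_exp (c θ : ℝ) :
    circleMap 0 (rexp (-c)) θ = Complex.exp (-(c - θ * Complex.I)) := by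
  rw [circleMap, zero_add, Complex.ofReal_exp, ← Complex.exp_add]
  push_cast
  ring_nf

theorem circleAverage_eq_integral (f : ℂ → ℂ) (ρ : ℝ) :
    circleAverage f 0 ρ = (2 * π)⁻¹ • ∫ θ in -π..π, f (circleMap 0 ρ θ) := by
  rw [circleAverage_def]
  congr 1
  have hper : Function.Periodic (fun θ => f (circleMap 0 ρ θ)) (2 * π) := fun θ => by
    simp [periodic_circleMap 0 ρ θ]
  have h := hper.intervalIntegral_add_eq 0 (-π)
  rwa [zero_add, show -π + 2 * π = π by ring] at h

theorem cosh_le_one_add_sq {c : ℝ} (hc : |c| ≤ 1) : cosh c ≤ 1 + c ^ 2 := by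
  have h1 : c ^ 2 ≤ 1 := by rwa [sq_le_one_iff_abs_le_one]
  have h2 := exp_bound_div_one_sub_of_interval (x := c ^ 2 / 2) (by positivity) (by linarith)
  refine (cosh_le_exp_half_sq c).trans (h2.trans ?_)
  rw [div_le_iff₀ (by linarith)]
  nlinarith [sq_nonneg c]

/-- The norm equals `2 cosh c + 2 cos θ`, and `cos θ ≤ 1 - 2 θ ^ 2 / π ^ 2` on `[-π, π]` yields the
Gaussian decay. -/
theorem norm_sq_div_le {c θ : ℝ} (hc : |c| ≤ 1) (hθ : |θ| ≤ π) :
    ‖(1 + Complex.exp (-(c - θ * Complex.I))) ^ 2 / Complex.exp (-(c - θ * Complex.I))‖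
      ≤ 4 * rexp (c ^ 2 / 2 - θ ^ 2 / π ^ 2) := by
  have h1 : ‖(1 + Complex.exp (-(c - θ * Complex.I))) ^ 2 / Complex.exp (-(c - θ * Complex.I))‖
      = 2 * cosh c + 2 * cos θ := by
    rw [norm_div, norm_pow, ← Complex.normSq_eq_norm_sq, Complex.norm_exp, Complex.normSq_apply,
      Complex.add_re, Complex.add_im, Complex.exp_re, Complex.exp_im, Complex.one_re,
      Complex.one_im]
    simp only [Complex.neg_re, Complex.sub_re, Complex.ofReal_re, Complex.mul_re, Complex.I_re,
      Complex.I_im, Complex.neg_im, Complex.sub_im, Complex.ofReal_im, Complex.mul_im, mul_zero,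
      mul_one, sub_zero, zero_sub, neg_neg, add_zero, zero_add]
    have h2 : rexp c * rexp (-c) = 1 := by rw [← exp_add, add_neg_cancel, exp_zero]
    rw [div_eq_iff (exp_pos _).ne', cosh_eq]
    linear_combination (rexp (-c)) ^ 2 * sin_sq_add_cos_sq θ - h2
  rw [h1]
  have h2 := cosh_le_one_add_sq hc
  have h3 := cos_le_one_sub_mul_cos_sq hθ
  have h4 := add_one_le_exp (c ^ 2 / 2 - θ ^ 2 / π ^ 2)
  have h5 : 2 / π ^ 2 * θ ^ 2 = 2 * (θ ^ 2 / π ^ 2) := by ring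
  rw [h5] at h3
  linarith

theorem pow_mul_exp_le (M : ℕ) (y : ℝ) :
    (1 + |y|) ^ M * rexp (-(y ^ 2 / π ^ 2)) ≤ M.factorial * rexp (1 + π ^ 2 / 4) := by
  have h0 : 0 ≤ 1 + |y| := by positivity
  have h1 := pow_div_factorial_le_exp (1 + |y|) h0 M
  rw [div_le_iff₀ (by positivity)] at h1
  have h2 : |y| ≤ y ^ 2 / π ^ 2 + π ^ 2 / 4 := by
    have h3 := sq_nonneg (|y| / π - π / 2)
    have h4 : (|y| / π - π / 2) ^ 2 = |y| ^ 2 / π ^ 2 - |y| + π ^ 2 / 4 := by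
      field_simp
      ring
    rw [h4, sq_abs] at h3
    linarith
  calc _ ≤ (rexp (1 + |y|) * M.factorial) * rexp (-(y ^ 2 / π ^ 2)) := by gcongr
    _ = M.factorial * rexp (1 + |y| - y ^ 2 / π ^ 2) := by
      rw [sub_eq_add_neg, exp_add (1 + |y|)]
      ring
    _ ≤ _ := by
      gcongr
      linarith

theorem integral_inv_one_add_sq_div_le {c : ℝ} (hc : 0 < c) :
    ∫ θ in -π..π, (1 + (θ / c) ^ 2)⁻¹ ≤ c * π := by
  rw [intervalIntegral.integral_comp_div (fun y => (1 + y ^ 2)⁻¹) hc.ne', integral_inv_one_add_sq,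
    smul_eq_mul]
  gcongr
  linarith [arctan_lt_pi_div_two (π / c), neg_pi_div_two_lt_arctan (-π / c)]

/-- Put `c = 1 / √n` and `θ = c y`. The remainder gives three powers of `c`, the factor `tanhHalf`
of the kernel one, and `dθ` one. Powers of `‖v‖ / Re v` become powers of `1 + |y|`, which the
Gaussian factor absorbs. -/
theorem exists_norm_circleAverage_le {R : ℂ → ℂ} (hR : Tame 3 (fun v => R (Complex.exp (-v)))) :
    ∃ C : ℝ, ∀ n : ℕ, 1 ≤ n →
      ‖circleAverage (fun t => R t * ker n t) 0 (rexp (-(√n)⁻¹))‖ ≤ C * 4 ^ n * (√n)⁻¹ ^ 5 := by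
  obtain ⟨C, K, hC, hb⟩ := hR.mul tame_tanhHalf
  -- The exponent collects `K` from `‖v‖ / Re v`, 4 from `‖v‖ ^ 4`, and 2 to spare for the
  -- integrable factor `(1 + y ^ 2)⁻¹`.
  set B : ℝ := (K + 4 + 2).factorial * rexp (1 + π ^ 2 / 4) with hB
  have hB0 : 0 ≤ B := by positivity
  refine ⟨C * rexp (1 / 2) * B, fun n hn => ?_⟩
  set c : ℝ := (√n)⁻¹ with hc
  have hn0 : (1 : ℝ) ≤ n := by exact_mod_cast hn
  have hn1 : 1 ≤ √n := one_le_sqrt.2 hn0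
  have hc0 : 0 < c := inv_pos.2 (by linarith)
  have hc1 : c ≤ 1 := inv_le_one_of_one_le₀ hn1
  have hnc : n * c ^ 2 = 1 := by
    rw [hc, inv_pow, sq_sqrt (by linarith)]
    field_simp
  have key : ∀ θ ∈ Set.Ioc (-π) π, ‖R (circleMap 0 (rexp (-c)) θ) * ker n (circleMap 0 (rexp (-c)) θ)‖
      ≤ C * rexp (1 / 2) * B * 4 ^ n * c ^ 4 * (1 + (θ / c) ^ 2)⁻¹ := by
    intro θ hθ
    have hθ' : |θ| ≤ π := abs_le.2 ⟨hθ.1.le, hθ.2⟩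
    set v : ℂ := c - θ * Complex.I with hv
    have hre : v.re = c := by simp [hv]
    have him : v.im = -θ := by simp [hv]
    have hvs : v ∈ strip := ⟨hre ▸ hc0, hre ▸ hc1, by rw [him, abs_neg]; exact hθ'⟩
    have h1 := hb v hvs
    have h2 := norm_sq_div_le (abs_le.2 ⟨by linarith, hc1⟩) hθ'
    rw [circleMap_exp, ← hv] at *
    rw [hre] at h1
    have h3 : ‖v‖ ≤ c * (1 + |θ / c|) := by
      have := Complex.norm_le_abs_re_add_abs_im v
      rw [hre, him, abs_neg, abs_of_pos hc0] at this
      rw [abs_div, abs_of_pos hc0]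
      field_simp
      linarith
    have h4 : ‖v‖ / c ≤ 1 + |θ / c| := by
      rw [div_le_iff₀ hc0]
      linarith
    have h5 := pow_mul_exp_le (K + 4 + 2) (θ / c)
    have h6 : 0 < 1 + (θ / c) ^ 2 := by positivity
    have h7 : 1 + (θ / c) ^ 2 ≤ (1 + |θ / c|) ^ 2 := by
      rw [← sq_abs (θ / c)]
      nlinarith [abs_nonneg (θ / c)]
    have h8 : (4 * rexp (c ^ 2 / 2 - θ ^ 2 / π ^ 2)) ^ n
        = 4 ^ n * (rexp (1 / 2) * rexp (-((θ / c) ^ 2 / π ^ 2))) := by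
      rw [mul_pow, ← exp_nat_mul, ← exp_add]
      congr 2
      have : (n : ℝ) = 1 / c ^ 2 := by field_simp; linarith
      rw [this]
      field_simp
      ring
    calc ‖R (Complex.exp (-v)) * ker n (Complex.exp (-v))‖
        = ‖R (Complex.exp (-v)) * tanhHalf v‖
          * ‖(1 + Complex.exp (-v)) ^ 2 / Complex.exp (-v)‖ ^ n := by
          rw [ker, tanhHalf, ← norm_pow, ← norm_mul, mul_assoc]
      _ ≤ (C * ‖v‖ ^ (3 + 1 : ℤ) * (‖v‖ / c) ^ K)
          * (4 * rexp (c ^ 2 / 2 - θ ^ 2 / π ^ 2)) ^ n := by gcongr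
      _ = (C * ‖v‖ ^ 4 * (‖v‖ / c) ^ K)
          * (4 ^ n * (rexp (1 / 2) * rexp (-((θ / c) ^ 2 / π ^ 2)))) := by
          rw [h8]
          norm_cast
      _ ≤ (C * (c * (1 + |θ / c|)) ^ 4 * (1 + |θ / c|) ^ K)
          * (4 ^ n * (rexp (1 / 2) * rexp (-((θ / c) ^ 2 / π ^ 2)))) := by gcongr
      _ = C * rexp (1 / 2) * 4 ^ n * c ^ 4 * ((1 + |θ / c|) ^ (K + 4)
          * rexp (-((θ / c) ^ 2 / π ^ 2))) := by ring
      _ ≤ C * rexp (1 / 2) * 4 ^ n * c ^ 4 * (B * (1 + (θ / c) ^ 2)⁻¹) := by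
          refine mul_le_mul_of_nonneg_left ?_ (by positivity)
          rw [← div_eq_mul_inv, le_div_iff₀ h6]
          refine le_trans ?_ h5
          rw [pow_add _ (K + 4) 2, mul_right_comm]
          gcongr
      _ = _ := by ring
  rw [circleAverage_eq_integral, norm_smul, norm_of_nonneg (by positivity)]
  have hg : Continuous fun θ : ℝ => C * rexp (1 / 2) * B * 4 ^ n * c ^ 4 * (1 + (θ / c) ^ 2)⁻¹ := by
    refine continuous_const.mul (Continuous.inv₀ (by fun_prop) fun θ => by positivity)
  have h9 := intervalIntegral.norm_integral_le_of_norm_le (μ := MeasureTheory.volume)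
    (show -π ≤ π by linarith [pi_pos])
    (Filter.Eventually.of_forall key) (hg.intervalIntegrable (-π) π)
  rw [intervalIntegral.integral_const_mul] at h9
  have h10 := h9.trans (mul_le_mul_of_nonneg_left (integral_inv_one_add_sq_div_le hc0)
    (by positivity))
  refine (mul_le_mul_of_nonneg_left h10 (by positivity)).trans ?_
  have h11 : (2 * π)⁻¹ * (C * rexp (1 / 2) * B * 4 ^ n * c ^ 4 * (c * π))
      = C * rexp (1 / 2) * B * 4 ^ n * c ^ 5 * (1 / 2) := by
    field_simp
  rw [h11]
  exact mul_le_of_le_one_right (by positivity) (by norm_num)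

end ClosedSRW

namespace ClosedSRW

open Finset Real Metric Filter Topology

/-! ### The regular part of `1 / (exp w - 1)` -/

/-- The domain on which the regular part of `1 / (exp w - 1)` is considered. -/
def regDomain : Set ℂ := {w | 0 < w.re} ∪ ball 0 6

/-- The regular part of `1 / (exp w - 1)` at `0`, continued over `0`. -/
noncomputable def expReg : ℂ → ℂ := dslope (fun w => (dslope Complex.exp 0 w)⁻¹) 0

theorem isOpen_regDomain : IsOpen regDomain :=
  (isOpen_lt continuous_const Complex.continuous_re).union isOpen_ball

theorem regDomain_mem_nhds : regDomain ∈ 𝓝 (0 : ℂ) :=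
  isOpen_regDomain.mem_nhds (Or.inr (mem_ball_self (by norm_num)))

theorem exp_ne_one {w : ℂ} (hw : w ∈ regDomain) (h0 : w ≠ 0) : Complex.exp w ≠ 1 := by
  rw [Ne, Complex.exp_eq_one_iff]
  rintro ⟨n, hn⟩
  rcases hw with hw | hw
  · rw [hn] at hw
    simp at hw
  · have hn0 : n ≠ 0 := by
      rintro rfl
      simp at hn
      exact h0 hn
    -- The nonzero roots `2 π i n` have modulus at least `2 π`, which exceeds 6.
    have h1 : (1 : ℝ) ≤ |(n : ℝ)| := by exact_mod_cast Int.one_le_abs hn0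
    rw [mem_ball_zero_iff, hn] at hw
    simp [abs_of_pos pi_pos] at hw
    nlinarith [pi_gt_three]

theorem dslope_exp {w : ℂ} (h0 : w ≠ 0) : dslope Complex.exp 0 w = (Complex.exp w - 1) / w := by
  rw [dslope_of_ne _ h0, slope_def_field, Complex.exp_zero, sub_zero]

theorem dslope_exp_zero : dslope Complex.exp 0 0 = 1 := by
  rw [dslope_same, Complex.deriv_exp, Complex.exp_zero]

theorem expReg_eq {w : ℂ} (h0 : w ≠ 0) : expReg w = (Complex.exp w - 1)⁻¹ - w⁻¹ := by
  rw [expReg, dslope_of_ne _ h0, slope_def_field, dslope_exp_zero, dslope_exp h0]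
  by_cases h : Complex.exp w - 1 = 0
  · simp [h]
    field_simp
  · field_simp
    ring

theorem differentiableOn_expReg : DifferentiableOn ℂ expReg regDomain := by
  rw [expReg, Complex.differentiableOn_dslope regDomain_mem_nhds]
  refine DifferentiableOn.inv ?_ ?_
  · rw [Complex.differentiableOn_dslope regDomain_mem_nhds]
    exact Complex.differentiable_exp.differentiableOn
  · intro w hw
    by_cases h0 : w = 0
    · rw [h0, dslope_exp_zero]
      exact one_ne_zero
    · rw [dslope_exp h0]
      exact div_ne_zero (sub_ne_zero.2 (exp_ne_one hw h0)) h0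

theorem differentiableOn_iteratedDeriv_expReg (j : ℕ) :
    DifferentiableOn ℂ (iteratedDeriv j expReg) regDomain := by
  induction j with
  | zero => simpa using differentiableOn_expReg
  | succ j ih =>
    rw [iteratedDeriv_succ]
    exact ih.deriv isOpen_regDomain

theorem hasDerivAt_iteratedDeriv_expReg (j : ℕ) {w : ℂ} (hw : w ∈ regDomain) :
    HasDerivAt (iteratedDeriv j expReg) (iteratedDeriv (j + 1) expReg w) w := by
  rw [iteratedDeriv_succ]
  exact ((differentiableOn_iteratedDeriv_expReg j).differentiableAt
    (isOpen_regDomain.mem_nhds hw)).hasDerivAt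

/-- Apart from the odd pole, `1 / (exp w - 1) + 1 / (exp (-w) - 1) = -1`; let `w` tend to `0`. -/
theorem expReg_zero : expReg 0 = -(1 / 2) := by
  have hc : ContinuousAt expReg 0 :=
    differentiableOn_expReg.continuousOn.continuousAt regDomain_mem_nhds
  have h1 : Tendsto (fun w => expReg w + expReg (-w)) (𝓝[≠] 0) (𝓝 (expReg 0 + expReg 0)) := by
    have h2 : ContinuousAt (fun w => expReg w + expReg (-w)) 0 :=
      hc.add (ContinuousAt.comp (by rwa [neg_zero]) continuousAt_neg)
    have h3 := h2.tendsto
    rw [neg_zero] at h3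
    exact h3.mono_left nhdsWithin_le_nhds
  have h4 : (fun w => expReg w + expReg (-w)) =ᶠ[𝓝[≠] 0] fun _ => -1 := by
    filter_upwards [self_mem_nhdsWithin, nhdsWithin_le_nhds regDomain_mem_nhds] with w hw0 hw
    rw [expReg_eq hw0, expReg_eq (neg_ne_zero.2 hw0), Complex.exp_neg]
    have h5 := sub_ne_zero.2 (exp_ne_one hw hw0)
    have h6 := Complex.exp_ne_zero w
    have h7 : (Complex.exp w)⁻¹ - 1 = -(Complex.exp w - 1) / Complex.exp w := by
      field_simp
      ring
    rw [h7]
    have hw0' : w ≠ 0 := hw0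
    field_simp
    ring
  have h5 := tendsto_nhds_unique h1 (tendsto_const_nhds.congr' h4.symm)
  linear_combination h5 / 2

theorem norm_expReg_le {w : ℂ} (hw : 0 < w.re) : ‖expReg w‖ ≤ 2 / w.re := by
  have h0 : w ≠ 0 := by
    rintro rfl
    simp at hw
  rw [expReg_eq h0]
  have h1 : ‖(Complex.exp w - 1)⁻¹‖ ≤ 1 / w.re := by
    rw [norm_inv, ← one_div]
    apply one_div_le_one_div_of_le hw
    have := norm_sub_norm_le (Complex.exp w) 1
    rw [norm_one, Complex.norm_exp] at this
    linarith [add_one_le_exp w.re]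
  have h2 : ‖w⁻¹‖ ≤ 1 / w.re := by
    rw [norm_inv, ← one_div]
    exact one_div_le_one_div_of_le hw (Complex.re_le_norm w)
  calc _ ≤ _ := norm_sub_le _ _
    _ ≤ 1 / w.re + 1 / w.re := add_le_add h1 h2
    _ = _ := by ring

/-- Cauchy's estimate on the disc of radius `Re w / 2`, where `expReg` is bounded by `4 / Re w`. -/
theorem exists_norm_iteratedDeriv_expReg_le (j : ℕ) : ∃ C : ℝ, 0 ≤ C ∧ ∀ w : ℂ, 0 < w.re →
    ‖iteratedDeriv j expReg w‖ ≤ C / w.re ^ (j + 1) := by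
  refine ⟨j.factorial * 4 * 2 ^ j, by positivity, fun w hw => ?_⟩
  have hre : ∀ z ∈ closedBall w (w.re / 2), w.re / 2 ≤ z.re := by
    intro z hz
    rw [mem_closedBall_iff_norm] at hz
    have h1 := (Complex.abs_re_le_norm (z - w)).trans hz
    rw [Complex.sub_re, abs_le] at h1
    linarith
  have hd : DiffContOnCl ℂ expReg (ball w (w.re / 2)) := by
    apply DifferentiableOn.diffContOnCl_ball (U := regDomain) differentiableOn_expReg
    intro z hz
    have := hre z hz
    exact Or.inl (show 0 < z.re by linarith)
  have h := Complex.norm_iteratedDeriv_le_of_forall_mem_sphere_norm_le j (half_pos hw) hd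
    (C := 4 / w.re) (fun z hz => by
      have h1 := hre z (sphere_subset_closedBall hz)
      refine (norm_expReg_le (by linarith)).trans ?_
      rw [div_le_div_iff₀ (by linarith) hw]
      linarith)
  refine h.trans (le_of_eq ?_)
  rw [div_pow]
  field_simp
  ring

theorem exists_norm_iteratedDeriv_expReg_le' (j : ℕ) : ∃ C : ℝ, 0 ≤ C ∧ ∀ w : ℂ, ‖w‖ ≤ 1 →
    ‖iteratedDeriv j expReg w‖ ≤ C := by
  obtain ⟨C, hC⟩ := (isCompact_closedBall (0 : ℂ) 1).exists_bound_of_continuousOn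
    ((differentiableOn_iteratedDeriv_expReg j).continuousOn.mono (fun w hw => Or.inr
      (closedBall_subset_ball (by norm_num) hw)))
  refine ⟨C, (norm_nonneg _).trans (hC 0 (by simp)), fun w hw => hC w (by simpa using hw)⟩

/-- A bound that is uniform along a ray. -/
theorem exists_norm_iteratedDeriv_ray_le (j : ℕ) : ∃ C : ℝ, 0 ≤ C ∧ ∀ v ∈ strip, ∀ x : ℝ, 0 ≤ x →
    ‖iteratedDeriv (j + 1) expReg (x * v)‖
      ≤ C * (‖v‖ / v.re) ^ (j + 2) / (1 + x * ‖v‖) ^ 2 := by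
  obtain ⟨C₁, hC₁, h1⟩ := exists_norm_iteratedDeriv_expReg_le' (j + 1)
  obtain ⟨C₂, hC₂, h2⟩ := exists_norm_iteratedDeriv_expReg_le (j + 1)
  refine ⟨4 * (C₁ + C₂), by positivity, fun v hv x hx => ?_⟩
  have hv0 := norm_pos_of_mem_strip hv
  have hK := one_le_div_of_mem_strip hv
  have hre := hv.1
  have hn : ‖(x : ℂ) * v‖ = x * ‖v‖ := by rw [norm_mul, Complex.norm_real, norm_of_nonneg hx]
  have hp : 0 < (1 + x * ‖v‖) ^ 2 := by positivity
  rw [le_div_iff₀ hp]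
  have hKp : 1 ≤ (‖v‖ / v.re) ^ (j + 2) := one_le_pow₀ hK
  -- Near the origin the derivative is bounded. Farther out the decay in `x * Re v` is converted to
  -- decay in `x * ‖v‖` at the cost of powers of `‖v‖ / Re v`.
  rcases le_total (x * ‖v‖) 1 with h | h
  · have h3 := h1 _ (hn.trans_le h)
    have h4 : (1 + x * ‖v‖) ^ 2 ≤ 4 := by nlinarith [mul_nonneg hx hv0.le]
    calc _ ≤ C₁ * 4 := by gcongr
      _ ≤ (4 * (C₁ + C₂)) * 1 := by linarith
      _ ≤ _ := by gcongr
  · have hx0 : 0 < x := by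
      rcases hx.eq_or_lt with h' | h'
      · rw [← h', zero_mul] at h
        linarith
      · exact h'
    have hre' : ((x : ℂ) * v).re = x * v.re := by simp
    have h3 := h2 (x * v) (by rw [hre']; positivity)
    rw [hre'] at h3
    have h4 : (1 + x * ‖v‖) ^ 2 ≤ 4 * (x * ‖v‖) ^ 2 := by nlinarith
    have h5 : (x * ‖v‖) ^ 2 ≤ (x * ‖v‖) ^ (j + 2) := pow_le_pow_right₀ h (by omega)
    have h6 : C₂ / (x * v.re) ^ (j + 1 + 1) = C₂ * (‖v‖ / v.re) ^ (j + 2) / (x * ‖v‖) ^ (j + 2) := by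
      rw [mul_pow, mul_pow, div_pow]
      field_simp
    rw [h6] at h3
    have hq : 0 < (x * ‖v‖) ^ (j + 2) := by positivity
    calc _ ≤ (C₂ * (‖v‖ / v.re) ^ (j + 2) / (x * ‖v‖) ^ (j + 2)) * (4 * (x * ‖v‖) ^ (j + 2)) := by
          gcongr
          linarith
      _ = 4 * C₂ * (‖v‖ / v.re) ^ (j + 2) := by
          field_simp
      _ ≤ _ := by
          gcongr
          linarith

/-! ### Summation over a ray -/

/-- The error of the trapezoidal rule on a unit interval. -/
theorem norm_trapezoid_le {p p₁ p₂ p₃ : ℝ → ℂ} {a M : ℝ}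
    (h : ∀ x ∈ Set.Icc a (a + 1), HasDerivAt p (p₁ x) x)
    (h₁ : ∀ x ∈ Set.Icc a (a + 1), HasDerivAt p₁ (p₂ x) x)
    (h₂ : ∀ x ∈ Set.Icc a (a + 1), HasDerivAt p₂ (p₃ x) x)
    (hM : ∀ x ∈ Set.Icc a (a + 1), ‖p₃ x‖ ≤ M) :
    ‖p (a + 1) - p a - (p₁ a + p₁ (a + 1)) / 2‖ ≤ M := by
  have hmem : a + 1 ∈ Set.Icc a (a + 1) := ⟨by linarith, le_rfl⟩
  have hM0 : 0 ≤ M := (norm_nonneg _).trans (hM _ hmem)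
  have hid : ∀ x : ℝ, HasDerivAt (fun x : ℝ => ((x - a : ℝ) : ℂ) / 2) (1 / 2) x := fun x => by
    have := (((hasDerivAt_id x).sub_const a).ofReal_comp).div_const (2 : ℂ)
    simpa using this
  -- The error as a function of the right end point vanishes at `a` together with its first
  -- derivative, and its second derivative is `-(x - a) / 2 * p₃ x`; the mean value inequality is
  -- applied twice.
  have e1 : ∀ x ∈ Set.Icc a (a + 1), HasDerivAt
      (fun x => (p₁ x - p₁ a) / 2 - ((x - a : ℝ) : ℂ) / 2 * p₂ x)
      (-(((x - a : ℝ) : ℂ) / 2 * p₃ x)) x := by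
    intro x hx
    have := (((h₁ x hx).sub_const (p₁ a)).div_const 2).sub ((hid x).mul (h₂ x hx))
    refine this.congr_deriv ?_
    ring
  have e0 : ∀ x ∈ Set.Icc a (a + 1), HasDerivAt
      (fun x => p x - p a - ((x - a : ℝ) : ℂ) / 2 * (p₁ a + p₁ x))
      ((p₁ x - p₁ a) / 2 - ((x - a : ℝ) : ℂ) / 2 * p₂ x) x := by
    intro x hx
    have := ((h x hx).sub_const (p a)).sub ((hid x).mul ((h₁ x hx).const_add (p₁ a)))
    refine this.congr_deriv ?_
    ring
  have b1 : ∀ x ∈ Set.Icc a (a + 1),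
      ‖(p₁ x - p₁ a) / 2 - ((x - a : ℝ) : ℂ) / 2 * p₂ x‖ ≤ M := by
    intro x hx
    have := norm_image_sub_le_of_norm_deriv_le_segment' (C := M)
      (fun x hx => (e1 x hx).hasDerivWithinAt) (fun x hx => by
        have hx' := hM x ⟨hx.1, hx.2.le⟩
        rw [norm_neg, norm_mul, norm_div, Complex.norm_real, norm_of_nonneg (by linarith [hx.1])]
        have h2 : (x - a) / ‖(2 : ℂ)‖ ≤ 1 := by
          rw [Complex.norm_ofNat]
          linarith [hx.2]
        calc _ ≤ 1 * M := by gcongr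
          _ = M := one_mul M) x hx
    simp only [sub_self, Complex.ofReal_zero, zero_div, zero_mul, sub_zero] at this
    refine this.trans (mul_le_of_le_one_right hM0 (by linarith [hx.2]))
  have := norm_image_sub_le_of_norm_deriv_le_segment' (C := M)
    (fun x hx => (e0 x hx).hasDerivWithinAt) (fun x hx => b1 x ⟨hx.1, hx.2.le⟩) (a + 1) hmem
  simp only [sub_self, Complex.ofReal_zero, zero_div, zero_mul, sub_zero, add_sub_cancel_left,
    mul_one, Complex.ofReal_one] at this
  refine le_trans (le_of_eq ?_) this
  congr 1
  ring

theorem sum_one_div_sq_le {y : ℝ} (hy : 0 < y) (M : ℕ) :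
    ∑ N ∈ range M, 1 / (1 + N * y) ^ 2 ≤ 1 + 1 / y := by
  -- The subtracted tail makes the induction telescope.
  have h : ∀ M : ℕ, ∑ N ∈ range (M + 1), 1 / (1 + N * y) ^ 2
      ≤ 1 + 1 / y - 1 / (y * (1 + M * y)) := by
    intro M
    induction M with
    | zero => simp
    | succ M ih =>
      rw [sum_range_succ]
      have h1 : 0 < 1 + M * y := by positivity
      have h2 : 0 < 1 + ((M + 1 : ℕ) : ℝ) * y := by positivity
      have h3 : 1 / (1 + ((M + 1 : ℕ) : ℝ) * y) ^ 2
          ≤ 1 / ((1 + M * y) * (1 + ((M + 1 : ℕ) : ℝ) * y)) := by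
        apply one_div_le_one_div_of_le (by positivity)
        rw [sq]
        gcongr
        omega
      have h4 : 1 / ((1 + M * y) * (1 + ((M + 1 : ℕ) : ℝ) * y))
          = 1 / (y * (1 + M * y)) - 1 / (y * (1 + ((M + 1 : ℕ) : ℝ) * y)) := by
        have h5 : 1 + ((M + 1 : ℕ) : ℝ) * y = 1 + M * y + y := by push_cast; ring
        rw [h5] at h2 ⊢
        field_simp
        ring
      linarith
  refine (sum_le_sum_of_subset_of_nonneg (range_subset_range.2 (Nat.le_succ M))
    fun _ _ _ => by positivity).trans ((h M).trans ?_)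
  have : 0 ≤ 1 / (y * (1 + M * y)) := by positivity
  linarith

theorem ray_mem_regDomain {v : ℂ} (hv : v ∈ strip) {x : ℝ} (hx : 0 ≤ x) :
    (x : ℂ) * v ∈ regDomain := by
  rcases hx.eq_or_lt with h | h
  · rw [← h]
    simp [regDomain]
  · refine Or.inl ?_
    have := hv.1
    simp only [Set.mem_ofPred_eq, Complex.mul_re, Complex.ofReal_re, Complex.ofReal_im, zero_mul,
      sub_zero]
    positivity

theorem hasDerivAt_ray (j : ℕ) {v : ℂ} (hv : v ∈ strip) {x : ℝ} (hx : 0 ≤ x) (c : ℂ) :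
    HasDerivAt (fun x : ℝ => c * iteratedDeriv j expReg (x * v))
      (c * v * iteratedDeriv (j + 1) expReg (x * v)) x := by
  have h1 : HasDerivAt (fun x : ℝ => (x : ℂ) * v) v x := by
    simpa using ((hasDerivAt_id x).ofReal_comp).mul_const v
  have h2 := ((hasDerivAt_iteratedDeriv_expReg j (ray_mem_regDomain hv hx)).comp x h1).const_mul c
  refine h2.congr_deriv ?_
  ring

theorem summable_iteratedDeriv_ray (j : ℕ) {v : ℂ} (hv : v ∈ strip) :
    Summable fun d : ℕ => iteratedDeriv (j + 1) expReg (((d + 1 : ℕ) : ℝ) * v) := by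
  obtain ⟨C, hC, h⟩ := exists_norm_iteratedDeriv_expReg_le (j + 1)
  have hre := hv.1
  refine Summable.of_norm_bounded (g := fun d : ℕ => C / v.re ^ (j + 2) *
    (1 / ((d + 1 : ℕ) : ℝ) ^ (j + 2))) ?_ ?_
  · exact ((summable_nat_add_iff 1).2 (Real.summable_one_div_nat_pow.2 (by omega))).mul_left _
  · intro d
    have h1 := h ((((d + 1 : ℕ) : ℝ) : ℂ) * v) (by
      rw [Complex.re_ofReal_mul]
      positivity)
    rw [Complex.re_ofReal_mul, mul_pow] at h1
    refine h1.trans (le_of_eq ?_)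
    field_simp

theorem tame_tsum_iteratedDeriv (j : ℕ) :
    Tame 1 (fun v => ∑' d : ℕ, iteratedDeriv (j + 1) expReg (((d + 1 : ℕ) : ℝ) * v)
      + iteratedDeriv j expReg 0 * v⁻¹ + iteratedDeriv (j + 1) expReg 0 / 2) := by
  obtain ⟨C, hC, h⟩ := exists_norm_iteratedDeriv_ray_le (j + 2)
  obtain ⟨C', hC', h'⟩ := exists_norm_iteratedDeriv_expReg_le j
  refine ⟨6 * C, j + 4, by positivity, fun v hv => ?_⟩
  have hv0 := norm_pos_of_mem_strip hv
  have hvne : v ≠ 0 := norm_pos_iff.1 hv0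
  have hre := hv.1
  set D : ℕ → ℝ → ℂ := fun i x => iteratedDeriv i expReg (x * v) with hD
  have hstep : ∀ N : ℕ, ‖D j (N + 1) - D j N - (v * D (j + 1) N + v * D (j + 1) (N + 1)) / 2‖
      ≤ ‖v‖ ^ 3 * (C * (‖v‖ / v.re) ^ (j + 4)) * (1 / (1 + N * ‖v‖) ^ 2) := by
    intro N
    refine norm_trapezoid_le (p := D j) (p₁ := fun x => v * D (j + 1) x)
      (p₂ := fun x => v * v * D (j + 2) x) (p₃ := fun x => v * v * v * D (j + 3) x)
      (a := N) ?_ ?_ ?_ ?_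
    · intro x hx
      have hx0 : 0 ≤ x := (Nat.cast_nonneg N).trans hx.1
      simpa using hasDerivAt_ray j hv hx0 1
    · intro x hx
      exact hasDerivAt_ray (j + 1) hv ((Nat.cast_nonneg N).trans hx.1) v
    · intro x hx
      exact hasDerivAt_ray (j + 2) hv ((Nat.cast_nonneg N).trans hx.1) (v * v)
    · intro x hx
      have hx0 : 0 ≤ x := (Nat.cast_nonneg N).trans hx.1
      have h1 := h v hv x hx0
      rw [norm_mul, norm_mul, norm_mul, ← sq, ← pow_succ, mul_assoc]
      refine mul_le_mul_of_nonneg_left (h1.trans ?_) (by positivity)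
      rw [mul_one_div]
      have := hx.1
      gcongr
  -- The primitives telescope and the end point averages form the series with half weights at its
  -- ends. The total error `‖v‖ ^ 3 (1 + 1 / ‖v‖)`, divided by `‖v‖`, is of order `‖v‖`.
  have hsum : ∀ M : ℕ, ∑ N ∈ range M,
      (D j (N + 1) - D j N - (v * D (j + 1) N + v * D (j + 1) (N + 1)) / 2)
      = D j M - D j 0 - v * (∑ d ∈ range M, D (j + 1) ((d + 1 : ℕ) : ℝ)
        + D (j + 1) 0 / 2 - D (j + 1) M / 2) := by
    intro M
    induction M with
    | zero => simp
    | succ M ih =>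
      rw [sum_range_succ, ih, sum_range_succ]
      push_cast
      ring
  have hbound : ∀ M : ℕ, ‖D j M - D j 0 - v * (∑ d ∈ range M, D (j + 1) ((d + 1 : ℕ) : ℝ)
        + D (j + 1) 0 / 2 - D (j + 1) M / 2)‖
      ≤ ‖v‖ ^ 3 * (C * (‖v‖ / v.re) ^ (j + 4)) * (1 + 1 / ‖v‖) := by
    intro M
    rw [← hsum]
    refine (norm_sum_le _ _).trans ((sum_le_sum fun N _ => hstep N).trans ?_)
    rw [← mul_sum]
    gcongr
    exact sum_one_div_sq_le hv0 M
  have hlim0 : Tendsto (fun M : ℕ => D j M) atTop (𝓝 0) := by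
    have h1 : Tendsto (fun M : ℕ => C' / v.re ^ (j + 1) * (1 / ((M : ℝ)) ^ (j + 1))) atTop (𝓝 0) := by
      rw [← mul_zero (C' / v.re ^ (j + 1))]
      refine Tendsto.const_mul _ ?_
      have := (tendsto_one_div_atTop_nhds_zero_nat (𝕜 := ℝ)).pow (j + 1)
      simpa using this
    refine squeeze_zero_norm' ?_ h1
    filter_upwards [eventually_ge_atTop 1] with M hM
    have hM' : (0 : ℝ) < M := by exact_mod_cast hM
    have h2 := h' ((M : ℝ) * v) (by rw [Complex.re_ofReal_mul]; positivity)
    rw [Complex.re_ofReal_mul, mul_pow] at h2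
    refine h2.trans (le_of_eq ?_)
    field_simp
  have hS := (summable_iteratedDeriv_ray j hv).hasSum.tendsto_sum_nat
  have hlim1 : Tendsto (fun M : ℕ => D (j + 1) M) atTop (𝓝 0) :=
    (tendsto_add_atTop_iff_nat 1).1 (summable_iteratedDeriv_ray j hv).tendsto_atTop_zero
  have hlim := (((hlim0.sub_const (D j 0)).sub (((hS.add_const (D (j + 1) 0 / 2)).sub
    (hlim1.div_const 2)).const_mul v)).norm)
  have hfin := le_of_tendsto hlim (Eventually.of_forall hbound)
  have e : ∑' d : ℕ, iteratedDeriv (j + 1) expReg (((d + 1 : ℕ) : ℝ) * v)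
      + iteratedDeriv j expReg 0 * v⁻¹ + iteratedDeriv (j + 1) expReg 0 / 2
      = -v⁻¹ * (0 - D j 0 - v * (∑' d : ℕ, iteratedDeriv (j + 1) expReg (((d + 1 : ℕ) : ℝ) * v)
        + D (j + 1) 0 / 2 - 0 / 2)) := by
    simp only [hD, Complex.ofReal_zero, zero_mul]
    linear_combination (-(∑' d : ℕ, iteratedDeriv (j + 1) expReg (((d + 1 : ℕ) : ℝ) * v)
      + iteratedDeriv (j + 1) expReg 0 / 2)) * inv_mul_cancel₀ hvne
  simp only
  rw [e, norm_mul, norm_neg, norm_inv]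
  calc _ ≤ ‖v‖⁻¹ * (‖v‖ ^ 3 * (C * (‖v‖ / v.re) ^ (j + 4)) * (1 + 1 / ‖v‖)) := by gcongr
    _ = C * ‖v‖ * (‖v‖ + 1) * (‖v‖ / v.re) ^ (j + 4) := by field_simp
    _ ≤ C * ‖v‖ * 6 * (‖v‖ / v.re) ^ (j + 4) := by
        gcongr
        linarith [norm_le_of_mem_strip hv]
    _ = _ := by
        rw [zpow_one]
        ring

end ClosedSRW

namespace ClosedSRW

open Finset Real Metric Filter Topology

/-! ### Lambert series -/

/-- Up to sign, the `k`-th derivative of `1 / (exp w - 1)`. -/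
noncomputable def expDer (k : ℕ) (w : ℂ) : ℂ :=
  k.factorial * (w ^ (k + 1))⁻¹ + (-1) ^ k * iteratedDeriv k expReg w

/-- The function `1 / (1 - exp (-w))`. -/
noncomputable def bose (w : ℂ) : ℂ := geom (Complex.exp (-w))

theorem ne_zero_of_re_pos {w : ℂ} (hw : 0 < w.re) : w ≠ 0 := by
  rintro rfl
  simp at hw

theorem expDer_zero {w : ℂ} (hw : 0 < w.re) : expDer 0 w = bose w - 1 := by
  have h0 := ne_zero_of_re_pos hw
  have h1 := sub_ne_zero.2 (exp_ne_one (Or.inl hw) h0)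
  have h2 := one_sub_ne_zero (norm_exp_neg_lt_one hw)
  have h3 := Complex.exp_ne_zero w
  simp only [expDer, iteratedDeriv_zero, expReg_eq h0, bose, geom]
  rw [Complex.exp_neg] at *
  have h4 : 1 - (Complex.exp w)⁻¹ = (Complex.exp w - 1) / Complex.exp w := by
    field_simp
  rw [h4]
  simp only [Nat.factorial]
  field_simp
  push_cast
  ring

theorem hasDerivAt_expDer (k : ℕ) {w : ℂ} (hw : 0 < w.re) :
    HasDerivAt (expDer k) (-expDer (k + 1) w) w := by
  have h0 := ne_zero_of_re_pos hw
  have h1 := ((hasDerivAt_pow (k + 1) w).fun_inv (pow_ne_zero _ h0)).const_mul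
    (k.factorial : ℂ)
  have h2 := (hasDerivAt_iteratedDeriv_expReg k (Or.inl hw)).const_mul ((-1 : ℂ) ^ k)
  refine (h1.add h2).congr_deriv ?_
  rw [expDer, Nat.factorial_succ]
  push_cast
  field_simp
  ring

theorem hasDerivAt_bose {w : ℂ} (hw : 0 < w.re) :
    HasDerivAt bose (-(bose w * (bose w - 1))) w := by
  have h2 := one_sub_ne_zero (norm_exp_neg_lt_one hw)
  have h3 : HasDerivAt (fun w : ℂ => 1 - Complex.exp (-w)) (Complex.exp (-w)) w := by
    have := ((hasDerivAt_neg w).cexp).const_sub 1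
    simpa using this
  refine (h3.fun_inv h2).congr_deriv ?_
  rw [bose, geom]
  field_simp
  ring

/-- Both sides are minus the derivative of `bose - 1 = expDer 0`. -/
theorem bose_mul {w : ℂ} (hw : 0 < w.re) : bose w * (bose w - 1) = expDer 1 w := by
  have h1 : HasDerivAt (fun w => bose w - 1) (-expDer 1 w) w := by
    refine (hasDerivAt_expDer 0 hw).congr_of_eventuallyEq ?_
    have : {w : ℂ | 0 < w.re} ∈ 𝓝 w :=
      (isOpen_lt continuous_const Complex.continuous_re).mem_nhds hw
    filter_upwards [this] with z hz
    rw [expDer_zero hz]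
  exact neg_injective (((hasDerivAt_bose hw).sub_const 1).unique h1)

/-- With `X = bose w`, differentiating `X ^ (m + 1) (X - 1)` multiplies it by `-((m + 2) X - (m +
1))`, while `expDer k` becomes `-expDer (k + 1)`; this raises the power of `X`. Only the two top
coefficients are recorded, since no other can affect the linear term in `tanhHalf`. -/
theorem bose_pow_mul (m : ℕ) : ∃ γ : ℕ → ℂ,
    (∀ w : ℂ, 0 < w.re → bose w ^ (m + 1) * (bose w - 1)
      = ∑ k ∈ range (m + 1), γ k * expDer (k + 1) w) ∧
    γ m = 1 / (m + 1).factorial ∧ ∀ i, m = i + 1 → γ i = m / 2 / m.factorial := by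
  induction m with
  | zero => exact ⟨fun _ => 1, fun w hw => by simp [bose_mul hw], by simp, by simp⟩
  | succ m ih =>
    obtain ⟨γ, h, h1, h2⟩ := ih
    have hm : (m : ℂ) + 2 ≠ 0 := by exact_mod_cast Nat.succ_ne_zero (m + 1)
    have hm1 : (m : ℂ) + 1 ≠ 0 := by exact_mod_cast Nat.succ_ne_zero m
    refine ⟨fun k => ((if k = 0 then 0 else γ (k - 1))
      + if k ≤ m then (m + 1) * γ k else 0) / (m + 2), fun w hw => ?_, ?_, ?_⟩
    · have d1 : HasDerivAt (fun w => bose w ^ (m + 1) * (bose w - 1))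
          (-∑ k ∈ range (m + 1), γ k * expDer (k + 2) w) w := by
        have d2 : HasDerivAt (fun w => ∑ k ∈ range (m + 1), γ k * expDer (k + 1) w)
            (∑ k ∈ range (m + 1), γ k * -expDer (k + 2) w) w :=
          HasDerivAt.fun_sum fun k _ => (hasDerivAt_expDer (k + 1) hw).const_mul (γ k)
        have d3 := d2.congr_of_eventuallyEq (f₁ := fun w => bose w ^ (m + 1) * (bose w - 1)) (by
          have : {w : ℂ | 0 < w.re} ∈ 𝓝 w :=
            (isOpen_lt continuous_const Complex.continuous_re).mem_nhds hw
          filter_upwards [this] with z hz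
          rw [h z hz])
        refine d3.congr_deriv ?_
        simp
      have d4 := ((hasDerivAt_bose hw).fun_pow (m + 1)).fun_mul ((hasDerivAt_bose hw).sub_const 1)
      have e := d4.unique d1
      rw [Nat.add_sub_cancel] at e
      have e' : ∑ k ∈ range (m + 1), γ k * expDer (k + 2) w
          = bose w ^ (m + 1) * (bose w - 1) * ((m + 2) * bose w - (m + 1)) := by
        push_cast at e
        linear_combination e
      have e2 : (∑ k ∈ range (m + 2), ((if k = 0 then 0 else γ (k - 1))
          + if k ≤ m then (m + 1) * γ k else 0) / (m + 2) * expDer (k + 1) w)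
          = (∑ k ∈ range (m + 1), γ k * expDer (k + 2) w
            + (m + 1) * ∑ k ∈ range (m + 1), γ k * expDer (k + 1) w) / (m + 2) := by
        rw [mul_sum, add_div, sum_div, sum_div]
        have e3 : ∀ x y z : ℂ, (x + y) / (m + 2) * z = x * z / (m + 2) + y * z / (m + 2) := by
          intros
          ring
        simp only [e3, sum_add_distrib]
        congr 1
        · rw [sum_range_succ']
          simp
        · rw [sum_range_succ, if_neg (by omega)]
          simp only [zero_div, zero_mul, add_zero]
          refine sum_congr rfl fun k hk => ?_
          rw [if_pos (by simp at hk; omega)]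
          ring
      rw [e2, e', ← h w hw]
      field_simp
      ring
    · simp only [Nat.add_sub_cancel, if_neg (Nat.succ_ne_zero m), if_neg (show ¬m + 1 ≤ m by omega),
        h1, add_zero]
      have hf : ((m + 1).factorial : ℂ) ≠ 0 := by exact_mod_cast Nat.factorial_ne_zero (m + 1)
      rw [Nat.factorial_succ (m + 1)]
      push_cast
      rw [show (m : ℂ) + 1 + 1 = m + 2 by ring]
      field_simp
    · intro i hi
      obtain rfl : i = m := by omega
      simp only [le_refl, if_true, h1]
      have hf : (i.factorial : ℂ) ≠ 0 := by exact_mod_cast Nat.factorial_ne_zero i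
      cases i with
      | zero => simp
      | succ i =>
        rw [if_neg (Nat.succ_ne_zero i), Nat.add_sub_cancel, h2 i rfl, Nat.factorial_succ (i + 1)]
        push_cast at *
        field_simp

/-- Products of powers of `1 / (1 - exp (-w))` and `1 / (exp w - 1)` in terms of derivatives. -/
theorem bose_pow_mul_pow (b a q : ℕ) (hq : a + b = q) : ∃ γ : ℕ → ℂ,
    (∀ w : ℂ, 0 < w.re → bose w ^ (a + 1) * (bose w - 1) ^ (b + 1)
      = ∑ k ∈ range (q + 1), γ k * expDer (k + 1) w) ∧
    γ q = 1 / (q + 1).factorial ∧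
      ∀ i, q = i + 1 → γ i = ((a : ℂ) - b) / 2 / q.factorial := by
  induction b generalizing a q with
  | zero =>
    obtain rfl : a = q := by omega
    simpa using bose_pow_mul a
  | succ b ih =>
    obtain ⟨γ, h, h1, h2⟩ := ih (a + 1) q (by omega)
    obtain ⟨γ', h', h1', h2'⟩ := ih a (a + b) rfl
    obtain rfl : q = a + b + 1 := by omega
    refine ⟨fun k => γ k - if k ≤ a + b then γ' k else 0, fun w hw => ?_, ?_, ?_⟩
    · have e : bose w ^ (a + 1) * (bose w - 1) ^ (b + 1 + 1)
          = bose w ^ (a + 1 + 1) * (bose w - 1) ^ (b + 1)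
            - bose w ^ (a + 1) * (bose w - 1) ^ (b + 1) := by ring
      rw [e, h w hw, h' w hw]
      simp only [sub_mul, sum_sub_distrib]
      congr 1
      rw [sum_range_succ _ (a + b + 1), if_neg (by omega), zero_mul, add_zero]
      refine sum_congr rfl fun k hk => ?_
      rw [if_pos (by simp at hk; omega)]
    · simp only [if_neg (show ¬a + b + 1 ≤ a + b by omega), h1, sub_zero]
    · intro i hi
      obtain rfl : i = a + b := by omega
      have hf : ((a + b).factorial : ℂ) ≠ 0 := by exact_mod_cast Nat.factorial_ne_zero (a + b)
      have hf' : (a : ℂ) + b + 1 ≠ 0 := by exact_mod_cast Nat.succ_ne_zero (a + b)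
      simp only [le_refl, if_true]
      rw [h2 _ rfl, h1', Nat.factorial_succ (a + b)]
      push_cast
      field_simp
      ring

/-- The Lambert series `∑ d ≥ 1, expDer k (d * v)`. -/
noncomputable def lambert (k : ℕ) (v : ℂ) : ℂ := ∑' d : ℕ, expDer k (((d + 1 : ℕ) : ℝ) * v)

theorem hasSum_zeta (j : ℕ) :
    HasSum (fun d : ℕ => 1 / ((d + 1 : ℕ) : ℂ) ^ (j + 2)) (riemannZeta (j + 2 : ℕ)) := by
  rw [zeta_nat_eq_tsum_of_gt_one (by omega)]
  have hs : Summable fun n : ℕ => 1 / (n : ℂ) ^ (j + 2) := by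
    have := (Real.summable_one_div_nat_pow (p := j + 2)).2 (by omega)
    refine Summable.of_norm (this.congr fun n => ?_)
    simp
  rw [hs.tsum_eq_zero_add]
  simp only [Nat.cast_zero, ne_eq, Nat.add_eq_zero_iff, OfNat.ofNat_ne_zero, and_false,
    not_false_eq_true, zero_pow, div_zero, zero_add]
  exact ((summable_nat_add_iff 1).2 hs).hasSum

theorem hasSum_expDer (j : ℕ) {v : ℂ} (hv : v ∈ strip) :
    HasSum (fun d : ℕ => expDer (j + 1) (((d + 1 : ℕ) : ℝ) * v))
      ((j + 1).factorial * riemannZeta (j + 2 : ℕ) * (v ^ (j + 2))⁻¹ + (-1) ^ (j + 1) *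
        ∑' d : ℕ, iteratedDeriv (j + 1) expReg (((d + 1 : ℕ) : ℝ) * v)) := by
  have h1 := ((hasSum_zeta j).mul_left ((j + 1).factorial : ℂ)).mul_right ((v ^ (j + 2))⁻¹)
  have h2 := (summable_iteratedDeriv_ray j hv).hasSum.mul_left ((-1 : ℂ) ^ (j + 1))
  convert! h1.add h2 using 1
  ext d
  rw [expDer, mul_pow, mul_inv, one_div]
  push_cast
  ring

/-- The poles at the points `d v` sum to the zeta value; the regular parts contribute the boundary
terms of the trapezoidal rule. -/
theorem tame_lambert (j : ℕ) : Tame 1 (fun v => lambert (j + 1) v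
    - (j + 1).factorial * riemannZeta (j + 2 : ℕ) * (v ^ (j + 2))⁻¹
    - (-1) ^ j * iteratedDeriv j expReg 0 * v⁻¹
    - (-1) ^ j * iteratedDeriv (j + 1) expReg 0 / 2) := by
  refine ((tame_tsum_iteratedDeriv j).const_mul ((-1) ^ (j + 1))).congr fun v hv => ?_
  rw [lambert, (hasSum_expDer j hv).tsum_eq]
  ring

/-! ### Expansions in powers of `tanh (v / 2)` -/

/-- The function `f` is a quadratic polynomial in `tanh (v / 2)` up to a remainder of order 3. -/
def HasExp (f : ℂ → ℂ) (α β γ : ℂ) : Prop :=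
  Tame 3 (fun v => f v - (α + β * tanhHalf v + γ * tanhHalf v ^ 2))

namespace HasExp

variable {f g : ℂ → ℂ} {α β γ α' β' γ' : ℂ}

theorem congr (hf : HasExp f α β γ) (h : ∀ v ∈ strip, f v = g v) : HasExp g α β γ :=
  Tame.congr hf fun v hv => by rw [h v hv]

theorem add (hf : HasExp f α β γ) (hg : HasExp g α' β' γ') :
    HasExp (fun v => f v + g v) (α + α') (β + β') (γ + γ') :=
  (Tame.add hf hg).congr fun v _ => by ring

theorem const_mul (c : ℂ) (hf : HasExp f α β γ) :
    HasExp (fun v => c * f v) (c * α) (c * β) (c * γ) :=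
  (Tame.const_mul c hf).congr fun v _ => by ring

theorem of_tame (hf : Tame 3 f) : HasExp f 0 0 0 := hf.congr fun v _ => by ring

theorem const (c : ℂ) : HasExp (fun _ => c) c 0 0 := Tame.zero.congr fun v _ => by ring

theorem tame_zero (hf : HasExp f α β γ) : Tame 0 f :=
  (((Tame.mono hf (by norm_num)).add (Tame.const α)).add
    (((tame_tanhHalf.const_mul β).mono (by norm_num)).add
      (((tame_tanhHalf.pow 2).const_mul γ).mono (by norm_num)))).congr fun v _ => by ring

theorem tanhHalf : HasExp tanhHalf 0 1 0 := Tame.zero.congr fun v _ => by ring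

theorem mul (hf : HasExp f α β γ) (hg : HasExp g α' β' γ') :
    HasExp (fun v => f v * g v) (α * α') (α * β' + β * α') (α * γ' + β * β' + γ * α') := by
  have h1 : HasExp (fun v => α + β * ClosedSRW.tanhHalf v + γ * ClosedSRW.tanhHalf v ^ 2) α β γ :=
    Tame.zero.congr fun v _ => by ring
  have h2 : Tame 3 (fun v => ClosedSRW.tanhHalf v ^ 3) := by simpa using tame_tanhHalf.pow 3
  have h3 : Tame 3 (fun v => ClosedSRW.tanhHalf v ^ 3
      * ((β * γ' + γ * β') + γ * γ' * ClosedSRW.tanhHalf v)) :=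
    h2.mul (e' := 0) ((Tame.const _).add ((tame_tanhHalf.const_mul _).mono (by norm_num)))
  have h4 := (Tame.mul hf hg.tame_zero).mono (e' := 3) (by norm_num)
  have h5 := (Tame.mul h1.tame_zero hg).mono (e' := 3) (by norm_num)
  exact ((h4.add h5).add h3).congr fun v _ => by ring

theorem pow (hf : HasExp f α 0 γ) (k : ℕ) : ∃ γ', HasExp (fun v => f v ^ k) (α ^ k) 0 γ' := by
  induction k with
  | zero => exact ⟨0, by simpa using const 1⟩
  | succ k ih =>
    obtain ⟨γ', h⟩ := ih
    exact ⟨_, by simpa [pow_succ] using h.mul hf⟩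

theorem sum {ι : Type*} (s : Finset ι) {F : ι → ℂ → ℂ} {b : ι → ℂ}
    (h : ∀ i ∈ s, ∃ α γ, HasExp (F i) α (b i) γ) :
    ∃ α γ, HasExp (fun v => ∑ i ∈ s, F i v) α (∑ i ∈ s, b i) γ := by
  classical
  induction s using Finset.induction_on with
  | empty => exact ⟨0, 0, by simpa using const 0⟩
  | insert a s ha ih =>
    obtain ⟨α, γ, h1⟩ := ih fun i hi => h i (mem_insert_of_mem hi)
    obtain ⟨α', γ', h2⟩ := h a (mem_insert_self a s)
    exact ⟨_, _, by simpa only [sum_insert ha] using h2.add h1⟩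

theorem tanhHalf_pow_mul (hf : HasExp f α β γ) (k : ℕ) : ∃ α' γ', HasExp
    (fun v => ClosedSRW.tanhHalf v ^ k * f v) α' (if k = 0 then β else if k = 1 then α else 0) γ' := by
  match k with
  | 0 => exact ⟨α, γ, by simpa using hf⟩
  | 1 => exact ⟨_, _, by simpa using tanhHalf.mul hf⟩
  | k + 2 =>
    have h2 : HasExp (fun v => ClosedSRW.tanhHalf v ^ 2) 0 0 1 :=
      Tame.zero.congr fun v _ => by ring
    have h3 : Tame 0 (fun v => ClosedSRW.tanhHalf v ^ k) :=
      (tame_tanhHalf.pow k).mono (by positivity)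
    cases k with
    | zero => exact ⟨_, _, by simpa using h2.mul hf⟩
    | succ k =>
      refine ⟨0, 0, ?_⟩
      simp only [Nat.add_eq_zero_iff, OfNat.ofNat_ne_zero, and_false, if_false,
        Nat.reduceEqDiff]
      refine of_tame ((((tame_tanhHalf.pow (k + 1 + 2)).mul hf.tame_zero).mono ?_))
      push_cast
      linarith

end HasExp

/-- From `v = 2 s + 2 s ^ 3 / 3 + …` with `s = tanhHalf v`. The absence of a linear term passes to
all powers. -/
theorem hasExp_tanhHalf_div : HasExp (fun v => tanhHalf v * v⁻¹) (1 / 2) 0 (-1 / 6) := by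
  have hinv : Tame (-1) (fun v : ℂ => v⁻¹) := by simpa using Tame.id_zpow (-1)
  have h1 : Tame 3 (fun v => (tanhHalf v - v / 2 + v ^ 3 / 24) * v⁻¹) := by
    simpa using tame_tanhHalf_sub.mul hinv
  have h3 : Tame 3 (fun v : ℂ => v ^ 3) := by simpa using tame_id.pow 3
  have h4 : Tame 3 (fun v => tanhHalf v - v / 2) :=
    ((tame_tanhHalf_sub.mono (by norm_num)).sub (h3.const_mul (1 / 24))).congr fun v _ => by ring
  have h5 : Tame 3 (fun v => (tanhHalf v - v / 2) * (tanhHalf v + v / 2)) :=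
    (h4.mul (tame_tanhHalf.add (tame_id.const_mul (1 / 2)))).mono (by norm_num) |>.congr
      fun v _ => by ring
  refine (h1.add (h5.const_mul (1 / 6))).congr fun v hv => ?_
  have hv0 : v ≠ 0 := norm_pos_iff.1 (norm_pos_of_mem_strip hv)
  field_simp
  ring

/-- The zeta part is `s ^ i (s / v) ^ (j + 2)`, linear in `s` only for `i = 1`. The part with `v⁻¹`
is `s ^ (i + j + 1) (s / v)`, linear only for `i + j = 0`, with coefficient `expReg 0 / 2 = -1 / 4`.
The constant part carries at least `s ^ 2`. -/
theorem hasExp_lambert (i j : ℕ) : ∃ α γ,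
    HasExp (fun v => tanhHalf v ^ (i + j + 2) * lambert (j + 1) v) α
      ((if i = 1 then (j + 1).factorial * riemannZeta (j + 2 : ℕ) * (1 / 2) ^ (j + 2) else 0)
        + (if i + j = 0 then -1 / 4 else 0)) γ := by
  obtain ⟨γ₁, h1⟩ := hasExp_tanhHalf_div.pow (j + 2)
  obtain ⟨α₁, γ₁', h1'⟩ := h1.tanhHalf_pow_mul i
  obtain ⟨α₂, γ₂, h2⟩ := hasExp_tanhHalf_div.tanhHalf_pow_mul (i + j + 1)
  obtain ⟨α₃, γ₃, h3⟩ := (HasExp.const 1).tanhHalf_pow_mul (i + j + 2)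
  have h4 := HasExp.of_tame (((tame_tanhHalf.pow (i + j + 2)).mul (tame_lambert j)).mono
    (e' := 3) (by push_cast; linarith))
  have h5 := (((h1'.const_mul ((j + 1).factorial * riemannZeta (j + 2 : ℕ))).add
    (h2.const_mul ((-1) ^ j * iteratedDeriv j expReg 0))).add
    (h3.const_mul ((-1) ^ j * iteratedDeriv (j + 1) expReg 0 / 2))).add h4
  have hβ : (j + 1).factorial * riemannZeta (j + 2 : ℕ)
        * (if i = 0 then 0 else if i = 1 then (1 / 2) ^ (j + 2) else 0)
      + (-1) ^ j * iteratedDeriv j expReg 0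
        * (if i + j + 1 = 0 then 0 else if i + j + 1 = 1 then 1 / 2 else 0)
      + (-1) ^ j * iteratedDeriv (j + 1) expReg 0 / 2
        * (if i + j + 2 = 0 then 0 else if i + j + 2 = 1 then 1 else 0) + 0
      = (if i = 1 then (j + 1).factorial * riemannZeta (j + 2 : ℕ) * (1 / 2) ^ (j + 2) else 0)
        + (if i + j = 0 then (-1 / 4 : ℂ) else 0) := by
    have e1 : (if i = 0 then (0 : ℂ) else if i = 1 then (1 / 2) ^ (j + 2) else 0)
        = if i = 1 then (1 / 2) ^ (j + 2) else 0 := by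
      by_cases h : i = 0 <;> simp [h]
    rw [e1]
    by_cases h : i + j = 0
    · obtain ⟨rfl, rfl⟩ : i = 0 ∧ j = 0 := by omega
      simp [expReg_zero]
      norm_num
    · rw [if_neg h, if_neg (Nat.succ_ne_zero _), if_neg (show ¬i + j + 1 = 1 by omega),
        if_neg (Nat.succ_ne_zero _), if_neg (show ¬i + j + 2 = 1 by omega)]
      simp
  rw [hβ] at h5
  refine ⟨_, _, h5.congr fun v hv => ?_⟩
  rw [mul_pow]
  ring

theorem mem_strip_re {v : ℂ} (hv : v ∈ strip) (d : ℕ) :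
    0 < ((((d + 1 : ℕ) : ℝ) : ℂ) * v).re := by
  have := hv.1
  rw [Complex.re_ofReal_mul]
  positivity

theorem bose_nat_mul (d : ℕ) (v : ℂ) :
    bose ((((d + 1 : ℕ) : ℝ) : ℂ) * v) = geom (Complex.exp (-v) ^ (d + 1)) := by
  rw [bose, ← Complex.exp_nat_mul]
  push_cast
  ring_nf

/-- The sum over all distances of a product of powers. -/
noncomputable def geomSum (a b : ℕ) (v : ℂ) : ℂ :=
  ∑' d : ℕ, geom (Complex.exp (-v) ^ (d + 1)) ^ (a + 1)
    * (geom (Complex.exp (-v) ^ (d + 1)) - 1) ^ (b + 1)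

theorem summable_geomSum (a b : ℕ) {v : ℂ} (hv : v ∈ strip) :
    Summable fun d : ℕ => geom (Complex.exp (-v) ^ (d + 1)) ^ (a + 1)
    * (geom (Complex.exp (-v) ^ (d + 1)) - 1) ^ (b + 1) := by
  obtain ⟨γ, h, -, -⟩ := bose_pow_mul_pow b a (a + b) rfl
  simp only [← bose_nat_mul, h _ (mem_strip_re hv _)]
  exact summable_sum fun k _ => (hasSum_expDer k hv).summable.mul_left _

theorem hasExp_geomSum (a b : ℕ) : ∃ α γ,
    HasExp (fun v => tanhHalf v ^ (a + b + 2) * geomSum a b v) α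
      (if a + b = 0 then -1 / 4
        else ((a : ℂ) - b) / 2 * riemannZeta (a + b + 1 : ℕ) * (1 / 2) ^ (a + b + 1)) γ := by
  obtain ⟨c, h, h1, h2⟩ := bose_pow_mul_pow b a (a + b) rfl
  have e : ∀ v ∈ strip, ∑ k ∈ range (a + b + 1),
      c k * (tanhHalf v ^ ((a + b - k) + k + 2) * lambert (k + 1) v)
      = tanhHalf v ^ (a + b + 2) * geomSum a b v := by
    intro v hv
    have e1 : geomSum a b v = ∑ k ∈ range (a + b + 1), c k * lambert (k + 1) v := by
      unfold geomSum lambert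
      simp only [← bose_nat_mul, h _ (mem_strip_re hv _)]
      rw [Summable.tsum_finsetSum fun k _ => (hasSum_expDer k hv).summable.mul_left _]
      exact sum_congr rfl fun k _ => tsum_mul_left
    rw [e1, mul_sum]
    refine sum_congr rfl fun k hk => ?_
    rw [show a + b - k + k + 2 = a + b + 2 by simp at hk; omega]
    ring
  obtain ⟨α, γ, h3⟩ := HasExp.sum (range (a + b + 1))
    (F := fun k v => c k * (tanhHalf v ^ ((a + b - k) + k + 2) * lambert (k + 1) v))
    (fun k _ => by
      obtain ⟨α, γ, h⟩ := hasExp_lambert (a + b - k) k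
      exact ⟨_, _, h.const_mul (c k)⟩)
  refine ⟨α, γ, ?_⟩
  convert! h3.congr e using 1
  by_cases hab : a + b = 0
  · rw [if_pos hab, hab, zero_add, sum_range_one]
    rw [hab] at h1
    simp [h1]
  · rw [if_neg hab]
    obtain ⟨q, hq⟩ := Nat.exists_eq_succ_of_ne_zero hab
    -- Only the second coefficient from the top meets `hasExp_lambert` with `i = 1`; the factorials
    -- cancel.
    rw [sum_eq_single q]
    · rw [h2 q hq, if_pos (by omega), if_neg (by omega), hq]
      have hf : ((q + 1).factorial : ℂ) ≠ 0 := by exact_mod_cast Nat.factorial_ne_zero (q + 1)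
      rw [add_zero, show q.succ + 1 = q + 2 by rfl]
      simp only [Nat.succ_eq_add_one]
      field_simp
    · intro k hk hkq
      rw [if_neg (by simp at hk; omega), if_neg (by simp at hk; omega)]
      simp
    · intro h
      simp at h
      omega

end ClosedSRW

namespace ClosedSRW

open Finset Real Metric Filter Topology

/-! ### The expansion of the pair sum -/

theorem binomTerm_one_add (y : ℂ) (K l : ℕ) :
    binomTerm (1 + y) K l = ∑ i ∈ range (K + 1), (K.choose i : ℂ) * binomTerm y i l := by
  induction K generalizing l with
  | zero => simp [binomTerm]
  | succ K ih =>
    rw [sum_choose_succ_mul (fun i _ => binomTerm y i l) K]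
    cases l with
    | zero =>
      simp only [binomTerm_succ_zero, ih, mul_left_comm _ y, ← mul_sum]
      ring
    | succ l =>
      simp only [binomTerm_succ_succ, ih, mul_add, sum_add_distrib, mul_left_comm _ y, ← mul_sum]
      ring

theorem binomTerm_mul_binomTerm (s X : ℂ) (i j l : ℕ) :
    binomTerm (-(s * X)) i l * binomTerm (-(s * X)) j l * (s ^ 2 * (X * (X - 1))) ^ (l + 1)
      = (-1) ^ (i + j) * ((i.choose l : ℂ) * j.choose l)
        * (s ^ (i + j + 2) * (X ^ (i + j - l + 1) * (X - 1) ^ (l + 1))) := by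
  by_cases hi : i < l
  · rw [binomTerm_eq_zero _ hi, Nat.choose_eq_zero_of_lt hi]
    simp
  by_cases hj : j < l
  · rw [binomTerm_eq_zero _ hj, Nat.choose_eq_zero_of_lt hj]
    simp
  obtain ⟨i, rfl⟩ := Nat.exists_eq_add_of_le (not_lt.1 hi)
  obtain ⟨j, rfl⟩ := Nat.exists_eq_add_of_le (not_lt.1 hj)
  simp only [binomTerm, Nat.add_sub_cancel_left]
  rw [show l + i + (l + j) - l + 1 = i + j + l + 1 by omega, neg_pow, neg_pow (s * X) j,
    show (-1 : ℂ) ^ (l + i + (l + j)) = (-1) ^ i * (-1) ^ j by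
      rw [show l + i + (l + j) = 2 * l + (i + j) by ring, pow_add, pow_mul]
      simp [pow_add], mul_pow (s ^ 2), mul_pow X]
  ring

/-- Expanding the powers of `1 - s X` makes each summand homogeneous: `s` has the same degree as `X`
and `X - 1` together, so it compensates their poles at `v = 0`. -/
theorem pairTerm_eq (a b : ℕ) (s X : ℂ) : pairTerm a b s X
    = ∑ i ∈ range (a + 1), ∑ j ∈ range (b + 1), ∑ l ∈ range (b + 1),
      (a.choose i : ℂ) * b.choose j * (-1) ^ (i + j)
        * (1 / ((l : ℂ) + 1) * (i.choose l * j.choose l))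
        * (s ^ (i + j + 2) * (X ^ (i + j - l + 1) * (X - 1) ^ (l + 1))) := by
  have h : ∀ l : ℕ, 1 / ((l : ℂ) + 1) * binomTerm (1 - s * X) a l * binomTerm (1 - s * X) b l
      * (s ^ 2 * (X * (X - 1))) ^ (l + 1)
      = ∑ i ∈ range (a + 1), ∑ j ∈ range (b + 1), (a.choose i : ℂ) * b.choose j * (-1) ^ (i + j)
        * (1 / ((l : ℂ) + 1) * (i.choose l * j.choose l))
        * (s ^ (i + j + 2) * (X ^ (i + j - l + 1) * (X - 1) ^ (l + 1))) := by
    intro l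
    rw [sub_eq_add_neg, binomTerm_one_add, binomTerm_one_add, mul_assoc (1 / ((l : ℂ) + 1)),
      sum_mul_sum, mul_sum, sum_mul]
    refine sum_congr rfl fun i _ => ?_
    rw [mul_sum, sum_mul]
    refine sum_congr rfl fun j _ => ?_
    linear_combination (1 / ((l : ℂ) + 1) * (a.choose i * b.choose j))
      * binomTerm_mul_binomTerm s X i j l
  rw [pairTerm, sum_congr rfl fun l _ => h l, sum_comm]
  refine sum_congr rfl fun i _ => ?_
  rw [sum_comm]

theorem pairSum_exp_neg (a b : ℕ) {v : ℂ} (hv : v ∈ strip) : pairSum a b (Complex.exp (-v))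
    = ∑ i ∈ range (a + 1), ∑ j ∈ range (b + 1), ∑ l ∈ range (b + 1),
      (a.choose i : ℂ) * b.choose j * (-1) ^ (i + j)
        * (1 / ((l : ℂ) + 1) * (i.choose l * j.choose l))
        * (tanhHalf v ^ (i + j + 2) * geomSum (i + j - l) l v) := by
  refine HasSum.tsum_eq ?_
  simp only [pairTerm_eq]
  exact hasSum_sum fun i _ => hasSum_sum fun j _ => hasSum_sum fun l _ =>
    (((summable_geomSum (i + j - l) l hv).hasSum.mul_left _).mul_left _)

/-- The linear coefficient of a pair of powers. -/
noncomputable def linCoeff (i j : ℕ) : ℂ :=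
  if i + j = 0 then -1 / 4
  else (((i + j + 2).choose (i + 1) : ℂ) / 2 - (i + j).choose i) * riemannZeta (i + j + 1 : ℕ)
    * (1 / 2) ^ (i + j + 1)

theorem sum_choose_mul_choose {i j b : ℕ} (hj : j ≤ b) :
    ∑ l ∈ range (b + 1), (i.choose l : ℂ) * j.choose l = (i + j).choose i := by
  have h := Nat.add_choose_eq i j j
  rw [Nat.sum_antidiagonal_eq_sum_range_succ_mk] at h
  rw [Nat.choose_symm_add (a := i), h, ← sum_subset (range_mono (show j + 1 ≤ b + 1 by omega))]
  · push_cast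
    refine sum_congr rfl fun l hl => ?_
    rw [Nat.choose_symm (by simp at hl; omega)]
  · intro l _ hl
    rw [Nat.choose_eq_zero_of_lt (n := j) (by simp at hl; omega)]
    simp

/-- Absorbing `1 / (l + 1)` into `C(i + 1, l + 1)` reduces this to Vandermonde's identity. -/
theorem sum_choose_mul_choose_div {i j b : ℕ} (hj : j ≤ b) :
    ∑ l ∈ range (b + 1), 1 / ((l : ℂ) + 1) * (i.choose l * j.choose l)
      = ((i + j + 2).choose (i + 1) : ℂ) / ((i : ℂ) + j + 2) := by
  have hi : (i : ℂ) + 1 ≠ 0 := by exact_mod_cast Nat.succ_ne_zero i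
  have hij : (i : ℂ) + j + 2 ≠ 0 := by exact_mod_cast Nat.succ_ne_zero (i + j + 1)
  have h := Nat.add_choose_eq (i + 1) j (j + 1)
  rw [Nat.sum_antidiagonal_eq_sum_range_succ_mk, sum_range_succ'] at h
  simp only [Nat.add_sub_add_right, Nat.sub_zero, Nat.choose_succ_self, mul_zero, add_zero] at h
  have h1 : (i + 1 : ℂ) * ∑ l ∈ range (b + 1), 1 / ((l : ℂ) + 1) * (i.choose l * j.choose l)
      = ((i + 1 + j).choose (j + 1) : ℂ) := by
    rw [h, ← sum_subset (range_mono (show j + 1 ≤ b + 1 by omega)), mul_sum]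
    · push_cast
      refine sum_congr rfl fun l hl => ?_
      rw [Nat.choose_symm (by simp at hl; omega)]
      have h2 : ((i + 1 : ℕ) : ℂ) * i.choose l = (i + 1).choose (l + 1) * ((l + 1 : ℕ) : ℂ) := by
        exact_mod_cast Nat.add_one_mul_choose_eq i l
      have hl : (l : ℂ) + 1 ≠ 0 := by exact_mod_cast Nat.succ_ne_zero l
      push_cast at h2
      field_simp
      linear_combination (j.choose l : ℂ) * h2
    · intro l _ hl
      rw [Nat.choose_eq_zero_of_lt (n := j) (by simp at hl; omega)]
      simp
  have h3 : ((i + 1 + j).choose (j + 1) : ℂ) = (i + j + 1).choose i := by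
    rw [show i + 1 + j = i + (j + 1) by ring, ← Nat.choose_symm_add]
    rfl
  have h4 : ((i + j + 2 : ℕ) : ℂ) * (i + j + 1).choose i
      = (i + j + 2).choose (i + 1) * ((i + 1 : ℕ) : ℂ) := by
    exact_mod_cast Nat.add_one_mul_choose_eq (i + j + 1) i
  push_cast at h4
  rw [eq_div_iff hij]
  apply mul_left_cancel₀ hi
  linear_combination ((i : ℂ) + j + 2) * h1 + ((i : ℂ) + j + 2) * h3 + h4

theorem sum_eq_linCoeff {i j b : ℕ} (hj : j ≤ b) :
    ∑ l ∈ range (b + 1), 1 / ((l : ℂ) + 1) * (i.choose l * j.choose l)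
      * (if i + j = 0 then -1 / 4 else ((i : ℂ) + j - 2 * l) / 2 * riemannZeta (i + j + 1 : ℕ)
        * (1 / 2) ^ (i + j + 1)) = linCoeff i j := by
  have h1 := sum_choose_mul_choose_div (i := i) hj
  have h2 := sum_choose_mul_choose (i := i) hj
  have hij : (i : ℂ) + j + 2 ≠ 0 := by exact_mod_cast Nat.succ_ne_zero (i + j + 1)
  unfold linCoeff
  split_ifs with h
  · obtain ⟨rfl, rfl⟩ : i = 0 ∧ j = 0 := by omega
    rw [← sum_mul, h1]
    norm_num
  -- The splitting `(i + j - 2 l) / (2 (l + 1)) = (i + j + 2) / (2 (l + 1)) - 1` leads to the two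
  -- Vandermonde sums.
  · have h3 : ∀ l : ℕ, 1 / ((l : ℂ) + 1) * (i.choose l * j.choose l)
        * (((i : ℂ) + j - 2 * l) / 2 * riemannZeta (i + j + 1 : ℕ) * (1 / 2) ^ (i + j + 1))
        = (((i : ℂ) + j + 2) / 2 * (1 / ((l : ℂ) + 1) * (i.choose l * j.choose l))
          - i.choose l * j.choose l) * (riemannZeta (i + j + 1 : ℕ) * (1 / 2) ^ (i + j + 1)) := by
      intro l
      have hl : (l : ℂ) + 1 ≠ 0 := by exact_mod_cast Nat.succ_ne_zero l
      field_simp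
      ring
    simp only [h3]
    rw [← sum_mul, sum_sub_distrib, ← mul_sum, h1, h2]
    field_simp

theorem hasExp_pairSum (a b : ℕ) : ∃ α γ, HasExp (fun v => pairSum a b (Complex.exp (-v))) α
    (∑ i ∈ range (a + 1), ∑ j ∈ range (b + 1),
      (a.choose i : ℂ) * b.choose j * (-1) ^ (i + j) * linCoeff i j) γ := by
  obtain ⟨α, γ, h⟩ := HasExp.sum (range (a + 1)) fun i _ =>
    HasExp.sum (range (b + 1)) fun j _ => HasExp.sum (range (b + 1))
      (F := fun l v => (a.choose i : ℂ) * b.choose j * (-1) ^ (i + j)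
        * (1 / ((l : ℂ) + 1) * (i.choose l * j.choose l))
        * (tanhHalf v ^ (i + j + 2) * geomSum (i + j - l) l v))
      (b := fun l => (a.choose i : ℂ) * b.choose j * (-1) ^ (i + j)
        * (1 / ((l : ℂ) + 1) * (i.choose l * j.choose l)
        * (if i + j = 0 then -1 / 4 else ((i : ℂ) + j - 2 * l) / 2
          * riemannZeta (i + j + 1 : ℕ) * (1 / 2) ^ (i + j + 1)))) fun l _ => by
      -- If `l` exceeds `i` or `j` the coefficient is `0`; otherwise `i + j - l` is a genuine
      -- difference.
      by_cases hi : i < l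
      · refine ⟨0, 0, ?_⟩
        simpa [Nat.choose_eq_zero_of_lt hi] using HasExp.const 0
      by_cases hj : j < l
      · refine ⟨0, 0, ?_⟩
        simpa [Nat.choose_eq_zero_of_lt hj] using HasExp.const 0
      obtain ⟨α, γ, h⟩ := hasExp_geomSum (i + j - l) l
      have hl : i + j - l + l = i + j := by omega
      have hc : ((i + j - l : ℕ) : ℂ) - l = (i : ℂ) + j - 2 * l := by
        rw [Nat.cast_sub (by omega)]
        push_cast
        ring
      rw [hl, hc] at h
      exact ⟨_, _, by simpa only [mul_assoc] using h.const_mul ((a.choose i : ℂ) * b.choose j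
        * (-1) ^ (i + j) * (1 / ((l : ℂ) + 1) * (i.choose l * j.choose l)))⟩
  refine ⟨α, γ, ?_⟩
  have e : ∑ i ∈ range (a + 1), ∑ j ∈ range (b + 1), ∑ l ∈ range (b + 1),
      (a.choose i : ℂ) * b.choose j * (-1) ^ (i + j)
        * (1 / ((l : ℂ) + 1) * (i.choose l * j.choose l)
        * (if i + j = 0 then -1 / 4 else ((i : ℂ) + j - 2 * l) / 2
          * riemannZeta (i + j + 1 : ℕ) * (1 / 2) ^ (i + j + 1)))
      = ∑ i ∈ range (a + 1), ∑ j ∈ range (b + 1),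
        (a.choose i : ℂ) * b.choose j * (-1) ^ (i + j) * linCoeff i j := by
    refine sum_congr rfl fun i _ => sum_congr rfl fun j hj => ?_
    rw [← mul_sum, sum_eq_linCoeff (by simp at hj; omega)]
  rw [e] at h
  exact h.congr fun v hv => (pairSum_exp_neg a b hv).symm

theorem hasExp_one_sub_tanhHalf_pow (k : ℕ) :
    ∃ γ, HasExp (fun v => (1 - tanhHalf v) ^ k) 1 (-k) γ := by
  induction k with
  | zero => exact ⟨0, by simpa using HasExp.const 1⟩
  | succ k ih =>
    obtain ⟨γ, h⟩ := ih
    have h1 : HasExp (fun v => 1 - tanhHalf v) 1 (-1) 0 := Tame.zero.congr fun v _ => by ring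
    have h2 := h.mul h1
    rw [show (1 : ℂ) * -1 + -(k : ℂ) * 1 = -((k + 1 : ℕ) : ℂ) by push_cast; ring, one_mul] at h2
    exact ⟨_, by simpa only [pow_succ] using h2⟩

end ClosedSRW

namespace ClosedSRW

open Finset Real Metric Filter Topology

/-! ### Asymptotics of the second moment -/

theorem continuousOn_pairSum {ρ : ℝ} (hρ : 0 < ρ) (hρ1 : ρ < 1) (a b : ℕ) :
    ContinuousOn (pairSum a b) (sphere 0 ρ) := by
  obtain ⟨M, hM⟩ := exists_norm_pairTerm_le hρ1 a b
  refine continuousOn_tsum (u := fun d => M * ρ * ρ ^ d)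
    (fun d => continuousOn_pairTerm hρ hρ1 a b (Nat.succ_ne_zero d))
    ((summable_geometric_of_lt_one hρ.le hρ1).mul_left _) fun d t ht => ?_
  exact (hM t (mem_sphere_zero_iff_norm.1 ht) d).trans_eq (by ring)

theorem exp_neg_inv_sqrt_lt_one {n : ℕ} (hn : 1 ≤ n) : rexp (-(√n)⁻¹) < 1 := by
  rw [exp_lt_one_iff, neg_lt_zero, inv_pos, sqrt_pos]
  exact_mod_cast hn

theorem centralBinom_sub {n : ℕ} (hn : 1 ≤ n) :
    ((n.centralBinom : ℂ) - 4 * ((n - 1).centralBinom : ℂ))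
      = -(n.centralBinom : ℂ) / (2 * n - 1) := by
  obtain ⟨n, rfl⟩ : ∃ k, n = k + 1 := ⟨n - 1, by omega⟩
  have h1 : ((n : ℂ) + 1) * (n + 1).centralBinom = 2 * (2 * n + 1) * n.centralBinom := by
    exact_mod_cast Nat.succ_mul_centralBinom_succ n
  have h2 : (2 * (n : ℂ) + 1) ≠ 0 := by exact_mod_cast Nat.succ_ne_zero (2 * n)
  have h3 : 2 * ((n + 1 : ℕ) : ℂ) - 1 = 2 * n + 1 := by
    push_cast
    ring
  rw [h3, Nat.add_sub_cancel, eq_div_iff h2]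
  linear_combination 2 * h1

theorem circleAverage_quadratic_mul_ker {ρ : ℝ} (hρ : 0 < ρ) (hρ1 : ρ < 1) {n : ℕ} (hn : 2 ≤ n)
    (α β γ : ℂ) : circleAverage (fun t => (α + β * cayley t + γ * cayley t ^ 2) * ker n t) 0 ρ
      = β * (-(n.centralBinom : ℂ) / (2 * n - 1)) := by
  have hk := continuousOn_ker hρ hρ1 n
  have hc := continuousOn_cayley hρ hρ1
  have e : (fun t => (α + β * cayley t + γ * cayley t ^ 2) * ker n t) = fun t =>
      α • ker n t + β • (cayley t * ker n t) + γ • (cayley t ^ 2 * ker n t) := by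
    ext t
    simp only [smul_eq_mul]
    ring
  have i1 : CircleIntegrable (fun t => α • ker n t) 0 ρ :=
    ContinuousOn.circleIntegrable hρ.le (by fun_prop)
  have i2 : CircleIntegrable (fun t => β • (cayley t * ker n t)) 0 ρ :=
    ContinuousOn.circleIntegrable hρ.le (by fun_prop)
  have i3 : CircleIntegrable (fun t => γ • (cayley t ^ 2 * ker n t)) 0 ρ :=
    ContinuousOn.circleIntegrable hρ.le (by fun_prop)
  have i12 : CircleIntegrable (fun t => α • ker n t + β • (cayley t * ker n t)) 0 ρ :=
    ContinuousOn.circleIntegrable hρ.le (by fun_prop)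
  rw [e, circleAverage_fun_add i12 i3, circleAverage_fun_add i1 i2, circleAverage_fun_smul,
    circleAverage_fun_smul, circleAverage_fun_smul, circleAverage_ker hρ hρ1 (by omega),
    circleAverage_cayley_sq_mul_ker hρ hρ1 hn]
  have h := circleAverage_cayley_mul_ker hρ hρ1 (n - 1)
  rw [Nat.sub_add_cancel (by omega)] at h
  rw [h, centralBinom_sub (by omega)]
  simp

theorem exists_norm_circleAverage_sub_le {F : ℂ → ℂ} {α β γ : ℂ}
    (hF : HasExp (fun v => F (Complex.exp (-v))) α β γ)
    (hc : ∀ ρ : ℝ, 0 < ρ → ρ < 1 → ContinuousOn F (sphere 0 ρ)) :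
    ∃ C : ℝ, ∀ n : ℕ, 2 ≤ n → ‖circleAverage (fun t => F t * ker n t) 0 (rexp (-(√n)⁻¹))
      - β * (-(n.centralBinom : ℂ) / (2 * n - 1))‖ ≤ C * 4 ^ n * (√n)⁻¹ ^ 5 := by
  obtain ⟨C, hC⟩ := exists_norm_circleAverage_le
    (R := fun t => F t - (α + β * cayley t + γ * cayley t ^ 2)) hF
  refine ⟨C, fun n hn => ?_⟩
  have hρ := exp_pos (-(√n)⁻¹)
  have hρ1 := exp_neg_inv_sqrt_lt_one (show 1 ≤ n by omega)
  have hk := continuousOn_ker hρ hρ1 n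
  have hcy := continuousOn_cayley hρ hρ1
  have hFc := hc _ hρ hρ1
  have h := hC n (by omega)
  simp only [sub_mul] at h
  rw [circleAverage_fun_sub (ContinuousOn.circleIntegrable hρ.le (by fun_prop))
    (ContinuousOn.circleIntegrable hρ.le (by fun_prop)),
    circleAverage_quadratic_mul_ker hρ hρ1 hn] at h
  exact h

/-- The contribution of pairs of distinct points to the second moment tends to
`-2 * pairCoeff a b`. -/
noncomputable def pairCoeff (a b : ℕ) : ℂ := ∑ i ∈ range (a + 1), ∑ j ∈ range (b + 1),
  (a.choose i : ℂ) * b.choose j * (-1) ^ (i + j) * linCoeff i j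

theorem expect_eq (n a b : ℕ) :
    ((expect n fun w => (multRange a w : ℝ) * (multRange b w : ℝ) : ℝ) : ℂ)
      = (∑ w ∈ closedWalks (2 * n), (multRange a w : ℂ) * (multRange b w : ℂ))
        / n.centralBinom := by
  rw [expect, card_closedWalks]
  push_cast
  rfl

theorem exists_norm_expect_sub_le (a b : ℕ) : ∃ C : ℝ, ∀ n : ℕ, 2 ≤ n →
    ‖((expect n fun w => (multRange (a + 1) w : ℝ) * (multRange (b + 1) w : ℝ) : ℝ) : ℂ)
      - ((if a = b then 1 else 0) - 2 * pairCoeff a b)‖ ≤ C * (1 / n) := by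
  set δ : ℂ := if a = b then 1 else 0 with hδ
  have ha : (a : ℂ) + 1 ≠ 0 := by exact_mod_cast Nat.succ_ne_zero a
  obtain ⟨α, γ, h1⟩ := hasExp_pairSum a b
  obtain ⟨γ', h2⟩ := hasExp_one_sub_tanhHalf_pow (a + 1)
  have h3 := (h2.const_mul (δ * (1 / ((a : ℂ) + 1)))).add (h1.const_mul 2)
  obtain ⟨C, hC⟩ := exists_norm_circleAverage_sub_le
    (F := fun t => δ * (1 / ((a : ℂ) + 1)) * (1 - cayley t) ^ (a + 1) + 2 * pairSum a b t) h3
    fun ρ hρ hρ1 => by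
      have hcy := continuousOn_cayley hρ hρ1
      have hp := continuousOn_pairSum hρ hρ1 a b
      fun_prop
  have hC0 : 0 ≤ C := by
    have := (norm_nonneg _).trans (hC 2 le_rfl)
    by_contra hneg
    have h4 : C * 4 ^ 2 * (√(2 : ℕ))⁻¹ ^ 5 < 0 :=
      mul_neg_of_neg_of_pos (mul_neg_of_neg_of_pos (not_le.1 hneg) (by positivity)) (by positivity)
    linarith
  refine ⟨4 * C + ‖δ - 2 * pairCoeff a b‖, fun n hn => ?_⟩
  have hρ := exp_pos (-(√n)⁻¹)
  have hρ1 := exp_neg_inv_sqrt_lt_one (show 1 ≤ n by omega)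
  have h4 := hC n hn
  set A := circleAverage (fun t => (δ * (1 / ((a : ℂ) + 1)) * (1 - cayley t) ^ (a + 1)
    + 2 * pairSum a b t) * ker n t) 0 (rexp (-(√n)⁻¹)) with hA
  have hcb : (n.centralBinom : ℂ) ≠ 0 := by exact_mod_cast Nat.centralBinom_ne_zero n
  have hcb' : (0 : ℝ) < n.centralBinom := by exact_mod_cast Nat.centralBinom_pos n
  have hn0 : (0 : ℝ) < n := by
    have : 0 < n := by omega
    exact_mod_cast this
  have h2n : (2 * (n : ℂ) - 1) ≠ 0 := by
    have : 2 * (n : ℂ) - 1 = ((2 * n - 1 : ℕ) : ℂ) := by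
      rw [Nat.cast_sub (by omega)]
      push_cast
      ring
    rw [this, Nat.cast_ne_zero]
    omega
  have hS : ∑ w ∈ closedWalks (2 * n), (multRange (a + 1) w : ℂ) * (multRange (b + 1) w : ℂ)
      = 2 * n * A := by
    have hk := continuousOn_ker hρ hρ1 n
    have hcy := continuousOn_cayley hρ hρ1
    have hp := continuousOn_pairSum hρ hρ1 a b
    have e : (fun t => (δ * (1 / ((a : ℂ) + 1)) * (1 - cayley t) ^ (a + 1)
        + 2 * pairSum a b t) * ker n t) = fun t =>
        (δ * (1 / ((a : ℂ) + 1))) • ((1 - cayley t) ^ (a + 1) * ker n t)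
          + (2 : ℂ) • (pairSum a b t * ker n t) := by
      ext t
      simp only [smul_eq_mul]
      ring
    rw [sum_closedWalks_eq hρ hρ1 (by omega), hA, e, circleAverage_fun_add
      (ContinuousOn.circleIntegrable hρ.le (by fun_prop))
      (ContinuousOn.circleIntegrable hρ.le (by fun_prop)),
      circleAverage_fun_smul, circleAverage_fun_smul]
    simp only [hδ, smul_eq_mul]
    split_ifs <;> ring
  rw [expect_eq, hS]
  -- The linear coefficient is `-δ + 2 * pairCoeff a b`, and `2n / (2n - 1) = 1 + 1 / (2n - 1)`
  -- separates the limit from an explicit `O(1 / n)` term.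
  have h5 : 2 * n * A / n.centralBinom - (δ - 2 * pairCoeff a b)
      = 2 * n / n.centralBinom * (A - (δ * (1 / ((a : ℂ) + 1)) * (-((a + 1 : ℕ) : ℂ))
        + 2 * pairCoeff a b) * (-(n.centralBinom : ℂ) / (2 * n - 1)))
        + (δ - 2 * pairCoeff a b) * (1 / (2 * n - 1)) := by
    push_cast
    field_simp
    ring
  rw [h5, add_mul (4 * C)]
  refine (norm_add_le _ _).trans (add_le_add ?_ ?_)
  · rw [norm_mul]
    have h6 : ‖2 * (n : ℂ) / n.centralBinom‖ = 2 * n / n.centralBinom := by simp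
    rw [h6]
    refine (mul_le_mul_of_nonneg_left h4 (by positivity)).trans ?_
    -- This costs a factor `2 √n`, so the error is `2n * 2 √n * n ^ (-5/2) = 4 / n` times `C`.
    have h7 := four_pow_le_sqrt_mul_centralBinom (show 1 ≤ n by omega)
    have hs : 0 < √(n : ℝ) := sqrt_pos.2 hn0
    have hsq : √(n : ℝ) ^ 2 = n := sq_sqrt hn0.le
    calc 2 * (n : ℝ) / n.centralBinom * (C * 4 ^ n * (√n)⁻¹ ^ 5)
        ≤ 2 * (n : ℝ) / n.centralBinom * (C * (2 * √n * n.centralBinom) * (√n)⁻¹ ^ 5) := by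
          gcongr
      _ = 4 * C * (1 / n) := by
          have h8 : (√(n : ℝ))⁻¹ ^ 5 = (√(n : ℝ))⁻¹ * (1 / n) * (1 / n) := by
            rw [← hsq]
            field_simp
            rw [hsq]
          rw [h8]
          field_simp
          ring
  · rw [norm_mul]
    refine mul_le_mul_of_nonneg_left ?_ (norm_nonneg _)
    have h9 : (2 * (n : ℂ) - 1) = ((2 * n - 1 : ℝ) : ℂ) := by push_cast; rfl
    have hn2 : (2 : ℝ) ≤ n := by exact_mod_cast hn
    rw [h9, norm_div, norm_one, Complex.norm_real, norm_of_nonneg (by linarith)]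
    exact one_div_le_one_div_of_le hn0 (by linarith)

end ClosedSRW

namespace ClosedSRW

open Finset Real Metric Filter Topology

/-! ### Evaluation of the limit -/

theorem choose_symm_add' (i j : ℕ) : (i + j + 1).choose i = (i + j + 1).choose (j + 1) := by
  rw [add_assoc, Nat.choose_symm_add]

theorem mul_choose_add_one (i j : ℕ) :
    ((i + j + 2 : ℕ) : ℝ) * (i + j + 1).choose i = (i + j + 2).choose (i + 1) * (i + 1) := by
  exact_mod_cast Nat.add_one_mul_choose_eq (i + j + 1) i

theorem mul_choose_add_one' (i j : ℕ) :
    ((i + j + 2 : ℕ) : ℝ) * (i + j + 1).choose j = (i + j + 2).choose (i + 1) * (j + 1) := by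
  have h := mul_choose_add_one j i
  rw [add_comm j i, show i + j + 2 = (i + 1) + (j + 1) by ring, ← Nat.choose_symm_add,
    show (i + 1) + (j + 1) = i + j + 2 by ring] at h
  exact h

theorem mul_choose_add_one_add_one (i j : ℕ) : ((i + j + 2).choose (i + 1) : ℝ) * (i + 1) * (j + 1)
    = (i + j + 2) * (i + j + 1) * (i + j).choose i := by
  have h1 := mul_choose_add_one i j
  have h2 : ((i + j + 1 : ℕ) : ℝ) * (i + j).choose j = (i + j + 1).choose (j + 1) * (j + 1) := by
    exact_mod_cast Nat.add_one_mul_choose_eq (i + j) j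
  rw [← choose_symm_add', ← Nat.choose_symm_add] at h2
  push_cast at h1 h2
  linear_combination (-(j : ℝ) - 1) * h1 - ((i : ℝ) + j + 2) * h2

/-- Matches the weight of `Z` in the theorem with that in `linCoeff`. It vanishes at `i = j = 0`, so
the value of `riemannZeta` at `1` is immaterial. -/
theorem choose_mul_ratio (i j : ℕ) : ((i + j + 2).choose (i + 1) : ℝ)
    * ((((i + 1).choose 2 : ℝ) + (j + 1).choose 2) / (i + j + 2).choose 2)
    = (i + j + 2).choose (i + 1) - 2 * (i + j).choose i := by
  have h := mul_choose_add_one_add_one i j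
  have h1 : (i : ℝ) + j + 2 ≠ 0 := by positivity
  have h2 : (i : ℝ) + j + 1 ≠ 0 := by positivity
  rw [Nat.cast_choose_two, Nat.cast_choose_two, Nat.cast_choose_two]
  push_cast
  rw [show (i : ℝ) + j + 2 - 1 = i + j + 1 by ring]
  field_simp
  linear_combination (-2) * h

theorem choose_add_two (i j : ℕ) : ((i + j + 2).choose (i + 1) : ℝ) - 2 * (i + j).choose i
    = (if i = 0 then 0 else ((i + j).choose (i - 1) : ℝ))
      + if j = 0 then 0 else ((i + j).choose (j - 1) : ℝ) := by
  have h1 : (i + j + 2).choose (i + 1) = (i + j + 1).choose i + (i + j + 1).choose (i + 1) :=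
    Nat.choose_succ_succ _ _
  have h2 : (i + j + 1).choose (i + 1) = (i + j).choose i + (i + j).choose (i + 1) :=
    Nat.choose_succ_succ _ _
  have h3 : ((i + j + 1).choose i : ℝ)
      = (if i = 0 then 0 else ((i + j).choose (i - 1) : ℝ)) + (i + j).choose i := by
    cases i with
    | zero => simp
    | succ i => simp [Nat.choose_succ_succ (i + 1 + j) i]
  have h4 : ((i + j).choose (i + 1) : ℝ) = if j = 0 then 0 else ((i + j).choose (j - 1) : ℝ) := by
    cases j with
    | zero => simp
    | succ j =>
      rw [if_neg (Nat.succ_ne_zero j), Nat.add_sub_cancel,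
        show i + (j + 1) = (i + 1) + j by ring, Nat.choose_symm_add]
  rw [h1, h2]
  push_cast
  rw [h3, h4]
  ring

theorem choose_mul_sub (a i : ℕ) : (a.choose i : ℝ) * (a - i) = a.choose (i + 1) * (i + 1) := by
  by_cases h : i ≤ a
  · have := Nat.choose_succ_right_eq a i
    rw [← Nat.cast_sub h]
    exact_mod_cast this.symm
  · rw [Nat.choose_eq_zero_of_lt (by omega), Nat.choose_eq_zero_of_lt (by omega)]
    simp

theorem sum_shift (a : ℕ) (f g : ℕ → ℝ) (h0 : f 0 = 0) (ha : g a = 0)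
    (h : ∀ i, f (i + 1) = g i) : ∑ i ∈ range (a + 1), f i = ∑ i ∈ range (a + 1), g i := by
  rw [sum_range_succ', sum_range_succ, h0, ha, sum_congr rfl fun i _ => h i]

/-- By `choose_add_two` the left weight is `C(i + j, i - 1) + C(i + j, j - 1)`. Shift `i` in the
first half and `j` in the second, then absorb by `(a - i) C(a, i) = (i + 1) C(a, i + 1)`. This
exchanges the zeta values at `i + j + 1` for those at `i + j + 2`. -/
theorem sum_choose_telescope (a b : ℕ) (g : ℕ → ℝ) :
    ∑ i ∈ range (a + 1), ∑ j ∈ range (b + 1), (a.choose i : ℝ) * b.choose j * (g (i + j)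
      * ((i + j + 2).choose (i + 1) - 2 * (i + j).choose i))
    = ∑ i ∈ range (a + 1), ∑ j ∈ range (b + 1), (a.choose i : ℝ) * b.choose j * (g (i + j + 1)
      * ((i + j + 2).choose (i + 1) * (((a : ℝ) + b - i - j) / (i + j + 2)))) := by
  have h1 : ∀ i j : ℕ, (a.choose i : ℝ) * b.choose j * (g (i + j + 1)
      * ((i + j + 2).choose (i + 1) * (((a : ℝ) + b - i - j) / (i + j + 2))))
      = a.choose (i + 1) * b.choose j * (g (i + j + 1) * (i + j + 1).choose i)
        + a.choose i * b.choose (j + 1) * (g (i + j + 1) * (i + j + 1).choose j) := by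
    intro i j
    have hij : (i : ℝ) + j + 2 ≠ 0 := by positivity
    have e1 := mul_choose_add_one i j
    have e2 := mul_choose_add_one' i j
    have e3 := choose_mul_sub a i
    have e4 := choose_mul_sub b j
    push_cast at e1 e2
    field_simp
    linear_combination (g (i + j + 1) * (i + j + 2).choose (i + 1)) * (b.choose j * e3
      + a.choose i * e4) - g (i + j + 1) * (a.choose (i + 1) * b.choose j * e1
        + a.choose i * b.choose (j + 1) * e2)
  simp only [h1, choose_add_two, mul_add, sum_add_distrib]
  congr 1
  · refine sum_shift a _ _ ?_ ?_ fun i => ?_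
    · simp
    · simp
    · refine sum_congr rfl fun j _ => ?_
      rw [if_neg (Nat.succ_ne_zero i), Nat.add_sub_cancel, show i + 1 + j = i + j + 1 by ring]
  · refine sum_congr rfl fun i _ => ?_
    refine sum_shift b _ _ ?_ ?_ fun j => ?_
    · simp
    · simp
    · rw [if_neg (Nat.succ_ne_zero j), Nat.add_sub_cancel, ← add_assoc]

theorem re_linCoeff (i j : ℕ) : (linCoeff i j).re = (if i + j = 0 then -1 / 4 else 0)
    + (((i + j + 2).choose (i + 1) : ℝ) - 2 * (i + j).choose i) * (riemannZeta (i + j + 1 : ℕ)).re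
      * (1 / 2) ^ (i + j + 2) := by
  unfold linCoeff
  split_ifs with h
  · obtain ⟨rfl, rfl⟩ : i = 0 ∧ j = 0 := by omega
    norm_num
  · have e : (((i + j + 2).choose (i + 1) : ℂ) / 2 - (i + j).choose i) * riemannZeta (i + j + 1 : ℕ)
        * (1 / 2) ^ (i + j + 1) = (((((i + j + 2).choose (i + 1) : ℝ) / 2 - (i + j).choose i)
          * (1 / 2) ^ (i + j + 1) : ℝ) : ℂ) * riemannZeta (i + j + 1 : ℕ) := by
      push_cast
      ring
    rw [e, Complex.re_ofReal_mul]
    ring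

theorem re_pairCoeff (a b : ℕ) : (pairCoeff a b).re = -1 / 4
    + ∑ i ∈ range (a + 1), ∑ j ∈ range (b + 1), (a.choose i : ℝ) * b.choose j * (-1) ^ (i + j)
      * ((((i + j + 2).choose (i + 1) : ℝ) - 2 * (i + j).choose i)
        * (riemannZeta (i + j + 1 : ℕ)).re * (1 / 2) ^ (i + j + 2)) := by
  have h : ∀ i j : ℕ, ((a.choose i : ℂ) * b.choose j * (-1) ^ (i + j) * linCoeff i j).re
      = (a.choose i : ℝ) * b.choose j * (-1) ^ (i + j) * (if i + j = 0 then -1 / 4 else 0)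
        + (a.choose i : ℝ) * b.choose j * (-1) ^ (i + j)
      * ((((i + j + 2).choose (i + 1) : ℝ) - 2 * (i + j).choose i)
        * (riemannZeta (i + j + 1 : ℕ)).re * (1 / 2) ^ (i + j + 2)) := by
    intro i j
    rw [← mul_add, ← re_linCoeff, ← Complex.re_ofReal_mul]
    push_cast
    rfl
  simp only [pairCoeff, Complex.re_sum, h, sum_add_distrib]
  congr 1
  rw [sum_eq_single 0, sum_eq_single 0]
  · simp
  · intro j _ hj
    simp [hj]
  · simp
  · intro i _ hi
    simp [hi]
  · simp

/-- By `sum_choose_telescope` the `ζ` part of the double sum is `-2` times its `Z` part, so the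
whole is minus the `Z` part; `re_pairCoeff` is `-1 / 4` plus the `Z` part. -/
theorem neg_two_mul_re_pairCoeff (a b : ℕ) : -2 * (pairCoeff a b).re = 1 / 2
    + 2 * ∑ i ∈ range (a + 1), ∑ j ∈ range (b + 1), (a.choose i : ℝ) * b.choose j * (-1) ^ (i + j)
      * (i + j + 2).choose (i + 1) * (1 / 2) ^ (i + j + 2)
      * (((a : ℝ) + b - i - j) / (i + j + 2) * (riemannZeta (i + j + 2 : ℕ)).re
        + (((i + 1).choose 2 : ℝ) + (j + 1).choose 2) / (i + j + 2).choose 2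
          * (if i + j = 0 then 0 else (riemannZeta (i + j + 1 : ℕ)).re)) := by
  have h := sum_choose_telescope a b fun q => (-1) ^ q * (1 / 2) ^ q * (riemannZeta (q + 1 : ℕ)).re
  have h1 : ∀ i j : ℕ, (a.choose i : ℝ) * b.choose j * (-1) ^ (i + j)
      * (i + j + 2).choose (i + 1) * (1 / 2) ^ (i + j + 2)
      * (((a : ℝ) + b - i - j) / (i + j + 2) * (riemannZeta (i + j + 2 : ℕ)).re
        + (((i + 1).choose 2 : ℝ) + (j + 1).choose 2) / (i + j + 2).choose 2
          * (if i + j = 0 then 0 else (riemannZeta (i + j + 1 : ℕ)).re))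
      = -(1 / 2) * ((a.choose i : ℝ) * b.choose j * ((-1) ^ (i + j + 1) * (1 / 2) ^ (i + j + 1)
          * (riemannZeta (i + j + 1 + 1 : ℕ)).re
          * ((i + j + 2).choose (i + 1) * (((a : ℝ) + b - i - j) / (i + j + 2)))))
        + (1 / 4) * ((a.choose i : ℝ) * b.choose j * ((-1) ^ (i + j) * (1 / 2) ^ (i + j)
          * (riemannZeta (i + j + 1 : ℕ)).re
          * ((i + j + 2).choose (i + 1) - 2 * (i + j).choose i))) := by
    intro i j
    have e : ((i + j + 2).choose (i + 1) : ℝ)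
        * ((((i + 1).choose 2 : ℝ) + (j + 1).choose 2) / (i + j + 2).choose 2
          * (if i + j = 0 then 0 else (riemannZeta (i + j + 1 : ℕ)).re))
        = ((i + j + 2).choose (i + 1) - 2 * (i + j).choose i)
          * (riemannZeta (i + j + 1 : ℕ)).re := by
      rw [← mul_assoc, choose_mul_ratio]
      -- At `i + j = 0` the convention `Z(2) = 0` agrees with the factor `2 - 2 = 0` in front of
      -- `riemannZeta 1`.
      split_ifs with h0
      · obtain ⟨rfl, rfl⟩ : i = 0 ∧ j = 0 := by omega
        norm_num
      · rfl
    rw [show i + j + 1 + 1 = i + j + 2 by ring]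
    linear_combination ((a.choose i : ℝ) * b.choose j * (-1) ^ (i + j) * (1 / 2) ^ (i + j + 2)) * e
  have h2 : ∀ i j : ℕ, (a.choose i : ℝ) * b.choose j * (-1) ^ (i + j)
      * ((((i + j + 2).choose (i + 1) : ℝ) - 2 * (i + j).choose i)
        * (riemannZeta (i + j + 1 : ℕ)).re * (1 / 2) ^ (i + j + 2))
      = (1 / 4) * ((a.choose i : ℝ) * b.choose j * ((-1) ^ (i + j) * (1 / 2) ^ (i + j)
          * (riemannZeta (i + j + 1 : ℕ)).re
          * ((i + j + 2).choose (i + 1) - 2 * (i + j).choose i))) := by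
    intro i j
    ring
  simp only [re_pairCoeff, h1, h2, sum_add_distrib, ← mul_sum]
  rw [← h]
  ring

theorem sum_Icc_one (a : ℕ) (f : ℕ → ℝ) :
    ∑ r ∈ Icc 1 (a + 1), f r = ∑ i ∈ range (a + 1), f (i + 1) := by
  rw [range_eq_Ico, sum_Ico_add' f 0 (a + 1) 1]
  rfl

end ClosedSRW

theorem mainTheorem10 (k₁ k₂ : ℕ) (hk₁ : 1 ≤ k₁) (hk₂ : 1 ≤ k₂) :
    (fun n : ℕ =>
      ClosedSRW.expect n
          (fun w => (ClosedSRW.multRange k₁ w : ℝ) * (ClosedSRW.multRange k₂ w : ℝ))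
        - ((if k₁ = k₂ then (1 : ℝ) else 0) + 1 / 2
            + 2 * ∑ r₁ ∈ Finset.Icc 1 k₁, ∑ r₂ ∈ Finset.Icc 1 k₂,
                ((k₁ - 1).choose (r₁ - 1) : ℝ) * ((k₂ - 1).choose (r₂ - 1) : ℝ)
                  * (-1 : ℝ) ^ (r₁ + r₂) * ((r₁ + r₂).choose r₁ : ℝ)
                  * (1 / (2 : ℝ) ^ (r₁ + r₂))
                  * (((k₁ : ℝ) + (k₂ : ℝ) - (r₁ : ℝ) - (r₂ : ℝ)) / ((r₁ : ℝ) + (r₂ : ℝ))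
                        * (riemannZeta ((r₁ : ℂ) + (r₂ : ℂ))).re
                      + ((r₁.choose 2 : ℝ) + (r₂.choose 2 : ℝ)) / ((r₁ + r₂).choose 2 : ℝ)
                        * (if r₁ + r₂ = 2 then (0 : ℝ)
                            else (riemannZeta ((r₁ : ℂ) + (r₂ : ℂ) - 1)).re))))
      =O[Filter.atTop] (fun n : ℕ => 1 / (n : ℝ)) := by
  obtain ⟨a, rfl⟩ : ∃ a, k₁ = a + 1 := ⟨k₁ - 1, by omega⟩
  obtain ⟨b, rfl⟩ : ∃ b, k₂ = b + 1 := ⟨k₂ - 1, by omega⟩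
  have key : ∀ i j : ℕ, ((a + 1 - 1).choose (i + 1 - 1) : ℝ) * ((b + 1 - 1).choose (j + 1 - 1) : ℝ)
      * (-1 : ℝ) ^ (i + 1 + (j + 1)) * ((i + 1 + (j + 1)).choose (i + 1) : ℝ)
      * (1 / (2 : ℝ) ^ (i + 1 + (j + 1)))
      * ((((a + 1 : ℕ) : ℝ) + ((b + 1 : ℕ) : ℝ) - ((i + 1 : ℕ) : ℝ) - ((j + 1 : ℕ) : ℝ))
          / (((i + 1 : ℕ) : ℝ) + ((j + 1 : ℕ) : ℝ))
          * (riemannZeta (((i + 1 : ℕ) : ℂ) + ((j + 1 : ℕ) : ℂ))).re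
        + (((i + 1).choose 2 : ℝ) + ((j + 1).choose 2 : ℝ)) / ((i + 1 + (j + 1)).choose 2 : ℝ)
          * (if i + 1 + (j + 1) = 2 then (0 : ℝ)
            else (riemannZeta (((i + 1 : ℕ) : ℂ) + ((j + 1 : ℕ) : ℂ) - 1)).re))
      = (a.choose i : ℝ) * b.choose j * (-1) ^ (i + j)
      * (i + j + 2).choose (i + 1) * (1 / 2) ^ (i + j + 2)
      * (((a : ℝ) + b - i - j) / (i + j + 2) * (riemannZeta (i + j + 2 : ℕ)).re
        + (((i + 1).choose 2 : ℝ) + (j + 1).choose 2) / (i + j + 2).choose 2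
          * (if i + j = 0 then 0 else (riemannZeta (i + j + 1 : ℕ)).re)) := by
    intro i j
    have e1 : ((i + 1 : ℕ) : ℂ) + ((j + 1 : ℕ) : ℂ) = ((i + j + 2 : ℕ) : ℂ) := by
      push_cast
      ring
    have e2 : ((i + j + 2 : ℕ) : ℂ) - 1 = ((i + j + 1 : ℕ) : ℂ) := by
      push_cast
      ring
    have e3 : ((i + 1 : ℕ) : ℝ) + ((j + 1 : ℕ) : ℝ) = i + j + 2 := by
      push_cast
      ring
    have e4 : ((a + 1 : ℕ) : ℝ) + ((b + 1 : ℕ) : ℝ) - ((i + 1 : ℕ) : ℝ) - ((j + 1 : ℕ) : ℝ)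
        = a + b - i - j := by
      push_cast
      ring
    have e5 : (i + j + 2 = 2) = (i + j = 0) := by simp
    rw [e1, e2, e3, e4, show i + 1 + (j + 1) = i + j + 2 by ring, pow_add (-1 : ℝ) (i + j) 2,
      ← one_div_pow]
    simp only [e5, Nat.add_sub_cancel]
    ring
  obtain ⟨C, hC⟩ := ClosedSRW.exists_norm_expect_sub_le a b
  refine Asymptotics.IsBigO.of_bound C ?_
  filter_upwards [Filter.eventually_ge_atTop 2] with n hn
  -- Taking real parts of the complex estimate makes it unnecessary to know that `pairCoeff` is
  -- real.
  have h := (Complex.abs_re_le_norm _).trans (hC n hn)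
  rw [Real.norm_eq_abs, Real.norm_of_nonneg (by positivity)]
  convert! h using 2
  simp only [ClosedSRW.sum_Icc_one, key]
  have h1 := ClosedSRW.neg_two_mul_re_pairCoeff a b
  have h2 : (2 * ClosedSRW.pairCoeff a b).re = 2 * (ClosedSRW.pairCoeff a b).re := by simp
  have h3 : (if a = b then (1 : ℂ) else 0).re = if a + 1 = b + 1 then (1 : ℝ) else 0 := by
    by_cases hab : a = b <;> simp [hab]
  rw [Complex.sub_re, Complex.sub_re, Complex.ofReal_re, h2, h3]
  linear_combination h1
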